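/- Let $p\in(\frac73,5)$ and $1<q<p$. For $u\in H^1(\mathbb R^3)=H^1(\mathbb R^3;\mathbb C)$ put $$K(u)=\int_{\mathbb R^3}|\nabla u|^2\,dx,\qquad N_s(u)=\int_{\mathbb R^3}|u|^{s+1}\,dx,\qquad E(u)=\tfrac12K(u)+\tfrac1{q+1}N_q(u)-\tfrac1{p+1}N_p(u),$$ $\|u\|_X=K(u)^{1/2}+N_q(u)^{1/(q+1)}$, and for $r>0$ let $S(r^2)=\{u\in H^1(\mathbb R^3):\|u\|_{L^2}^2=r^2\}$. For $k>0$ let $$\Gamma_k(r^2)=\{g\in C([0,1];S(r^2)):\ \|g(0)\|_X^2\le k,\ E(g(1))<0\},\qquad I_k(r^2)=\inf_{g\in\Gamma_k(r^2)}\ \max_{t\in[0,1]}E(g(t)).$$ We say that $E$ has a mountain pass geometry on $S(r^2)$ with parameter $k>0$ if $\Gamma_k(r^2)\neq\emptyset$ and $$I_k(r^2)>\max\Big\{\sup_{g\in\Gamma_k(r^2)}E(g(0)),\ \sup_{g\in\Gamma_k(r^2)}E(g(1))\Big\}.$$ There is $k>0$ such that, for every $r>0$, $E$ has a mountain pass geometry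 on $S(r^2)$ with parameter $k$. Moreover, for each $r>0$ let $k(r)>0$ be any parameter with which $E$ has a mountain pass geometry on $S(r^2)$, and write $I(r^2)=I_{k(r)}(r^2)$. Then for every $\rho>0$ the following holds: if the function $r\mapsto I(r^2)$ is not strictly decreasing on $(0,\rho]$, then there exist $\rho_0\in(0,\rho)$ and $u_0\in S(\rho_0^2)$ such that $u_0$ is a positive (almost everywhere), radially symmetric weak solution of $$-\Delta u+|u|^{q-1}u-|u|^{p-1}u=0\quad\text{in }\mathbb R^3 .$$ -/

import Mathlib

open MeasureTheory
open scoped ContDiff ENNReal ComplexOrder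

noncomputable section

namespace CombinedNLS

/-- Euclidean three-space. -/
abbrev R3 : Type := EuclideanSpace ℝ (Fin 3)

/-- `L²(ℝ³; ℂ)`. -/
abbrev L2 : Type := Lp ℂ 2 (volume : Measure R3)

/-- Square integrable vector fields `L²(ℝ³; ℂ³)`. -/
abbrev L2Vec : Type := Lp (EuclideanSpace ℂ (Fin 3)) 2 (volume : Measure R3)

/-- Real test functions, i.e. elements of `C_c^∞(ℝ³)`. -/
structure IsTest (φ : R3 → ℝ) : Prop where
  contDiff : ContDiff ℝ ∞ φ
  hasCompactSupport : HasCompactSupport φ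

/-- The classical partial derivative `∂ᵢ φ`. -/
def partialDeriv (i : Fin 3) (φ : R3 → ℝ) (x : R3) : ℝ :=
  fderiv ℝ φ x (EuclideanSpace.single i 1)

theorem IsTest.partialDeriv_memLp {φ : R3 → ℝ} (hφ : IsTest φ) (i : Fin 3) :
    MemLp (fun x => (partialDeriv i φ x : ℂ)) 2 volume := by
  have hc : Continuous (fun x => (partialDeriv i φ x : ℂ)) := by
    refine Complex.continuous_ofReal.comp ?_
    exact (hφ.contDiff.continuous_fderiv (by simp)).clm_apply continuous_const
  refine hc.memLp_of_hasCompactSupport ?_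
  have h1 : HasCompactSupport (partialDeriv i φ) :=
    (hφ.hasCompactSupport.fderiv ℝ).comp_left
      (g := fun L : R3 →L[ℝ] ℝ => L (EuclideanSpace.single i 1)) (by simp)
  exact h1.comp_left (g := fun t : ℝ => (t : ℂ)) (by simp)

theorem IsTest.memLp {φ : R3 → ℝ} (hφ : IsTest φ) :
    MemLp (fun x => (φ x : ℂ)) 2 volume :=
  (Complex.continuous_ofReal.comp hφ.contDiff.continuous).memLp_of_hasCompactSupport
    (hφ.hasCompactSupport.comp_left (g := fun t : ℝ => (t : ℂ)) (by simp))

/-- `v` is the weak (distributional) gradient of `u`: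
`∫ u ∂ᵢφ = - ∫ vᵢ φ` for every test function `φ` and `i = 1, 2, 3`. -/
def IsWeakGrad (u : L2) (v : L2Vec) : Prop :=
  ∀ φ : R3 → ℝ, IsTest φ → ∀ i : Fin 3,
    ∫ x, u x * (partialDeriv i φ x : ℂ) = -∫ x, v x i * (φ x : ℂ)

theorem memLp_coord (v : L2Vec) (i : Fin 3) : MemLp (fun x => v x i) 2 volume :=
  (Lp.memLp v).continuousLinearMap_comp
    (EuclideanSpace.proj i : EuclideanSpace ℂ (Fin 3) →L[ℂ] ℂ)

/-- The Sobolev space `H¹(ℝ³; ℂ)`: a function in `L²` together with its (unique) weak gradient,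
which is in `L²` as well. The norm is `(‖u‖₂² + ‖∇u‖₂²)^(1/2)`. -/
def H1 : Submodule ℂ (WithLp 2 (L2 × L2Vec)) where
  carrier := {w | IsWeakGrad w.fst w.snd}
  zero_mem' := by
    intro φ hφ i
    simp
  add_mem' := by
    intro a b ha hb φ hφ i
    have h1 : ∫ x, (a.fst + b.fst) x * (partialDeriv i φ x : ℂ)
        = (∫ x, a.fst x * (partialDeriv i φ x : ℂ)) + ∫ x, b.fst x * (partialDeriv i φ x : ℂ) := by
      refine Eq.trans ?_ (integral_add ((Lp.memLp a.fst).integrable_mul (hφ.partialDeriv_memLp i))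
        ((Lp.memLp b.fst).integrable_mul (hφ.partialDeriv_memLp i)))
      refine integral_congr_ae ?_
      filter_upwards [Lp.coeFn_add a.fst b.fst] with x hx
      simp only [hx, Pi.add_apply, add_mul, PiLp.add_apply]
    have h2 : ∫ x, (a.snd + b.snd) x i * (φ x : ℂ)
        = (∫ x, a.snd x i * (φ x : ℂ)) + ∫ x, b.snd x i * (φ x : ℂ) := by
      refine Eq.trans ?_ (integral_add ((memLp_coord a.snd i).integrable_mul hφ.memLp)
        ((memLp_coord b.snd i).integrable_mul hφ.memLp))
      refine integral_congr_ae ?_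
      filter_upwards [Lp.coeFn_add a.snd b.snd] with x hx
      simp only [hx, Pi.add_apply, add_mul, PiLp.add_apply]
    simp only [WithLp.add_fst, WithLp.add_snd]
    rw [h1, h2, ha φ hφ i, hb φ hφ i]
    ring
  smul_mem' := by
    intro c a ha φ hφ i
    have h1 : ∫ x, (c • a.fst) x * (partialDeriv i φ x : ℂ)
        = c * ∫ x, a.fst x * (partialDeriv i φ x : ℂ) := by
      rw [← integral_const_mul]
      refine integral_congr_ae ?_
      filter_upwards [Lp.coeFn_smul c a.fst] with x hx
      simp [hx, mul_assoc]
    have h2 : ∫ x, (c • a.snd) x i * (φ x : ℂ) = c * ∫ x, a.snd x i * (φ x : ℂ) := by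
      rw [← integral_const_mul]
      refine integral_congr_ae ?_
      filter_upwards [Lp.coeFn_smul c a.snd] with x hx
      simp [hx, mul_assoc]
    simp only [WithLp.smul_fst, WithLp.smul_snd]
    rw [h1, h2, ha φ hφ i]
    ring

/-- The underlying function of an element of `H¹`. -/
def fn (u : H1) : L2 := (u : WithLp 2 (L2 × L2Vec)).fst

/-- The weak gradient of an element of `H¹`. -/
def grad (u : H1) : L2Vec := (u : WithLp 2 (L2 × L2Vec)).snd

/-- `K(u) = ∫ |∇u|² dx`. -/
def kinetic (u : H1) : ℝ := ∫ x, ‖grad u x‖ ^ 2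

/-- `N_s(u) = ∫ |u|^(s+1) dx`, finite for `u ∈ H¹(ℝ³)` and `1 ≤ s ≤ 5`. -/
def potential (s : ℝ) (u : H1) : ℝ := ∫ x, ‖fn u x‖ ^ (s + 1)

/-- `E(u) = K(u)/2 + N_q(u)/(q+1) - N_p(u)/(p+1)`. -/
def energy (p q : ℝ) (u : H1) : ℝ :=
  1 / 2 * kinetic u + 1 / (q + 1) * potential q u - 1 / (p + 1) * potential p u

/-- `‖u‖_X = K(u)^(1/2) + N_q(u)^(1/(q+1))`. -/
def normX (q : ℝ) (u : H1) : ℝ :=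
  kinetic u ^ (1 / 2 : ℝ) + potential q u ^ (1 / (q + 1))

/-- The mass sphere `S(m) = {u ∈ H¹ : ‖u‖₂² = m}`. -/
def massSphere (m : ℝ) : Set H1 := {u | ‖fn u‖ ^ 2 = m}

/-- The paths `Γ(m)`: continuous (for the `H¹` norm) maps `g : [0,1] → S(m)` with
`‖g(0)‖_X² ≤ k` and `E(g(1)) < 0`. -/
def paths (p q k m : ℝ) : Set C(unitInterval, massSphere m) :=
  {g | normX q (g 0 : H1) ^ 2 ≤ k ∧ energy p q (g 1 : H1) < 0}

/-- The level `I(m) = inf_{g ∈ Γ(m)} max_{t ∈ [0,1]} E(g(t))`, the parameter `k` of `Γ(m)` being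
displayed. -/
def level (p q k m : ℝ) : ℝ :=
  sInf ((fun g : C(unitInterval, massSphere m) => ⨆ t, energy p q (g t : H1)) '' paths p q k m)

/-- Mountain pass geometry of `E` on `S(m)` with parameter `k > 0`: there are paths, and
`I(m)` exceeds both `sup_{g ∈ Γ(m)} E(g(0))` and `sup_{g ∈ Γ(m)} E(g(1))`. -/
structure MountainPassGeometry (p q k m : ℝ) : Prop where
  pos : 0 < k
  nonempty : (paths p q k m).Nonempty
  lt_level :
    max (sSup ((fun g : C(unitInterval, massSphere m) => energy p q (g 0 : H1)) '' paths p q k m))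
        (sSup ((fun g : C(unitInterval, massSphere m) => energy p q (g 1 : H1)) '' paths p q k m))
      < level p q k m

/-- `u` is real valued and positive (almost everywhere, as an element of `L²`). -/
def IsPositive (u : H1) : Prop := ∀ᵐ x, 0 < fn u x

/-- `u` is radially symmetric: it agrees almost everywhere with a function of `|x|`. -/
def IsRadial (u : H1) : Prop := ∃ f : ℝ → ℂ, ∀ᵐ x, fn u x = f ‖x‖

/-- `u` is a weak solution of `-Δu + |u|^(q-1) u - |u|^(p-1) u = 0` in `ℝ³`. -/
def IsZeroMassSolution (p q : ℝ) (u : H1) : Prop :=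
  ∀ φ : R3 → ℝ, IsTest φ →
    (∫ x, ∑ i : Fin 3, grad u x i * (partialDeriv i φ x : ℂ))
      + (∫ x, ((‖fn u x‖ ^ (q - 1) : ℝ) : ℂ) * fn u x * (φ x : ℂ))
      - (∫ x, ((‖fn u x‖ ^ (p - 1) : ℝ) : ℂ) * fn u x * (φ x : ℂ)) = 0

end CombinedNLS

end

/-!
The mountain pass level of `E` on a mass sphere is compared with the infimum of `E` on the part of
the Pohozaev set `{u ≠ 0 : Q u = 0}` that lies on this sphere, where `Q u` is the derivative at
`t = 0` of the energy along the mass preserving dilations `u_t x = exp (3t/2) u (exp t x)`. Since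
`p > 7/3`, the power `N_p` grows fastest along dilations, and Bernoulli's inequality gives
`E (u_t) ≤ E u + c(t) Q u` with `c(t) = (exp (bt) - 1) / b` (`energy_dilate_le`). Hence a function
on the Pohozaev set maximizes the energy on its dilation orbit, the orbit is an admissible path,
and the level is at most the energy (`level_le_energy`). Conversely, under mountain pass geometry
every admissible path crosses the Pohozaev set, because otherwise the orbit of its starting point
would be a better path (`MountainPassGeometry.exists_pohozaev`). A widely spread function adds mass
without changing kinetic energy and powers, so the level for the mass `r²` is also a lower bound
for the energy on the Pohozaev set at all masses up to `r²` (`level_le_energy_of_norm_le`).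

That one parameter `k` serves all masses follows from interpolating `N_p` between `N_q` and
`∫ |u|⁶`: the term with `N_q` is absorbed by the energy, and the other one is cubic in the kinetic
energy by Sobolev's inequality (`exists_energy_ge`, `exists_mountainPassGeometry`).

If the level is not strictly decreasing, there are `r₁ < r₂` such that the level for `r₁` is at
most the level for `r₂`. A minimizing sequence for `r₁` on the Pohozaev set is symmetrized and
dilated back to the Pohozaev set. Radial decrease gives uniform decay at infinity, and local
compactness does the rest: a limit exists on which `K` and `N_q` do not increase and `N_p` does not
decrease (`exists_radial_limit`). Dilating once more yields a minimizer `u` with mass at most `r₁²`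
(`exists_minimizer`); its mass may have dropped, but its energy is at most that of all functions on
the Pohozaev set with mass up to `r₂²`. So `u` is an interior minimum, with no constraint on the
mass, and since `E (u_t) - E u` is controlled by `Q u` with a small factor, the Pohozaev constraint
produces no multiplier either: `u` solves the equation (`energy_variation`). If the radially
decreasing function `u` vanished outside a ball, testing the equation against a barrier at the
boundary of that ball would lead to a contradiction (`HasProfile.pos`).

The tools that Sobolev spaces usually provide are replaced by the nonlocal energies
`∫∫_{|x - y| < ε} |u y - u x|²`. They are bounded by the kinetic energy
(`nonlocalEnergy_fn_le`), they are lower semicontinuous for convergence almost everywhere, and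
their bounds characterize `H¹` (`exists_H1_of_nonlocalEnergy_le`). Together with averages over
balls they give local compactness (`exists_subseq_tendsto`). They do not increase under
polarization at a half-space (`nonlocalEnergy_polarize_le`); symmetrization is then obtained by
maximizing a weighted integral in a compact class that is stable under polarization, since the
maximizer is polarized with respect to all half-spaces that contain the origin, and hence radially
decreasing (`SymmClass.exists_polarized`, `radiallyDecreasing_of_polarized`).
-/

noncomputable section

namespace CombinedNLS

/-! ### Square integrals and mollification -/

theorem lintegral_mul_sq_le {α : Type*} [MeasurableSpace α] {μ : Measure α} {f g : α → ℝ≥0∞}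
    (hf : AEMeasurable f μ) (hg : AEMeasurable g μ) :
    (∫⁻ x, f x * g x ∂μ) ^ 2 ≤ (∫⁻ x, f x ^ 2 ∂μ) * ∫⁻ x, g x ^ 2 ∂μ := by
  have h := ENNReal.lintegral_mul_le_Lp_mul_Lq μ (p := 2) (q := 2)
    Real.HolderConjugate.two_two hf hg
  calc (∫⁻ x, f x * g x ∂μ) ^ 2
      ≤ ((∫⁻ x, f x ^ (2 : ℝ) ∂μ) ^ (1 / 2 : ℝ) * (∫⁻ x, g x ^ (2 : ℝ) ∂μ) ^ (1 / 2 : ℝ)) ^ 2 := by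
        gcongr; simpa using h
    _ = _ := by
        rw [mul_pow]
        simp only [← ENNReal.rpow_natCast, ← ENNReal.rpow_mul]
        norm_num

theorem lintegral_sq_le {α : Type*} [MeasurableSpace α] {μ : Measure α} {g : α → ℝ≥0∞}
    (hg : AEMeasurable g μ) :
    (∫⁻ x, g x ∂μ) ^ 2 ≤ μ Set.univ * ∫⁻ x, g x ^ 2 ∂μ := by
  simpa using lintegral_mul_sq_le (μ := μ) (f := fun _ => 1) aemeasurable_const hg

theorem eLpNorm_two_sq {α : Type*} [MeasurableSpace α] {μ : Measure α} {F : Type*}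
    [NormedAddCommGroup F] (f : α → F) :
    eLpNorm f 2 μ ^ 2 = ∫⁻ x, ‖f x‖ₑ ^ 2 ∂μ := by
  have := eLpNorm_nnreal_pow_eq_lintegral (μ := μ) (f := f) (p := 2) (by norm_num)
  simp only [NNReal.coe_ofNat, ENNReal.coe_ofNat, ENNReal.rpow_ofNat] at this
  exact this

/-- Averaging a square integrable function against a probability density does not increase its
norm. -/
theorem lintegral_mollify_sq_le {F : Type*} [NormedAddCommGroup F] [NormedSpace ℝ F]
    {ρ : R3 → ℝ} (hρ : Continuous ρ) (h0 : ∀ x, 0 ≤ ρ x)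
    (h1 : ∫⁻ x, ENNReal.ofReal (ρ x) = 1) {v : R3 → F} (hv : StronglyMeasurable v) :
    ∫⁻ x, ‖∫ t, ρ t • v (x - t)‖ₑ ^ 2 ≤ ∫⁻ x, ‖v x‖ₑ ^ 2 := by
  set ν : Measure R3 := volume.withDensity (fun t => ENNReal.ofReal (ρ t)) with hν
  have hρm : Measurable fun t => ENNReal.ofReal (ρ t) := by fun_prop
  have hνu : ν Set.univ = 1 := by simp [hν, h1]
  have hve : Measurable fun x => ‖v x‖ₑ := hv.enorm
  have key : ∀ x, ‖∫ t, ρ t • v (x - t)‖ₑ ^ 2 ≤ ∫⁻ t, ENNReal.ofReal (ρ t) * ‖v (x - t)‖ₑ ^ 2 := by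
    intro x
    have hm : Measurable fun t => ‖v (x - t)‖ₑ := hve.comp (by fun_prop)
    calc ‖∫ t, ρ t • v (x - t)‖ₑ ^ 2 ≤ (∫⁻ t, ‖ρ t • v (x - t)‖ₑ) ^ 2 := by
          gcongr; exact enorm_integral_le_lintegral_enorm _
      _ = (∫⁻ t, ‖v (x - t)‖ₑ ∂ν) ^ 2 := by
          rw [hν, lintegral_withDensity_eq_lintegral_mul _ hρm hm]
          congr 1
          refine lintegral_congr fun t => ?_
          rw [enorm_smul, Real.enorm_eq_ofReal (h0 t)]; rfl
      _ ≤ ν Set.univ * ∫⁻ t, ‖v (x - t)‖ₑ ^ 2 ∂ν := lintegral_sq_le hm.aemeasurable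
      _ = _ := by
          rw [hνu, one_mul, hν, lintegral_withDensity_eq_lintegral_mul _ hρm (hm.pow_const 2)]
          rfl
  calc ∫⁻ x, ‖∫ t, ρ t • v (x - t)‖ₑ ^ 2
      ≤ ∫⁻ x, ∫⁻ t, ENNReal.ofReal (ρ t) * ‖v (x - t)‖ₑ ^ 2 := lintegral_mono key
    _ = ∫⁻ t, ∫⁻ x, ENNReal.ofReal (ρ t) * ‖v (x - t)‖ₑ ^ 2 := by
        refine lintegral_lintegral_swap (Measurable.aemeasurable ?_)
        have : Measurable fun z : R3 × R3 => z.1 - z.2 := by fun_prop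
        exact (hρm.comp measurable_snd).mul ((hve.comp this).pow_const 2)
    _ = ∫⁻ t, ENNReal.ofReal (ρ t) * ∫⁻ x, ‖v x‖ₑ ^ 2 := by
        refine lintegral_congr fun t => ?_
        rw [lintegral_const_mul' _ _ ENNReal.ofReal_ne_top,
          lintegral_sub_right_eq_self (fun x => ‖v x‖ₑ ^ 2) t]
    _ = _ := by rw [lintegral_mul_const _ hρm, h1, one_mul]

/-- The classical gradient of a complex function, as a vector of `ℂ³`. -/
def cgrad (f : R3 → ℂ) (x : R3) : EuclideanSpace ℂ (Fin 3) :=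
  WithLp.toLp 2 fun i => fderiv ℝ f x (EuclideanSpace.single i 1)

theorem isTest_translate_reflect {η : R3 → ℝ} (hη : IsTest η) (x : R3) :
    IsTest (fun y => η (x - y)) where
  contDiff := hη.contDiff.comp (by fun_prop)
  hasCompactSupport := hη.hasCompactSupport.comp_homeomorph (Homeomorph.subLeft x)

theorem partialDeriv_translate_reflect {η : R3 → ℝ} (hη : IsTest η) (x y : R3) (i : Fin 3) :
    partialDeriv i (fun y => η (x - y)) y = - partialDeriv i η (x - y) := by
  have h1 : HasFDerivAt η (fderiv ℝ η (x - y)) (x - y) :=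
    (hη.contDiff.differentiable (by simp) _).hasFDerivAt
  have h2 : HasFDerivAt (fun y : R3 => x - y) (-ContinuousLinearMap.id ℝ R3) y :=
    (hasFDerivAt_id y).const_sub x
  have h3 := h1.comp y h2
  have h4 : fderiv ℝ (fun y => η (x - y)) y = _ := h3.fderiv
  simp [partialDeriv, h4]

theorem fn_memLp (u : H1) : MemLp (fn u) 2 volume := Lp.memLp _

theorem grad_memLp (u : H1) : MemLp (grad u) 2 volume := Lp.memLp _

theorem fn_locallyIntegrable (u : H1) : LocallyIntegrable (fn u) volume :=
  (fn_memLp u).locallyIntegrable (by norm_num)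

theorem grad_locallyIntegrable (u : H1) : LocallyIntegrable (grad u) volume :=
  (grad_memLp u).locallyIntegrable (by norm_num)

/-- Mollification commutes with the weak gradient. -/
theorem cgrad_mollify (u : H1) {η : R3 → ℝ} (hη : IsTest η) (x : R3) :
    cgrad (fun x => ∫ t, η t • fn u (x - t)) x = ∫ t, η t • grad u (x - t) := by
  have hc : (fun x => ∫ t, η t • fn u (x - t))
      = convolution η (fn u) (ContinuousLinearMap.lsmul ℝ ℝ) volume := rfl
  have hd := hη.hasCompactSupport.hasFDerivAt_convolution_left
    (ContinuousLinearMap.lsmul ℝ ℝ : ℝ →L[ℝ] ℂ →L[ℝ] ℂ) (hη.contDiff.of_le (by simp))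
    (fn_locallyIntegrable u) x
  have hint : Integrable (fun t => η t • grad u (x - t)) := by
    have := (hη.hasCompactSupport.convolutionExists_left
      (ContinuousLinearMap.lsmul ℝ ℝ : ℝ →L[ℝ] _ →L[ℝ] EuclideanSpace ℂ (Fin 3))
      hη.contDiff.continuous (grad_locallyIntegrable u)) x
    exact this
  have hint2 : Integrable (fun t => (ContinuousLinearMap.precompL R3
      (ContinuousLinearMap.lsmul ℝ ℝ : ℝ →L[ℝ] ℂ →L[ℝ] ℂ)) (fderiv ℝ η t) (fn u (x - t))) := by
    have := ((hη.hasCompactSupport.fderiv ℝ).convolutionExists_left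
      (ContinuousLinearMap.precompL R3 (ContinuousLinearMap.lsmul ℝ ℝ : ℝ →L[ℝ] ℂ →L[ℝ] ℂ))
      (hη.contDiff.continuous_fderiv (by simp)) (fn_locallyIntegrable u)) x
    exact this
  ext i
  have e1 : (∫ t, η t • grad u (x - t)) i = ∫ t, (η t • grad u (x - t)) i :=
    ((EuclideanSpace.proj i : EuclideanSpace ℂ (Fin 3) →L[ℂ] ℂ).integral_comp_comm hint).symm
  rw [e1, cgrad, hc, hd.fderiv]
  have e2 : (convolution (fderiv ℝ η) (fn u) (ContinuousLinearMap.precompL R3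
      (ContinuousLinearMap.lsmul ℝ ℝ : ℝ →L[ℝ] ℂ →L[ℝ] ℂ)) volume x) (EuclideanSpace.single i 1)
      = ∫ t, partialDeriv i η t • fn u (x - t) := by
    rw [convolution, ContinuousLinearMap.integral_apply hint2]
    rfl
  change (convolution (fderiv ℝ η) (fn u) (ContinuousLinearMap.precompL R3
      (ContinuousLinearMap.lsmul ℝ ℝ : ℝ →L[ℝ] ℂ →L[ℝ] ℂ)) volume x) (EuclideanSpace.single i 1) = _
  rw [e2]
  have hw := u.2 _ (isTest_translate_reflect hη x) i
  simp only [partialDeriv_translate_reflect hη] at hw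
  have s1 : ∫ t, partialDeriv i η t • fn u (x - t) = ∫ y, partialDeriv i η (x - y) • fn u y := by
    rw [← integral_sub_left_eq_self _ _ x]
    simp
  have s2 : ∫ t, (η t • grad u (x - t)) i = ∫ y, (η (x - y) • grad u y) i := by
    rw [← integral_sub_left_eq_self _ _ x]
    simp
  rw [s1, s2]
  have l : ∫ y, partialDeriv i η (x - y) • fn u y
      = - ∫ y, (fn u y) * ((-partialDeriv i η (x - y) : ℝ) : ℂ) := by
    rw [← integral_neg]
    refine integral_congr_ae (Filter.Eventually.of_forall fun y => ?_)
    simp [mul_comm]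
  have r : ∫ y, (η (x - y) • grad u y) i = ∫ y, grad u y i * (η (x - y) : ℂ) := by
    refine integral_congr_ae (Filter.Eventually.of_forall fun y => ?_)
    simp [mul_comm]
  rw [l, r]
  change -(∫ y, fn u y * _) = _
  rw [show (∫ y, fn u y * ((-partialDeriv i η (x - y) : ℝ) : ℂ)) = _ from hw, neg_neg]
  rfl


theorem eLpNorm_mollify_le {F : Type*} [NormedAddCommGroup F] [NormedSpace ℝ F]
    {ρ : R3 → ℝ} (hρ : Continuous ρ) (h0 : ∀ x, 0 ≤ ρ x)
    (h1 : ∫⁻ x, ENNReal.ofReal (ρ x) = 1) {v : R3 → F} (hv : StronglyMeasurable v) :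
    eLpNorm (fun x => ∫ t, ρ t • v (x - t)) 2 volume ≤ eLpNorm v 2 volume := by
  have := lintegral_mollify_sq_le hρ h0 h1 hv
  rw [← eLpNorm_two_sq, ← eLpNorm_two_sq] at this
  exact (ENNReal.pow_le_pow_left_iff two_ne_zero).1 this

theorem norm_toLp_le_sum (w : Fin 3 → ℂ) :
    ‖(WithLp.toLp 2 w : EuclideanSpace ℂ (Fin 3))‖ ≤ ∑ i, ‖w i‖ := by
  have h : (WithLp.toLp 2 w : EuclideanSpace ℂ (Fin 3))
      = ∑ i, EuclideanSpace.single i (w i) := by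
    ext j
    simp [Finset.sum_apply, Pi.single_apply]
  rw [h]
  exact (norm_sum_le _ _).trans (by simp)

theorem cgrad_smul {χ : R3 → ℝ} {m : R3 → ℂ} {x : R3} (hχ : DifferentiableAt ℝ χ x)
    (hm : DifferentiableAt ℝ m x) :
    cgrad (fun y => χ y • m y) x
      = χ x • cgrad m x + m x • WithLp.toLp 2 (fun i => (partialDeriv i χ x : ℂ)) := by
  ext i
  simp only [cgrad, PiLp.add_apply, PiLp.smul_apply, fderiv_fun_smul hχ hm]
  simp [partialDeriv, mul_comm]

/-- Density of smooth compactly supported functions in `H¹`, in the form needed to transfer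
inequalities: almost everywhere convergence, with control of the gradient norms. -/
theorem exists_smooth_approx (u : H1) :
    ∃ (C : ℝ≥0∞) (f : ℕ → R3 → ℂ), C ≠ ⊤ ∧ (∀ n, ContDiff ℝ ∞ (f n)) ∧
      (∀ n, HasCompactSupport (f n)) ∧
      (∀ᵐ x, Filter.Tendsto (fun n => f n x) Filter.atTop (nhds (fn u x))) ∧
      ∀ n : ℕ, eLpNorm (cgrad (f n)) 2 volume
        ≤ eLpNorm (grad u) 2 volume + C * ENNReal.ofReal (1 / ((n : ℝ) + 1)) := by
  let φ : ℕ → ContDiffBump (0 : R3) := fun n =>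
    ⟨1 / ((n : ℝ) + 1), 2 * (1 / ((n : ℝ) + 1)), by positivity,
      lt_mul_of_one_lt_left (by positivity) (by norm_num)⟩
  let η : ℕ → R3 → ℝ := fun n => (φ n).normed volume
  have hη : ∀ n, IsTest (η n) := fun n =>
    ⟨(φ n).contDiff_normed, (φ n).hasCompactSupport_normed⟩
  let m : ℕ → R3 → ℂ := fun n x => ∫ t, η n t • fn u (x - t)
  have hη0 : ∀ n x, 0 ≤ η n x := fun n x => (φ n).nonneg_normed x
  have hη1 : ∀ n, ∫⁻ x, ENNReal.ofReal (η n x) = 1 := by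
    intro n
    rw [← ofReal_integral_eq_lintegral_ofReal]
    · rw [(φ n).integral_normed]; simp
    · exact (hη n).contDiff.continuous.integrable_of_hasCompactSupport (hη n).hasCompactSupport
    · exact Filter.Eventually.of_forall (hη0 n)
  have hms : ∀ n, ContDiff ℝ ∞ (m n) := fun n =>
    (hη n).hasCompactSupport.contDiff_convolution_left
      (ContinuousLinearMap.lsmul ℝ ℝ : ℝ →L[ℝ] ℂ →L[ℝ] ℂ) (hη n).contDiff
      (fn_locallyIntegrable u)
  have hmt : ∀ᵐ x, Filter.Tendsto (fun n => m n x) Filter.atTop (nhds (fn u x)) := by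
    refine ContDiffBump.ae_convolution_tendsto_right_of_locallyIntegrable (φ := φ) (K := 2)
      ?_ ?_ (fn_locallyIntegrable u)
    · have := (tendsto_one_div_add_atTop_nhds_zero_nat (𝕜 := ℝ)).const_mul 2
      simpa [φ] using this
    · exact Filter.Eventually.of_forall fun n => le_rfl
  have hmL : ∀ n, eLpNorm (m n) 2 volume ≤ eLpNorm (fn u) 2 volume := fun n =>
    eLpNorm_mollify_le (hη n).contDiff.continuous (hη0 n) (hη1 n) (Lp.stronglyMeasurable _)
  have hgL : ∀ n, eLpNorm (cgrad (m n)) 2 volume ≤ eLpNorm (grad u) 2 volume := by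
    intro n
    have : cgrad (m n) = fun x => ∫ t, η n t • grad u (x - t) :=
      funext fun x => cgrad_mollify u (hη n) x
    rw [this]
    exact eLpNorm_mollify_le (hη n).contDiff.continuous (hη0 n) (hη1 n) (Lp.stronglyMeasurable _)
  let χ : ContDiffBump (0 : R3) := ⟨1, 2, one_pos, one_lt_two⟩
  have hχt : IsTest χ := ⟨χ.contDiff, χ.hasCompactSupport⟩
  obtain ⟨M, hM⟩ : ∃ M : ℝ, ∀ x, ‖fderiv ℝ χ x‖ ≤ M :=
    (hχt.hasCompactSupport.fderiv ℝ).exists_bound_of_continuous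
      (hχt.contDiff.continuous_fderiv (by simp))
  let c : ℕ → ℝ := fun n => 1 / ((n : ℝ) + 1)
  have hc : ∀ n, 0 < c n := fun n => by positivity
  let X : ℕ → R3 → ℝ := fun n x => χ (c n • x)
  have hXs : ∀ n, ContDiff ℝ ∞ (X n) := fun n => hχt.contDiff.comp (by fun_prop)
  have hXc : ∀ n, HasCompactSupport (X n) := fun n =>
    hχt.hasCompactSupport.comp_smul (hc n).ne'
  have hXd : ∀ n x i, |partialDeriv i (X n) x| ≤ c n * M := by
    intro n x i
    have h1 : HasFDerivAt (χ : R3 → ℝ) (fderiv ℝ χ (c n • x)) (c n • x) :=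
      (hχt.contDiff.differentiable (by simp) _).hasFDerivAt
    have h2 : HasFDerivAt (fun y : R3 => c n • y) (c n • ContinuousLinearMap.id ℝ R3) x :=
      (hasFDerivAt_id x).const_smul (c n)
    have h3 : fderiv ℝ (X n) x = _ := (h1.comp x h2).fderiv
    have h4 : |fderiv ℝ χ (c n • x) (EuclideanSpace.single i 1)| ≤ M :=
      ((fderiv ℝ χ (c n • x)).le_opNorm _).trans (by simpa using hM _)
    simp only [partialDeriv, h3]
    simp only [ContinuousLinearMap.comp_apply, _root_.smul_apply,
      ContinuousLinearMap.id_apply, map_smul, smul_eq_mul, abs_mul, abs_of_pos (hc n)]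
    exact mul_le_mul_of_nonneg_left h4 (hc n).le
  refine ⟨ENNReal.ofReal (3 * M) * eLpNorm (fn u) 2 volume, fun n x => X n x • m n x,
    ENNReal.mul_ne_top ENNReal.ofReal_ne_top (fn_memLp u).2.ne,
    fun n => (hXs n).smul (hms n), fun n => (hXc n).smul_right, ?_, ?_⟩
  · filter_upwards [hmt] with x hx
    refine hx.congr' ?_
    have h0 : Filter.Tendsto (fun n => ‖c n • x‖) Filter.atTop (nhds 0) := by
      have := ((tendsto_one_div_add_atTop_nhds_zero_nat (𝕜 := ℝ)).smul_const x).norm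
      simpa [c] using this
    filter_upwards [h0.eventually (gt_mem_nhds one_pos)] with n hn
    have : X n x = 1 := χ.one_of_mem_closedBall (by simpa using hn.le)
    simp [this]
  · intro n
    have hM0 : 0 ≤ M := (norm_nonneg _).trans (hM 0)
    have hpt : ∀ x, ‖cgrad (fun y => X n y • m n y) x‖
        ≤ ‖cgrad (m n) x‖ + ‖((c n * (3 * M) : ℝ) : ℂ) * m n x‖ := by
      intro x
      rw [cgrad_smul ((hXs n).differentiable (by simp) x) ((hms n).differentiable (by simp) x)]
      refine (norm_add_le _ _).trans (add_le_add ?_ ?_)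
      · rw [norm_smul, Real.norm_eq_abs, abs_of_nonneg χ.nonneg]
        exact mul_le_of_le_one_left (norm_nonneg _) χ.le_one
      · rw [norm_smul, norm_mul, mul_comm]
        refine mul_le_mul_of_nonneg_right ?_ (norm_nonneg _)
        refine (norm_toLp_le_sum _).trans ?_
        rw [Complex.norm_real, Real.norm_eq_abs, abs_of_nonneg (by positivity [hc n])]
        calc ∑ i, ‖(partialDeriv i (X n) x : ℂ)‖ ≤ ∑ i : Fin 3, c n * M := by
              refine Finset.sum_le_sum fun i _ => ?_
              rw [Complex.norm_real]; exact hXd n x i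
          _ = _ := by simp; ring
    have hcg : AEStronglyMeasurable (cgrad (m n)) volume := by
      have : Continuous (cgrad (m n)) := by
        refine (PiLp.continuous_toLp 2 _).comp (continuous_pi fun i => ?_)
        exact ((hms n).continuous_fderiv (by simp)).clm_apply continuous_const
      exact this.aestronglyMeasurable
    calc eLpNorm (cgrad (fun y => X n y • m n y)) 2 volume
        ≤ eLpNorm (fun x => ‖cgrad (m n) x‖ + ‖((c n * (3 * M) : ℝ) : ℂ) * m n x‖) 2 volume :=
          eLpNorm_mono_real hpt
      _ ≤ eLpNorm (fun x => ‖cgrad (m n) x‖) 2 volume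
          + eLpNorm (fun x => ‖((c n * (3 * M) : ℝ) : ℂ) * m n x‖) 2 volume :=
          eLpNorm_add_le hcg.norm
            ((hms n).continuous.aestronglyMeasurable.const_mul _).norm (by norm_num)
      _ ≤ _ := by
          rw [eLpNorm_norm, eLpNorm_norm]
          refine add_le_add (hgL n) ?_
          have : (fun x => ((c n * (3 * M) : ℝ) : ℂ) * m n x)
              = ((c n * (3 * M) : ℝ) : ℂ) • m n := rfl
          rw [this, eLpNorm_const_smul]
          have e : ‖((c n * (3 * M) : ℝ) : ℂ)‖ₑ
              = ENNReal.ofReal (3 * M) * ENNReal.ofReal (c n) := by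
            rw [← ENNReal.ofReal_mul (by positivity), ← ofReal_norm, Complex.norm_real,
              Real.norm_eq_abs, abs_of_nonneg (by positivity [hc n]), mul_comm]
          rw [e, mul_right_comm]
          gcongr
          exact hmL n

/-! ### Sobolev inequality -/

theorem norm_fderiv_le_cgrad (f : R3 → ℂ) (x : R3) : ‖fderiv ℝ f x‖ ≤ 3 * ‖cgrad f x‖ := by
  refine ContinuousLinearMap.opNorm_le_bound _ (by positivity) fun h => ?_
  have hh : h = ∑ i, h i • EuclideanSpace.single i (1 : ℝ) := by
    ext j; simp [Finset.sum_apply, Pi.single_apply]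
  have h1 : fderiv ℝ f x h = ∑ i, h i • cgrad f x i := by
    conv_lhs => rw [hh]
    simp [cgrad, map_sum]
  rw [h1]
  calc ‖∑ i, h i • cgrad f x i‖ ≤ ∑ i : Fin 3, ‖h‖ * ‖cgrad f x‖ := by
        refine (norm_sum_le _ _).trans (Finset.sum_le_sum fun i _ => ?_)
        rw [norm_smul]
        exact mul_le_mul (PiLp.norm_apply_le h i) (PiLp.norm_apply_le _ i) (norm_nonneg _)
          (norm_nonneg _)
    _ = _ := by simp; ring

theorem exists_sobolev : ∃ S : NNReal, ∀ u : H1,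
    eLpNorm (fn u) 6 volume ≤ S * eLpNorm (grad u) 2 volume := by
  refine ⟨SNormLESNormFDerivOfEqConst ℂ (volume : Measure R3) 2 * 3, fun u => ?_⟩
  obtain ⟨C, f, hC, hs, hc, ht, hg⟩ := exists_smooth_approx u
  have h1 : ∀ n, eLpNorm (f n) 6 volume
      ≤ (SNormLESNormFDerivOfEqConst ℂ (volume : Measure R3) 2 * 3 : NNReal)
        * (eLpNorm (grad u) 2 volume + C * ENNReal.ofReal (1 / ((n : ℝ) + 1))) := by
    intro n
    have h := eLpNorm_le_eLpNorm_fderiv_of_eq (volume : Measure R3) ((hs n).of_le (by simp)) (hc n)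
      (p := 2) (p' := 6) (by norm_num) (by simp) (by simp; norm_num)
    have h2 : eLpNorm (fderiv ℝ (f n)) 2 volume ≤ (3 : NNReal) • eLpNorm (cgrad (f n)) 2 volume :=
      eLpNorm_le_nnreal_smul_eLpNorm_of_ae_le_mul
        (Filter.Eventually.of_forall fun x => norm_fderiv_le_cgrad (f n) x) 2
    refine h.trans ?_
    push_cast
    rw [mul_assoc]
    gcongr
    refine h2.trans ?_
    rw [ENNReal.smul_def, smul_eq_mul]
    push_cast
    gcongr
    exact hg n
  have h2 := Lp.eLpNorm_lim_le_liminf_eLpNorm (p := 6)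
    (fun n => (hs n).continuous.aestronglyMeasurable) _ ht
  refine h2.trans ((Filter.liminf_le_liminf (Filter.Eventually.of_forall h1)).trans ?_)
  refine le_of_eq (Filter.Tendsto.liminf_eq ?_)
  refine ENNReal.Tendsto.const_mul ?_ (Or.inr ENNReal.coe_ne_top)
  have h3 : Filter.Tendsto (fun n : ℕ => C * ENNReal.ofReal (1 / ((n : ℝ) + 1)))
      Filter.atTop (nhds (C * ENNReal.ofReal 0)) :=
    ENNReal.Tendsto.const_mul
      (ENNReal.tendsto_ofReal tendsto_one_div_add_atTop_nhds_zero_nat) (Or.inr hC)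
  simpa using h3.const_add (eLpNorm (grad u) 2 volume)

/-! ### Nonlocal Dirichlet energies -/

/-- The nonlocal Dirichlet energy `∬_{|x-y|<ε} |u(y) - u(x)|² dy dx`. After division by
`ballMoment ε` it approximates the Dirichlet integral as `ε → 0`. -/
def nonlocalEnergy {F : Type*} [NormedAddCommGroup F] (ε : ℝ) (u : R3 → F) : ℝ≥0∞ :=
  ∫⁻ x, ∫⁻ y in Metric.ball x ε, ‖u y - u x‖ₑ ^ 2

/-- The second moment `∫_{|h|<ε} h₀² dh` of a ball in one coordinate direction. -/
def ballMoment (ε : ℝ) : ℝ := ∫ h in Metric.ball (0 : R3) ε, h 0 ^ 2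

theorem integrableOn_ball_of_continuous {F : Type*} [NormedAddCommGroup F] {f : R3 → F}
    (hf : Continuous f) (x : R3) (ε : ℝ) : IntegrableOn f (Metric.ball x ε) :=
  (hf.continuousOn.integrableOn_compact (isCompact_closedBall x ε)).mono_set
    Metric.ball_subset_closedBall

theorem setIntegral_ball_comp_isometry (T : R3 ≃ₗᵢ[ℝ] R3) (f : R3 → ℝ) (ε : ℝ) :
    ∫ h in Metric.ball (0 : R3) ε, f (T h) = ∫ h in Metric.ball (0 : R3) ε, f h := by
  have h := T.measurePreserving.setIntegral_preimage_emb
    T.toHomeomorph.measurableEmbedding f (Metric.ball 0 ε)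
  rw [← h]
  congr 2
  ext x; simp

theorem integral_ball_mul (ε : ℝ) (i j : Fin 3) :
    ∫ h in Metric.ball (0 : R3) ε, h i * h j = if i = j then ballMoment ε else 0 := by
  split_ifs with hij
  · subst hij
    have h := setIntegral_ball_comp_isometry
      (LinearIsometryEquiv.piLpCongrLeft 2 ℝ ℝ (Equiv.swap i 0)) (fun h => h 0 ^ 2) ε
    rw [ballMoment, ← h]
    congr 1 with x
    simp [LinearIsometryEquiv.piLpCongrLeft_apply, Equiv.piCongrLeft', sq]
  · have h := setIntegral_ball_comp_isometry
      (LinearIsometryEquiv.piLpCongrRight 2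
        (fun k : Fin 3 => if k = i then LinearIsometryEquiv.neg ℝ else
          LinearIsometryEquiv.refl ℝ ℝ)) (fun h => h i * h j) ε
    have h2 : ∫ x in Metric.ball (0 : R3) ε, -(x i * x j)
        = ∫ x in Metric.ball (0 : R3) ε, x i * x j := by
      rw [← h]
      congr 1 with x
      simp [LinearIsometryEquiv.piLpCongrRight_apply, Ne.symm hij]
    rw [integral_neg] at h2
    linarith

theorem ballMoment_pos {ε : ℝ} (hε : 0 < ε) : 0 < ballMoment ε := by
  unfold ballMoment
  have hc : Continuous fun h : R3 => h 0 ^ 2 := by fun_prop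
  refine (integral_pos_iff_support_of_nonneg (fun _ => sq_nonneg _)
    (integrableOn_ball_of_continuous hc 0 ε)).2 ?_
  have ho : IsOpen (Function.support fun h : R3 => h 0 ^ 2) := hc.isOpen_support
  rw [Measure.restrict_apply ho.measurableSet]
  refine (ho.inter Metric.isOpen_ball).measure_pos _ ⟨EuclideanSpace.single 0 (ε / 2), ?_, ?_⟩
  · simp [hε.ne']
  · simp [abs_of_pos hε, hε]

theorem integral_ball_norm_sq (ε : ℝ) :
    ∫ h in Metric.ball (0 : R3) ε, ‖h‖ ^ 2 = 3 * ballMoment ε := by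
  have h1 : ∀ h : R3, ‖h‖ ^ 2 = ∑ i, h i * h i := fun h => by
    rw [EuclideanSpace.norm_sq_eq]; simp [sq]
  simp only [h1]
  rw [integral_finsetSum _ fun i _ =>
    integrableOn_ball_of_continuous (f := fun h : R3 => h i * h i) (by fun_prop) 0 ε]
  simp [integral_ball_mul]

/-- Averaging `|L h|²` over a ball recovers the Hilbert–Schmidt norm of `L`. -/
theorem lintegral_ball_enorm_apply_sq (L : R3 →L[ℝ] ℂ) (ε : ℝ) :
    ∫⁻ h in Metric.ball (0 : R3) ε, ‖L h‖ₑ ^ 2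
      = ENNReal.ofReal (ballMoment ε)
        * ‖(WithLp.toLp 2 fun i => L (EuclideanSpace.single i 1) : EuclideanSpace ℂ (Fin 3))‖ₑ ^ 2 := by
  set z : Fin 3 → ℂ := fun i => L (EuclideanSpace.single i 1) with hz
  have hL : ∀ h : R3, L h = ∑ i, h i • z i := fun h => by
    have hh : h = ∑ i, h i • EuclideanSpace.single i (1 : ℝ) := by
      ext j; simp [Finset.sum_apply, Pi.single_apply]
    conv_lhs => rw [hh]
    simp [hz, map_sum]
  have h1 : ∀ h : R3, ‖L h‖ ^ 2 = ∑ i, ∑ j, (h i * h j) * inner ℝ (z i) (z j) := fun h => by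
    rw [← real_inner_self_eq_norm_sq, hL, sum_inner]
    simp only [inner_sum, inner_smul_left, inner_smul_right, mul_assoc]
    exact Finset.sum_congr rfl fun i _ => Finset.sum_congr rfl fun j _ => by
      simp only [conj_trivial]; ring
  have h2 : ∫ h in Metric.ball (0 : R3) ε, ‖L h‖ ^ 2 = ballMoment ε * ∑ i, ‖z i‖ ^ 2 := by
    simp only [h1]
    rw [integral_finsetSum _ fun i _ => integrableOn_ball_of_continuous (by fun_prop) 0 ε]
    rw [Finset.mul_sum]
    refine Finset.sum_congr rfl fun i _ => ?_
    rw [integral_finsetSum _ fun i _ => integrableOn_ball_of_continuous (by fun_prop) 0 ε]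
    simp only [integral_mul_const, integral_ball_mul, ite_mul, zero_mul, Finset.sum_ite_eq,
      Finset.mem_univ, if_true, real_inner_self_eq_norm_sq]
  have e : ∀ {G : Type} [NormedAddCommGroup G] (w : G), ‖w‖ₑ ^ 2 = ENNReal.ofReal (‖w‖ ^ 2) :=
    fun w => by rw [← ofReal_norm, ENNReal.ofReal_pow (norm_nonneg _)]
  simp only [e]
  rw [← ofReal_integral_eq_lintegral_ofReal
    (integrableOn_ball_of_continuous (by fun_prop) 0 ε)
    (Filter.Eventually.of_forall fun _ => by positivity), h2, ENNReal.ofReal_mul, 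
    EuclideanSpace.norm_sq_eq]
  exact integral_nonneg fun _ => sq_nonneg _

theorem nonlocalEnergy_eq_translate {F : Type*} [NormedAddCommGroup F] {u : R3 → F}
    (hu : StronglyMeasurable u) (ε : ℝ) :
    nonlocalEnergy ε u = ∫⁻ h in Metric.ball (0 : R3) ε, ∫⁻ x, ‖u (x + h) - u x‖ₑ ^ 2 := by
  have h1 : ∀ x, ∫⁻ y in Metric.ball x ε, ‖u y - u x‖ₑ ^ 2
      = ∫⁻ h in Metric.ball (0 : R3) ε, ‖u (x + h) - u x‖ₑ ^ 2 := by
    intro x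
    have := (measurePreserving_add_left (volume : Measure R3) x).setLIntegral_comp_preimage_emb
      (measurableEmbedding_addLeft x) (fun y => ‖u y - u x‖ₑ ^ 2) (Metric.ball x ε)
    rw [← this]
    congr 2
    ext h; simp [dist_eq_norm]
  simp only [nonlocalEnergy, h1]
  refine lintegral_lintegral_swap (Measurable.aemeasurable ?_)
  have ha : StronglyMeasurable fun z : R3 × R3 => u (z.1 + z.2) :=
    hu.comp_measurable (by fun_prop)
  have hb : StronglyMeasurable fun z : R3 × R3 => u z.1 := hu.comp_measurable (by fun_prop)
  exact (ha.sub hb).enorm.pow_const 2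

theorem lintegral_translate_sub_sq_le {f : R3 → ℂ} (hf : ContDiff ℝ ∞ f) (h : R3) :
    ∫⁻ x, ‖f (x + h) - f x‖ₑ ^ 2 ≤ ∫⁻ x, ‖fderiv ℝ f x h‖ₑ ^ 2 := by
  have hD : Continuous fun x => fderiv ℝ f x h :=
    (hf.continuous_fderiv (by simp)).clm_apply continuous_const
  have key : ∀ x, ‖f (x + h) - f x‖ₑ ^ 2
      ≤ ∫⁻ s in Set.Ioc (0 : ℝ) 1, ‖fderiv ℝ f (x + s • h) h‖ₑ ^ 2 := by
    intro x
    have hc : Continuous fun s : ℝ => fderiv ℝ f (x + s • h) h := hD.comp (by fun_prop)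
    have hder : ∀ s : ℝ, HasDerivAt (fun s : ℝ => f (x + s • h)) (fderiv ℝ f (x + s • h) h) s := by
      intro s
      have h1 := (hf.differentiable (by simp) (x + s • h)).hasFDerivAt
      have h2 : HasDerivAt (fun s : ℝ => x + s • h) h s := by
        simpa using ((hasDerivAt_id s).smul_const h).const_add x
      exact h1.comp_hasDerivAt s h2
    have hF := intervalIntegral.integral_eq_sub_of_hasDerivAt (a := 0) (b := 1)
      (fun s _ => hder s) (hc.intervalIntegrable 0 1)
    have h3 : f (x + h) - f x = ∫ s in Set.Ioc (0 : ℝ) 1, fderiv ℝ f (x + s • h) h := by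
      rw [← intervalIntegral.integral_of_le zero_le_one, hF]; simp
    rw [h3]
    calc _ ≤ (∫⁻ s in Set.Ioc (0 : ℝ) 1, ‖fderiv ℝ f (x + s • h) h‖ₑ) ^ 2 := by
          gcongr; exact enorm_integral_le_lintegral_enorm _
      _ ≤ _ := by
          have := lintegral_sq_le (μ := volume.restrict (Set.Ioc (0 : ℝ) 1))
            (g := fun s => ‖fderiv ℝ f (x + s • h) h‖ₑ) hc.enorm.measurable.aemeasurable
          simpa using this
  calc ∫⁻ x, ‖f (x + h) - f x‖ₑ ^ 2
      ≤ ∫⁻ x, ∫⁻ s in Set.Ioc (0 : ℝ) 1, ‖fderiv ℝ f (x + s • h) h‖ₑ ^ 2 := lintegral_mono key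
    _ = ∫⁻ s in Set.Ioc (0 : ℝ) 1, ∫⁻ x, ‖fderiv ℝ f (x + s • h) h‖ₑ ^ 2 := by
        refine lintegral_lintegral_swap (Continuous.aemeasurable ?_)
        have : Continuous fun z : R3 × ℝ => fderiv ℝ f (z.1 + z.2 • h) h := hD.comp (by fun_prop)
        exact ENNReal.continuous_pow 2 |>.comp this.enorm
    _ = ∫⁻ s in Set.Ioc (0 : ℝ) 1, ∫⁻ x, ‖fderiv ℝ f x h‖ₑ ^ 2 := by
        refine lintegral_congr fun s => ?_
        exact lintegral_add_right_eq_self (fun x => ‖fderiv ℝ f x h‖ₑ ^ 2) (s • h)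
    _ = _ := by simp

theorem nonlocalEnergy_le_of_contDiff {f : R3 → ℂ} (hf : ContDiff ℝ ∞ f) (ε : ℝ) :
    nonlocalEnergy ε f ≤ ENNReal.ofReal (ballMoment ε) * ∫⁻ x, ‖cgrad f x‖ₑ ^ 2 := by
  rw [nonlocalEnergy_eq_translate hf.continuous.stronglyMeasurable]
  calc ∫⁻ h in Metric.ball (0 : R3) ε, ∫⁻ x, ‖f (x + h) - f x‖ₑ ^ 2
      ≤ ∫⁻ h in Metric.ball (0 : R3) ε, ∫⁻ x, ‖fderiv ℝ f x h‖ₑ ^ 2 :=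
        lintegral_mono fun h => lintegral_translate_sub_sq_le hf h
    _ = ∫⁻ x, ∫⁻ h in Metric.ball (0 : R3) ε, ‖fderiv ℝ f x h‖ₑ ^ 2 := by
        refine lintegral_lintegral_swap (Continuous.aemeasurable ?_)
        have : Continuous fun z : R3 × R3 => fderiv ℝ f z.2 z.1 :=
          ((hf.continuous_fderiv (by simp)).comp continuous_snd).clm_apply continuous_fst
        exact ENNReal.continuous_pow 2 |>.comp this.enorm
    _ = ∫⁻ x, ENNReal.ofReal (ballMoment ε) * ‖cgrad f x‖ₑ ^ 2 := by
        refine lintegral_congr fun x => ?_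
        rw [lintegral_ball_enorm_apply_sq]; rfl
    _ = _ := lintegral_const_mul' _ _ ENNReal.ofReal_ne_top

/-- Lower semicontinuity of the nonlocal energy under almost everywhere convergence. -/
theorem nonlocalEnergy_le_liminf {F : Type*} [NormedAddCommGroup F] {f : ℕ → R3 → F} {u : R3 → F}
    (hf : ∀ n, StronglyMeasurable (f n))
    (h : ∀ᵐ x, Filter.Tendsto (fun n => f n x) Filter.atTop (nhds (u x))) (ε : ℝ) :
    nonlocalEnergy ε u ≤ Filter.liminf (fun n => nonlocalEnergy ε (f n)) Filter.atTop := by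
  have h1 : ∀ᵐ x, ∫⁻ y in Metric.ball x ε, ‖u y - u x‖ₑ ^ 2
      ≤ Filter.liminf (fun n => ∫⁻ y in Metric.ball x ε, ‖f n y - f n x‖ₑ ^ 2) Filter.atTop := by
    filter_upwards [h] with x hx
    have h2 : ∀ᵐ y ∂(volume.restrict (Metric.ball x ε)), ‖u y - u x‖ₑ ^ 2
        = Filter.liminf (fun n => ‖f n y - f n x‖ₑ ^ 2) Filter.atTop := by
      filter_upwards [ae_restrict_of_ae h] with y hy
      exact (((ENNReal.continuous_pow 2).tendsto _).comp (hy.sub hx).enorm).liminf_eq.symm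
    rw [lintegral_congr_ae h2]
    exact lintegral_liminf_le fun n =>
      (((hf n).sub stronglyMeasurable_const).enorm.pow_const 2)
  refine (lintegral_mono_ae h1).trans (lintegral_liminf_le fun n => ?_)
  have hm : Measurable fun z : R3 × R3 => ‖f n z.2 - f n z.1‖ₑ ^ 2 := by
    exact (((hf n).comp_measurable measurable_snd).sub
      ((hf n).comp_measurable measurable_fst)).enorm.pow_const 2
  have hs : MeasurableSet {z : R3 × R3 | z.2 ∈ Metric.ball z.1 ε} :=
    measurableSet_lt (f := fun z : R3 × R3 => dist z.2 z.1) (by fun_prop) measurable_const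
  have : (fun x => ∫⁻ y in Metric.ball x ε, ‖f n y - f n x‖ₑ ^ 2)
      = fun x => ∫⁻ y, Set.indicator {z : R3 × R3 | z.2 ∈ Metric.ball z.1 ε}
          (fun z => ‖f n z.2 - f n z.1‖ₑ ^ 2) (x, y) := by
    funext x
    rw [← lintegral_indicator Metric.isOpen_ball.measurableSet]
    rfl
  rw [this]
  exact (hm.indicator hs).lintegral_prod_right'

/-- The bound by the Dirichlet integral passes from smooth functions to `H¹` by density and lower
semicontinuity; there is no error term. -/
theorem nonlocalEnergy_fn_le (u : H1) (ε : ℝ) :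
    nonlocalEnergy ε (fn u) ≤ ENNReal.ofReal (ballMoment ε) * ∫⁻ x, ‖grad u x‖ₑ ^ 2 := by
  obtain ⟨C, f, hC, hs, hc, ht, hg⟩ := exists_smooth_approx u
  have h1 : ∀ n, nonlocalEnergy ε (f n) ≤ ENNReal.ofReal (ballMoment ε)
      * (eLpNorm (grad u) 2 volume + C * ENNReal.ofReal (1 / ((n : ℝ) + 1))) ^ 2 := by
    intro n
    refine (nonlocalEnergy_le_of_contDiff (hs n) ε).trans ?_
    rw [← eLpNorm_two_sq]
    gcongr
    exact hg n
  refine (nonlocalEnergy_le_liminf (fun n => (hs n).continuous.stronglyMeasurable) ht ε).trans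
    ((Filter.liminf_le_liminf (Filter.Eventually.of_forall h1)).trans ?_)
  refine le_of_eq (Filter.Tendsto.liminf_eq ?_)
  rw [← eLpNorm_two_sq]
  refine ENNReal.Tendsto.const_mul ?_ (Or.inr ENNReal.ofReal_ne_top)
  refine ((ENNReal.continuous_pow 2).tendsto _).comp ?_
  have h3 : Filter.Tendsto (fun n : ℕ => C * ENNReal.ofReal (1 / ((n : ℝ) + 1)))
      Filter.atTop (nhds (C * ENNReal.ofReal 0)) :=
    ENNReal.Tendsto.const_mul
      (ENNReal.tendsto_ofReal tendsto_one_div_add_atTop_nhds_zero_nat) (Or.inr hC)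
  simpa using h3.const_add (eLpNorm (grad u) 2 volume)

/-! ### Recovering the weak gradient from nonlocal energies -/

/-- A functional that is bounded by the norm of the image under a linear map into a Hilbert space
is represented by a vector of that space. -/
theorem exists_inner_eq_of_bound {E T : Type*} [NormedAddCommGroup E] [InnerProductSpace ℂ E]
    [CompleteSpace E] [AddCommGroup T] [Module ℂ T] (ι : T →ₗ[ℂ] E) (l : T →ₗ[ℂ] ℂ) {C : ℝ}
    (hC : 0 ≤ C) (h : ∀ t, ‖l t‖ ≤ C * ‖ι t‖) :
    ∃ v : E, ‖v‖ ≤ C ∧ ∀ t, inner ℂ v (ι t) = l t := by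
  have hker : ∀ s t, ι s = ι t → l s = l t := by
    intro s t hst
    have h1 := h (s - t)
    rw [map_sub, map_sub, hst, sub_self, norm_zero, mul_zero] at h1
    exact sub_eq_zero.1 (norm_le_zero_iff.1 h1)
  choose g hg using fun y : LinearMap.range ι => y.2
  let f₀ : LinearMap.range ι →ₗ[ℂ] ℂ :=
    { toFun := fun y => l (g y)
      map_add' := fun x y => by
        rw [← map_add]; exact hker _ _ (by simp [hg])
      map_smul' := fun c y => by
        rw [RingHom.id_apply, ← map_smul]; exact hker _ _ (by simp [hg]) }
  let f : LinearMap.range ι →L[ℂ] ℂ := f₀.mkContinuous C fun y => by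
    have := h (g y)
    rwa [hg] at this
  obtain ⟨F, hF, hFn⟩ := exists_extension_norm_eq (LinearMap.range ι) f
  refine ⟨(InnerProductSpace.toDual ℂ E).symm F, ?_, fun t => ?_⟩
  · rw [LinearIsometryEquiv.norm_map, hFn]
    exact LinearMap.mkContinuous_norm_le _ hC _
  · rw [InnerProductSpace.toDual_symm_apply]
    have h2 := hF ⟨ι t, t, rfl⟩
    rw [h2]
    exact hker _ _ (hg _)

/-- Smooth compactly supported vector fields with values in `ℂ³`. -/
def TestField : Submodule ℂ (Fin 3 → R3 → ℂ) where
  carrier := {Φ | ∀ i, ContDiff ℝ ∞ (Φ i) ∧ HasCompactSupport (Φ i)}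
  zero_mem' := fun _ => ⟨contDiff_const, HasCompactSupport.zero⟩
  add_mem' := fun ha hb i => ⟨(ha i).1.add (hb i).1, (ha i).2.add (hb i).2⟩
  smul_mem' := fun c _ ha i => ⟨(ha i).1.const_smul c, (ha i).2.smul_left (f := fun _ => c)⟩

theorem testField_memLp (Φ : TestField) :
    MemLp (fun x => (WithLp.toLp 2 fun i => (Φ : Fin 3 → R3 → ℂ) i x :
      EuclideanSpace ℂ (Fin 3))) 2 volume := by
  refine MemLp.of_eval_piLp fun i => ?_
  exact (Φ.prop i).1.continuous.memLp_of_hasCompactSupport (Φ.prop i).2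

/-- The inclusion of test fields in `L²`. -/
def testFieldToL2 : TestField →ₗ[ℂ] L2Vec where
  toFun Φ := (testField_memLp Φ).toLp _
  map_add' Φ Ψ := by
    rw [← MemLp.toLp_add]; rfl
  map_smul' c Φ := by
    rw [RingHom.id_apply, ← MemLp.toLp_const_smul]; rfl

theorem exists_uniform_taylor {f : R3 → ℂ} (hf : ContDiff ℝ ∞ f) (hc : HasCompactSupport f) {η : ℝ}
    (hη : 0 < η) :
    ∃ ε : ℝ, 0 < ε ∧ ∀ h : R3, ‖h‖ < ε → ∀ x, ‖f (x - h) - f x + fderiv ℝ f x h‖ ≤ η * ‖h‖ := by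
  have hu : UniformContinuous (fderiv ℝ f) :=
    (hc.fderiv ℝ).uniformContinuous_of_continuous (hf.continuous_fderiv (by simp))
  obtain ⟨ε, hε, H⟩ := Metric.uniformContinuous_iff.1 hu η hη
  refine ⟨ε, hε, fun h hh x => ?_⟩
  have key := (convex_segment (𝕜 := ℝ) x (x - h)).norm_image_sub_le_of_norm_hasFDerivWithin_le'
    (f := f) (f' := fderiv ℝ f) (φ := fderiv ℝ f x) (C := η)
    (fun z _ => (hf.differentiable (by simp) z).hasFDerivAt.hasFDerivWithinAt)
    (fun z hz => ?_) (left_mem_segment ℝ _ _) (right_mem_segment ℝ _ _)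
  · have e : x - h - x = -h := by abel
    rw [e, map_neg, sub_neg_eq_add, norm_neg] at key
    exact key
  · rw [← dist_eq_norm]
    refine (H (?_ : dist z x < ε)).le
    refine lt_of_le_of_lt ?_ hh
    rw [segment_eq_image_lineMap] at hz
    obtain ⟨t, ht, rfl⟩ := hz
    rw [dist_lineMap_left]
    simp only [dist_eq_norm, sub_sub_cancel]
    rw [Real.norm_of_nonneg ht.1]
    exact mul_le_of_le_one_left (norm_nonneg _) ht.2


/-- If the nonlocal energies of `u` are bounded by those of a function with Dirichlet integral `A`,
then `u` has a distributional gradient of norm at most `√A`, tested against vector fields. -/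
theorem norm_integral_div_le {u : R3 → ℂ} (hum : StronglyMeasurable u) (hu : MemLp u 2 volume)
    {A : ℝ} (hA : 0 ≤ A)
    (h : ∀ ε > 0, nonlocalEnergy ε u ≤ ENNReal.ofReal (ballMoment ε) * ENNReal.ofReal A)
    (Φ : TestField) :
    ‖∫ x, (starRingEnd ℂ) (u x) * ∑ i, fderiv ℝ ((Φ : Fin 3 → R3 → ℂ) i) x
        (EuclideanSpace.single i 1)‖ ≤ √A * ‖testFieldToL2 Φ‖ := by
  set P : Fin 3 → R3 → ℂ := Φ.1 with hP
  have hPs : ∀ i, ContDiff ℝ ∞ (P i) := fun i => (Φ.prop i).1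
  have hPc : ∀ i, HasCompactSupport (P i) := fun i => (Φ.prop i).2
  have hus : MemLp (fun x => (starRingEnd ℂ) (u x)) 2 volume := hu.star
  have hint : ∀ {g : R3 → ℂ}, Continuous g → HasCompactSupport g →
      Integrable (fun x => (starRingEnd ℂ) (u x) * g x) := fun hg hgc =>
    hus.integrable_mul (q := 2) (hg.memLp_of_hasCompactSupport hgc)
  have hDc : ∀ i (w : R3), Continuous fun x => fderiv ℝ (P i) x w := fun i w =>
    ((hPs i).continuous_fderiv (by simp)).clm_apply continuous_const
  have hDs : ∀ i (w : R3), HasCompactSupport fun x => fderiv ℝ (P i) x w := fun i w =>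
    ((hPc i).fderiv ℝ).comp_left (g := fun L : R3 →L[ℝ] ℂ => L w) (by simp)
  have hTs : ∀ i (w : R3), HasCompactSupport fun x => P i (x - w) := fun i w =>
    (hPc i).comp_homeomorph (Homeomorph.subRight w)
  have hTc : ∀ i (w : R3), Continuous fun x => P i (x - w) := fun i w =>
    (hPs i).continuous.comp (by fun_prop)
  set d : Fin 3 → R3 → ℂ := fun i w => ∫ x, (starRingEnd ℂ) (u x) * fderiv ℝ (P i) x w with hd
  set D : ℂ := ∫ x, (starRingEnd ℂ) (u x) * ∑ i, fderiv ℝ (P i) x (EuclideanSpace.single i 1)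
    with hDdef
  have hDsum : D = ∑ i, d i (EuclideanSpace.single i 1) := by
    simp only [hDdef, Finset.mul_sum]
    exact integral_finsetSum _ fun i _ => hint (hDc i _) (hDs i _)
  have hdlin : ∀ i w, d i w = ∑ j, ((w j : ℝ) : ℂ) * d i (EuclideanSpace.single j 1) := by
    intro i w
    have hw : w = ∑ j, w j • EuclideanSpace.single j (1 : ℝ) := by
      ext j; simp [Finset.sum_apply, Pi.single_apply]
    simp only [hd, ← integral_const_mul]
    rw [← integral_finsetSum _ fun j _ => (hint (hDc i _) (hDs i _)).const_mul _]
    refine integral_congr_ae (Filter.Eventually.of_forall fun x => ?_)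
    conv_lhs => rw [hw]
    simp only [map_sum, map_smul, Finset.mul_sum]
    refine Finset.sum_congr rfl fun j _ => ?_
    rw [Complex.real_smul]; ring
  -- the set where all translates by vectors of length at most one live
  set S : Set R3 := ⋃ i, Metric.cthickening 1 (tsupport (P i)) with hS
  have hScomp : IsCompact S := isCompact_iUnion fun i => (hPc i).isCompact.cthickening
  have hSm : MeasurableSet S := hScomp.isClosed.measurableSet
  have huS : IntegrableOn u S := (hu.locallyIntegrable (by norm_num)).integrableOn_isCompact hScomp
  set M : ℝ := ∫ x in S, ‖u x‖ with hM
  have hM0 : 0 ≤ M := integral_nonneg fun _ => norm_nonneg _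
  have main : ∀ η > 0, ‖D‖ ≤ √A * ‖testFieldToL2 Φ‖ + 9 * η * M := by
    intro η hη
    choose e he0 he using fun i => exists_uniform_taylor (hPs i) (hPc i) hη
    obtain ⟨ε, hε0, hε1, hεe⟩ : ∃ ε : ℝ, 0 < ε ∧ ε ≤ 1 ∧ ∀ i, ε ≤ e i := by
      refine ⟨min 1 (min (e 0) (min (e 1) (e 2))), ?_, min_le_left _ _, fun i => ?_⟩
      · simp [he0]
      · fin_cases i <;> simp
    set b : ℝ := ballMoment ε with hb
    have hb0 : 0 < b := ballMoment_pos hε0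
    set q : R3 → ℂ := fun w => ∑ i, ((w i : ℝ) : ℂ) * d i w with hq
    have hqint : ∫ w in Metric.ball (0 : R3) ε, q w = b * D := by
      have h1 : ∀ w, q w = ∑ i, ∑ j, ((w i * w j : ℝ) : ℂ) * d i (EuclideanSpace.single j 1) := by
        intro w
        simp only [hq]
        refine Finset.sum_congr rfl fun i _ => ?_
        rw [hdlin, Finset.mul_sum]
        refine Finset.sum_congr rfl fun j _ => ?_
        push_cast; ring
      simp only [h1]
      rw [integral_finsetSum _ fun i _ => integrableOn_ball_of_continuous (by fun_prop) 0 ε, hDsum,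
        Finset.mul_sum]
      refine Finset.sum_congr rfl fun i _ => ?_
      rw [integral_finsetSum _ fun j _ => integrableOn_ball_of_continuous (by fun_prop) 0 ε]
      simp only [integral_mul_const, integral_complex_ofReal, integral_ball_mul]
      rw [Finset.sum_eq_single i (fun j _ hj => by simp [Ne.symm hj]) (by simp)]
      simp [hb]
    set J : R3 → ℂ := fun w => ∑ i, ((w i : ℝ) : ℂ)
      * ∫ x, (starRingEnd ℂ) (u x) * (P i (x - w) - P i x) with hJ
    have hJq : ∀ w ∈ Metric.ball (0 : R3) ε, ‖J w + q w‖ ≤ 3 * η * M * ‖w‖ ^ 2 := by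
      intro w hw
      have hwε : ‖w‖ < ε := by simpa using hw
      have h1 : J w + q w = ∑ i, ((w i : ℝ) : ℂ)
          * ∫ x, (starRingEnd ℂ) (u x) * (P i (x - w) - P i x + fderiv ℝ (P i) x w) := by
        simp only [hJ, hq, ← Finset.sum_add_distrib, ← mul_add, hd]
        refine Finset.sum_congr rfl fun i _ => ?_
        refine congrArg _ ?_
        simp only [mul_add]
        exact (integral_add (hint ((hTc i w).sub (hPs i).continuous) ((hTs i w).sub (hPc i)))
          (hint (hDc i w) (hDs i w))).symm
      have h2 : ∀ i, ‖∫ x, (starRingEnd ℂ) (u x)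
          * (P i (x - w) - P i x + fderiv ℝ (P i) x w)‖ ≤ η * ‖w‖ * M := by
        intro i
        have hz : ∀ x, x ∉ S → (starRingEnd ℂ) (u x)
            * (P i (x - w) - P i x + fderiv ℝ (P i) x w) = 0 := by
          intro x hx
          have hx' : x ∉ Metric.cthickening 1 (tsupport (P i)) := fun hh =>
            hx (Set.mem_iUnion.2 ⟨i, hh⟩)
          have a1 : x ∉ tsupport (P i) := fun hh =>
            hx' (Metric.self_subset_cthickening _ hh)
          have a2 : x - w ∉ tsupport (P i) := fun hh =>
            hx' (Metric.mem_cthickening_of_dist_le x (x - w) 1 _ hh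
              (by rw [dist_eq_norm, sub_sub_cancel]; linarith))
          have a3 : x ∉ tsupport (fderiv ℝ (P i)) := fun hh => a1 (tsupport_fderiv_subset ℝ hh)
          rw [image_eq_zero_of_notMem_tsupport a1, image_eq_zero_of_notMem_tsupport a2,
            image_eq_zero_of_notMem_tsupport a3]
          simp
        rw [← setIntegral_eq_integral_of_forall_compl_eq_zero hz]
        refine (norm_integral_le_integral_norm _).trans ?_
        rw [hM, ← integral_const_mul]
        refine integral_mono_of_nonneg (Filter.Eventually.of_forall fun _ => norm_nonneg _)
          (huS.norm.const_mul _) (Filter.Eventually.of_forall fun x => ?_)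
        simp only [norm_mul, RCLike.norm_conj]
        rw [mul_comm]
        exact mul_le_mul_of_nonneg_right (he i w (hwε.trans_le (hεe i)) x) (norm_nonneg _)
      rw [h1]
      calc _ ≤ ∑ i : Fin 3, ‖w‖ * (η * ‖w‖ * M) := by
            refine (norm_sum_le _ _).trans (Finset.sum_le_sum fun i _ => ?_)
            rw [norm_mul, Complex.norm_real]
            exact mul_le_mul (PiLp.norm_apply_le w i) (h2 i) (norm_nonneg _) (norm_nonneg _)
        _ = _ := by simp; ring
    set L : R3 → R3 →L[ℝ] ℂ := fun x =>
      ∑ i, (EuclideanSpace.proj i : R3 →L[ℝ] ℝ).smulRight (P i x) with hL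
    have hLa : ∀ x w, L x w = ∑ i, ((w i : ℝ) : ℂ) * P i x := by
      intro x w
      simp [hL]
    have hLc : Continuous fun z : R3 × R3 => L z.2 z.1 := by
      simp only [hLa]
      have := fun i => (hPs i).continuous
      fun_prop
    have hJle : ∀ w, ‖J w‖ₑ ≤ ∫⁻ x, ‖u (x + w) - u x‖ₑ * ‖L x w‖ₑ := by
      intro w
      have h1 : J w = ∫ x, (starRingEnd ℂ) (u (x + w) - u x) * L x w := by
        simp only [hJ, hLa, Finset.mul_sum]
        have hsh : MemLp (fun x => (starRingEnd ℂ) (u (x + w))) 2 volume :=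
          hus.comp_measurePreserving (measurePreserving_add_right volume w)
        have hPm : ∀ i, MemLp (P i) 2 volume := fun i =>
          (hPs i).continuous.memLp_of_hasCompactSupport (hPc i)
        have hi1 : ∀ i, Integrable (fun x => (starRingEnd ℂ) (u (x + w)) * P i x) := fun i =>
          hsh.integrable_mul (hPm i)
        have hi2 : ∀ i, Integrable (fun x => (starRingEnd ℂ) (u x) * P i x) := fun i =>
          hus.integrable_mul (hPm i)
        rw [integral_finsetSum]
        · refine Finset.sum_congr rfl fun i _ => ?_
          have e1 : ∫ x, (starRingEnd ℂ) (u x) * P i (x - w)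
              = ∫ x, (starRingEnd ℂ) (u (x + w)) * P i x := by
            rw [← integral_add_right_eq_self _ w]
            simp
          have e2 : ∫ x, (starRingEnd ℂ) (u x) * (P i (x - w) - P i x)
              = ∫ x, (starRingEnd ℂ) (u (x + w) - u x) * P i x := by
            simp only [mul_sub, map_sub, sub_mul]
            rw [integral_sub (hint (hTc i w) (hTs i w)) (hi2 i), integral_sub (hi1 i) (hi2 i), e1]
          rw [e2, ← integral_const_mul]
          refine integral_congr_ae (Filter.Eventually.of_forall fun x => ?_)
          simp only; ring
        · intro i _
          have := ((hi1 i).sub (hi2 i)).const_mul ((w i : ℝ) : ℂ)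
          refine this.congr (Filter.Eventually.of_forall fun x => ?_)
          simp only [map_sub, Pi.sub_apply]; ring
      rw [h1]
      refine (enorm_integral_le_lintegral_enorm _).trans (le_of_eq ?_)
      refine lintegral_congr fun x => ?_
      rw [enorm_mul, RCLike.enorm_conj]
    have hX : ∫⁻ w in Metric.ball (0 : R3) ε, ‖J w‖ₑ
        ≤ ENNReal.ofReal (b * (√A * ‖testFieldToL2 Φ‖)) := by
      set X := ∫⁻ w in Metric.ball (0 : R3) ε, ∫⁻ x, ‖u (x + w) - u x‖ₑ * ‖L x w‖ₑ with hXd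
      refine (lintegral_mono hJle).trans ?_
      set μ := (volume.restrict (Metric.ball (0 : R3) ε)).prod (volume : Measure R3) with hμ
      have m1 : Measurable fun z : R3 × R3 => ‖u (z.2 + z.1) - u z.2‖ₑ := by
        have ha : StronglyMeasurable fun z : R3 × R3 => u (z.2 + z.1) :=
          hum.comp_measurable (by fun_prop)
        have hb : StronglyMeasurable fun z : R3 × R3 => u z.2 := hum.comp_measurable (by fun_prop)
        exact (ha.sub hb).enorm
      have m2 : Measurable fun z : R3 × R3 => ‖L z.2 z.1‖ₑ := hLc.enorm.measurable
      have hX1 : X = ∫⁻ z, ‖u (z.2 + z.1) - u z.2‖ₑ * ‖L z.2 z.1‖ₑ ∂μ :=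
        (lintegral_prod _ (m1.mul m2).aemeasurable).symm
      have hX2 : X ^ 2 ≤ (ENNReal.ofReal b * ENNReal.ofReal A)
          * (ENNReal.ofReal b * ENNReal.ofReal (‖testFieldToL2 Φ‖ ^ 2)) := by
        rw [hX1]
        refine (lintegral_mul_sq_le m1.aemeasurable m2.aemeasurable).trans ?_
        gcongr
        · rw [lintegral_prod _ (m1.pow_const 2).aemeasurable]
          simp only
          rw [← nonlocalEnergy_eq_translate hum]
          exact h ε hε0
        · rw [lintegral_prod_symm _ (m2.pow_const 2).aemeasurable]
          simp only [lintegral_ball_enorm_apply_sq]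
          rw [lintegral_const_mul' _ _ ENNReal.ofReal_ne_top]
          gcongr
          have hN : ‖testFieldToL2 Φ‖ₑ ^ 2 = ∫⁻ x, ‖(WithLp.toLp 2 fun i => P i x :
              EuclideanSpace ℂ (Fin 3))‖ₑ ^ 2 := by
            rw [← eLpNorm_two_sq]
            congr 1
            exact Lp.enorm_toLp (testField_memLp Φ)
          rw [ENNReal.ofReal_pow (norm_nonneg _), ofReal_norm, hN]
          refine le_of_eq (lintegral_congr fun x => ?_)
          congr 4
          funext i
          rw [hLa, Finset.sum_eq_single i (fun j _ hj => by simp [Ne.symm hj]) (by simp)]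
          simp
      have hX3 : X ^ 2 ≤ ENNReal.ofReal (b * (√A * ‖testFieldToL2 Φ‖)) ^ 2 := by
        refine hX2.trans (le_of_eq ?_)
        rw [← ENNReal.ofReal_pow (by positivity), ← ENNReal.ofReal_mul hb0.le,
          ← ENNReal.ofReal_mul hb0.le, ← ENNReal.ofReal_mul (by positivity), mul_pow, mul_pow,
          Real.sq_sqrt hA]
        congr 1; ring
      exact (ENNReal.pow_le_pow_left_iff two_ne_zero).1 hX3
    have hfin : ‖(b : ℂ) * D‖ₑ
        ≤ ENNReal.ofReal (b * (√A * ‖testFieldToL2 Φ‖) + 9 * η * M * b) := by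
      rw [← hqint]
      refine (enorm_integral_le_lintegral_enorm _).trans ?_
      calc ∫⁻ w in Metric.ball (0 : R3) ε, ‖q w‖ₑ
          ≤ ∫⁻ w in Metric.ball (0 : R3) ε,
              (‖J w‖ₑ + ENNReal.ofReal (3 * η * M * ‖w‖ ^ 2)) := by
            refine setLIntegral_mono' Metric.isOpen_ball.measurableSet fun w hw => ?_
            have e1 : q w = (J w + q w) - J w := by ring
            calc ‖q w‖ₑ = ‖(J w + q w) - J w‖ₑ := by rw [← e1]
              _ ≤ ‖J w + q w‖ₑ + ‖J w‖ₑ := enorm_sub_le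
              _ ≤ _ := by
                rw [add_comm]
                gcongr
                rw [← ofReal_norm]
                exact ENNReal.ofReal_le_ofReal (hJq w hw)
        _ = (∫⁻ w in Metric.ball (0 : R3) ε, ‖J w‖ₑ)
            + ∫⁻ w in Metric.ball (0 : R3) ε, ENNReal.ofReal (3 * η * M * ‖w‖ ^ 2) :=
            lintegral_add_right _ (by fun_prop)
        _ ≤ ENNReal.ofReal (b * (√A * ‖testFieldToL2 Φ‖)) + ENNReal.ofReal (9 * η * M * b) := by
            gcongr
            rw [← ofReal_integral_eq_lintegral_ofReal
              (integrableOn_ball_of_continuous (by fun_prop) 0 ε)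
              (Filter.Eventually.of_forall fun _ => by positivity), integral_const_mul,
              integral_ball_norm_sq]
            refine ENNReal.ofReal_le_ofReal (le_of_eq ?_)
            ring
        _ = _ := (ENNReal.ofReal_add (by positivity) (by positivity)).symm
    rw [← ofReal_norm, ENNReal.ofReal_le_ofReal_iff (by positivity), norm_mul, Complex.norm_real,
      Real.norm_of_nonneg hb0.le] at hfin
    refine le_of_mul_le_mul_left (hfin.trans (le_of_eq ?_)) hb0
    ring
  refine le_of_forall_pos_le_add fun δ hδ => ?_
  refine (main (δ / (9 * M + 1)) (by positivity)).trans (add_le_add_right ?_ _)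
  rw [show 9 * (δ / (9 * M + 1)) * M = δ * (9 * M / (9 * M + 1)) by ring]
  exact mul_le_of_le_one_right hδ.le ((div_le_one (by positivity)).2 (by linarith))


theorem norm_Lp_two_sq {F : Type*} [NormedAddCommGroup F] (f : Lp F 2 (volume : Measure R3)) :
    ‖f‖ ^ 2 = ∫ x, ‖f x‖ ^ 2 := by
  have h1 : ENNReal.ofReal (‖f‖ ^ 2) = ∫⁻ x, ‖f x‖ₑ ^ 2 := by
    rw [← eLpNorm_two_sq, ← Lp.enorm_def, ENNReal.ofReal_pow (norm_nonneg _), ofReal_norm]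
  have hm : AEStronglyMeasurable (fun x => ‖f x‖ ^ 2) volume :=
    ((Lp.stronglyMeasurable f).norm.pow 2).aestronglyMeasurable
  rw [integral_eq_lintegral_of_nonneg_ae (Filter.Eventually.of_forall fun _ => by positivity) hm]
  have h2 : ∀ x, ENNReal.ofReal (‖f x‖ ^ 2) = ‖f x‖ₑ ^ 2 := fun x => by
    rw [ENNReal.ofReal_pow (norm_nonneg _), ofReal_norm]
  simp only [h2, ← h1]
  rw [ENNReal.toReal_ofReal (by positivity)]

theorem kinetic_eq_norm_sq (u : H1) : kinetic u = ‖grad u‖ ^ 2 := (norm_Lp_two_sq _).symm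

theorem kinetic_nonneg (u : H1) : 0 ≤ kinetic u := by
  rw [kinetic_eq_norm_sq]; positivity

theorem lintegral_grad_eq (u : H1) : ∫⁻ x, ‖grad u x‖ₑ ^ 2 = ENNReal.ofReal (kinetic u) := by
  rw [kinetic_eq_norm_sq, ENNReal.ofReal_pow (norm_nonneg _), ofReal_norm, Lp.enorm_def,
    eLpNorm_two_sq]

/-- A square integrable function whose nonlocal energies are bounded by `ballMoment ε * A` lies in
`H¹` and has Dirichlet integral at most `A`. -/
theorem exists_H1_of_nonlocalEnergy_le (u : L2) {A : ℝ} (hA : 0 ≤ A)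
    (h : ∀ ε > 0, nonlocalEnergy ε u ≤ ENNReal.ofReal (ballMoment ε) * ENNReal.ofReal A) :
    ∃ U : H1, fn U = u ∧ kinetic U ≤ A := by
  have hus : MemLp (fun x => (starRingEnd ℂ) (u x)) 2 volume := (Lp.memLp u).star
  have hint : ∀ Φ : TestField, ∀ i, Integrable (fun x => (starRingEnd ℂ) (u x)
      * fderiv ℝ (Φ.1 i) x (EuclideanSpace.single i 1)) := fun Φ i =>
    hus.integrable_mul (q := 2) <| Continuous.memLp_of_hasCompactSupport
      (((Φ.prop i).1.continuous_fderiv (by simp)).clm_apply continuous_const)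
      (((Φ.prop i).2.fderiv ℝ).comp_left (g := fun L : R3 →L[ℝ] ℂ => L _) (by simp))
  have hint' : ∀ Φ : TestField, Integrable (fun x => (starRingEnd ℂ) (u x)
      * ∑ i, fderiv ℝ (Φ.1 i) x (EuclideanSpace.single i 1)) := fun Φ => by
    simp only [Finset.mul_sum]
    exact integrable_finsetSum _ fun i _ => hint Φ i
  have hdiff : ∀ (Φ : TestField) i x, DifferentiableAt ℝ (Φ.1 i) x := fun Φ i x =>
    (Φ.prop i).1.differentiable (by simp) x
  let l : TestField →ₗ[ℂ] ℂ :=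
    { toFun := fun Φ => -∫ x, (starRingEnd ℂ) (u x)
        * ∑ i, fderiv ℝ (Φ.1 i) x (EuclideanSpace.single i 1)
      map_add' := fun Φ Ψ => by
        rw [← neg_add, ← integral_add (hint' Φ) (hint' Ψ)]
        congr 2
        funext x
        rw [← mul_add, ← Finset.sum_add_distrib]
        refine congrArg (fun z => _ * z) (Finset.sum_congr rfl fun i _ => ?_)
        change fderiv ℝ (Φ.1 i + Ψ.1 i) x _ = _
        rw [fderiv_add (hdiff Φ i x) (hdiff Ψ i x)]
        rfl
      map_smul' := fun c Φ => by
        rw [RingHom.id_apply, smul_eq_mul, mul_neg, ← integral_const_mul]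
        congr 2
        funext x
        rw [mul_left_comm, Finset.mul_sum Finset.univ _ c]
        refine congrArg (fun z => _ * z) (Finset.sum_congr rfl fun i _ => ?_)
        change fderiv ℝ (c • Φ.1 i) x _ = _
        rw [fderiv_const_smul (hdiff Φ i x)]
        rfl }
  obtain ⟨v, hv, hvl⟩ := exists_inner_eq_of_bound testFieldToL2 l (Real.sqrt_nonneg A) fun Φ => by
    change ‖-_‖ ≤ _
    rw [norm_neg]
    exact norm_integral_div_le (Lp.stronglyMeasurable u) (Lp.memLp u) hA h Φ
  have hgrad : IsWeakGrad u v := by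
    intro φ hφ i
    have hφc : ContDiff ℝ ∞ (fun x => (φ x : ℂ)) := Complex.ofRealCLM.contDiff.comp hφ.contDiff
    have hφs : HasCompactSupport (fun x => (φ x : ℂ)) :=
      hφ.hasCompactSupport.comp_left (g := fun t : ℝ => (t : ℂ)) (by simp)
    let Φ : TestField := ⟨fun j => if j = i then fun x => (φ x : ℂ) else 0, fun j => by
      by_cases hj : j = i
      · simp only [hj, if_true]; exact ⟨hφc, hφs⟩
      · simp only [hj, if_false]; exact ⟨contDiff_const, HasCompactSupport.zero⟩⟩
    have hΦj : ∀ j x, Φ.1 j x = if j = i then (φ x : ℂ) else 0 := fun j x => by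
      by_cases hj : j = i <;> simp [Φ, hj]
    have h1 : l Φ = -∫ x, (starRingEnd ℂ) (u x) * (partialDeriv i φ x : ℂ) := by
      change -∫ x, (starRingEnd ℂ) (u x) * ∑ j, fderiv ℝ (Φ.1 j) x (EuclideanSpace.single j 1) = _
      congr 2
      funext x
      congr 1
      rw [Finset.sum_eq_single i]
      · have e : Φ.1 i = fun x => (φ x : ℂ) := by funext x; simp [hΦj]
        have hd : HasFDerivAt (fun x => (φ x : ℂ)) (Complex.ofRealCLM.comp (fderiv ℝ φ x)) x :=
          Complex.ofRealCLM.hasFDerivAt.comp x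
            (hφ.contDiff.differentiable (by simp) x).hasFDerivAt
        rw [e, hd.fderiv]
        rfl
      · intro j _ hj
        have e : Φ.1 j = fun _ => 0 := by funext x; simp [hΦj, hj]
        rw [e]; simp
      · simp
    have h2 : inner ℂ v (testFieldToL2 Φ) = ∫ x, (starRingEnd ℂ) (v x i) * (φ x : ℂ) := by
      rw [L2.inner_def]
      refine integral_congr_ae ?_
      filter_upwards [(testField_memLp Φ).coeFn_toLp] with x hx2
      have hx3 : testFieldToL2 Φ x = WithLp.toLp 2 fun i => Φ.1 i x := hx2
      rw [hx3, PiLp.inner_apply, Finset.sum_eq_single i]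
      · simp [hΦj, mul_comm]
      · intro j _ hj
        simp [hΦj, hj]
      · simp
    have h3 := (hvl Φ).symm.trans h2
    rw [h1] at h3
    have h4 := congrArg (starRingEnd ℂ) h3
    rw [map_neg, ← integral_conj, ← integral_conj] at h4
    simp only [map_mul, Complex.conj_conj, Complex.conj_ofReal] at h4
    rw [← h4, neg_neg]
  refine ⟨⟨WithLp.toLp 2 (u, v), hgrad⟩, rfl, ?_⟩
  rw [kinetic_eq_norm_sq]
  change ‖v‖ ^ 2 ≤ A
  calc ‖v‖ ^ 2 ≤ √A ^ 2 := by gcongr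
    _ = A := Real.sq_sqrt hA

/-! ### Local compactness of bounded nonlocal energy -/

/-- An integrable, strictly decreasing radial weight, used to make Lebesgue measure finite. -/
def radialWeight (x : R3) : ℝ := (1 + ‖x‖) ^ (-4 : ℝ)

theorem radialWeight_pos (x : R3) : 0 < radialWeight x :=
  Real.rpow_pos_of_pos (by positivity) _

theorem radialWeight_le_one (x : R3) : radialWeight x ≤ 1 :=
  Real.rpow_le_one_of_one_le_of_nonpos (by linarith [norm_nonneg x]) (by norm_num)

theorem radialWeight_lt {x y : R3} (h : ‖x‖ < ‖y‖) : radialWeight y < radialWeight x :=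
  Real.rpow_lt_rpow_of_neg (by positivity) (by linarith) (by norm_num)

theorem continuous_radialWeight : Continuous radialWeight :=
  Continuous.rpow_const (by fun_prop) fun x => Or.inl (by positivity)

theorem integrable_radialWeight : Integrable radialWeight :=
  integrable_one_add_norm (by simp; norm_num)

/-- Lebesgue measure weighted by `radialWeight`. -/
def weightedMeasure : Measure R3 := volume.withDensity fun x => ENNReal.ofReal (radialWeight x)

theorem measurable_ofReal_radialWeight : Measurable fun x => ENNReal.ofReal (radialWeight x) :=
  continuous_radialWeight.measurable.ennreal_ofReal

instance : IsFiniteMeasure weightedMeasure :=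
  isFiniteMeasure_withDensity_ofReal integrable_radialWeight.2

theorem weightedMeasure_le : weightedMeasure ≤ volume := by
  conv_rhs => rw [← withDensity_one (μ := (volume : Measure R3))]
  refine withDensity_mono (Filter.Eventually.of_forall fun x => ?_)
  simpa using radialWeight_le_one x

theorem volume_ac_weightedMeasure : (volume : Measure R3) ≪ weightedMeasure :=
  withDensity_absolutelyContinuous' measurable_ofReal_radialWeight.aemeasurable
    (Filter.Eventually.of_forall fun x => by simpa using radialWeight_pos x)

theorem setLIntegral_ball_le_weighted (R : ℝ) {f : R3 → ℝ≥0∞} (hf : Measurable f) :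
    ∫⁻ x in Metric.ball 0 R, f x
      ≤ ENNReal.ofReal ((1 + R) ^ (4 : ℝ)) * ∫⁻ x, f x ∂weightedMeasure := by
  rw [weightedMeasure, lintegral_withDensity_eq_lintegral_mul _ measurable_ofReal_radialWeight hf,
    ← lintegral_const_mul' _ _ ENNReal.ofReal_ne_top]
  refine (setLIntegral_mono' Metric.isOpen_ball.measurableSet fun x hx => ?_).trans
    (setLIntegral_le_lintegral _ _)
  simp only [Pi.mul_apply]
  rw [← mul_assoc, ← ENNReal.ofReal_mul' (radialWeight_pos x).le]
  refine le_mul_of_one_le_left zero_le ?_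
  rw [ENNReal.one_le_ofReal, radialWeight, Real.rpow_neg (by positivity), ← div_eq_mul_inv,
    one_le_div (by positivity)]
  have : ‖x‖ < R := by simpa using hx
  exact Real.rpow_le_rpow (by positivity) (by linarith) (by norm_num)

theorem nonlocalEnergy_congr_ae {F : Type*} [NormedAddCommGroup F] {u v : R3 → F}
    (h : u =ᵐ[volume] v) (ε : ℝ) : nonlocalEnergy ε u = nonlocalEnergy ε v := by
  refine lintegral_congr_ae ?_
  filter_upwards [h] with x hx
  refine lintegral_congr_ae ?_
  filter_upwards [ae_restrict_of_ae h] with y hy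
  rw [hx, hy]

/-- Sums of `f` over balls of radius `η`. -/
def ballSum (η : ℝ) (f : R3 → ℝ) (x : R3) : ℝ := ∫ y in Metric.ball x η, f y

theorem stronglyMeasurable_ballSum (η : ℝ) {f : R3 → ℝ} (hf : StronglyMeasurable f) :
    StronglyMeasurable (ballSum η f) := by
  have hs : MeasurableSet {z : R3 × R3 | z.2 ∈ Metric.ball z.1 η} :=
    measurableSet_lt (f := fun z : R3 × R3 => dist z.2 z.1) (by fun_prop) measurable_const
  have : ballSum η f = fun x => ∫ y, Set.indicator {z : R3 × R3 | z.2 ∈ Metric.ball z.1 η}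
      (fun z => f z.2) (x, y) := by
    funext x
    rw [ballSum, ← integral_indicator Metric.isOpen_ball.measurableSet]
    rfl
  rw [this]
  exact ((hf.comp_measurable measurable_snd).indicator hs).integral_prod_right'

/-- The mean over a ball of radius `η` is close to the function in `L²` if the nonlocal energy at
scale `η` is small. -/
theorem lintegral_sub_ballMean_sq_le {η : ℝ} (hη : 0 < η) {f : R3 → ℝ} (hf : StronglyMeasurable f)
    (hfi : LocallyIntegrable f volume) :
    ∫⁻ x, ‖f x - (volume.real (Metric.ball (0 : R3) η))⁻¹ * ballSum η f x‖ₑ ^ 2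
      ≤ (volume (Metric.ball (0 : R3) η))⁻¹ * nonlocalEnergy η f := by
  set V := volume (Metric.ball (0 : R3) η) with hV
  have hV0 : V ≠ 0 := (Metric.measure_ball_pos _ _ hη).ne'
  have hVt : V ≠ ⊤ := measure_ball_lt_top.ne
  have hVx : ∀ x : R3, volume (Metric.ball x η) = V := fun x => Measure.addHaar_ball_center _ _ _
  have hVr : volume.real (Metric.ball (0 : R3) η) = V.toReal := rfl
  have hVr0 : V.toReal ≠ 0 := (ENNReal.toReal_pos hV0 hVt).ne'
  rw [nonlocalEnergy, ← lintegral_const_mul' _ _ (ENNReal.inv_ne_top.2 hV0)]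
  refine lintegral_mono fun x => ?_
  have hfb : IntegrableOn f (Metric.ball x η) :=
    (hfi.integrableOn_isCompact (isCompact_closedBall x η)).mono_set Metric.ball_subset_closedBall
  have h1 : f x - (volume.real (Metric.ball (0 : R3) η))⁻¹ * ballSum η f x
      = (V.toReal)⁻¹ * ∫ y in Metric.ball x η, (f x - f y) := by
    rw [integral_sub (integrableOn_const (C := f x) (by rw [hVx]; exact hVt)) hfb, setIntegral_const, hVr,
      Measure.real, hVx, ballSum, smul_eq_mul, mul_sub, inv_mul_cancel_left₀ hVr0]
  have h2 : ‖(V.toReal)⁻¹‖ₑ = V⁻¹ := by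
    rw [← ENNReal.toReal_inv, Real.enorm_eq_ofReal ENNReal.toReal_nonneg,
      ENNReal.ofReal_toReal (ENNReal.inv_ne_top.2 hV0)]
  rw [h1, enorm_mul, mul_pow, h2]
  have h3 : ‖∫ y in Metric.ball x η, (f x - f y)‖ₑ ^ 2
      ≤ V * ∫⁻ y in Metric.ball x η, ‖f y - f x‖ₑ ^ 2 := by
    calc _ ≤ (∫⁻ y in Metric.ball x η, ‖f x - f y‖ₑ) ^ 2 := by
          gcongr; exact enorm_integral_le_lintegral_enorm _
      _ ≤ _ := by
          have := lintegral_sq_le (μ := volume.restrict (Metric.ball x η))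
            (g := fun y => ‖f x - f y‖ₑ)
            (stronglyMeasurable_const.sub hf).enorm.aemeasurable
          rw [Measure.restrict_apply_univ, hVx] at this
          simpa only [enorm_sub_rev (f x)] using this
  calc V⁻¹ ^ 2 * _ ≤ V⁻¹ ^ 2 * (V * ∫⁻ y in Metric.ball x η, ‖f y - f x‖ₑ ^ 2) := by gcongr
    _ = _ := by
      rw [sq, mul_assoc, ← mul_assoc V⁻¹ V, ENNReal.inv_mul_cancel hV0 hVt, one_mul]

theorem ballMoment_le {ε : ℝ} (hε : 0 < ε) :
    ENNReal.ofReal (ballMoment ε) ≤ ENNReal.ofReal (ε ^ 2) * volume (Metric.ball (0 : R3) ε) := by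
  have hVt : volume (Metric.ball (0 : R3) ε) ≠ ⊤ := measure_ball_lt_top.ne
  rw [← ENNReal.ofReal_toReal hVt, ← ENNReal.ofReal_mul (by positivity)]
  refine ENNReal.ofReal_le_ofReal ?_
  have : ∫ h in Metric.ball (0 : R3) ε, ε ^ 2 = ε ^ 2 * (volume (Metric.ball (0 : R3) ε)).toReal := by
    rw [setIntegral_const, smul_eq_mul, mul_comm]; rfl
  rw [← this]
  refine setIntegral_mono_on (integrableOn_ball_of_continuous (by fun_prop) 0 ε)
    (integrableOn_const hVt) Metric.isOpen_ball.measurableSet fun h hh => ?_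
  have h1 : ‖h‖ < ε := by simpa using hh
  have h2 := (PiLp.norm_apply_le h 0).trans h1.le
  exact sq_le_sq' (by linarith [(abs_le.1 h2).1]) (abs_le.1 h2).2

/-- Weak compactness of bounded sets of `L²`: along a subsequence all ball means converge. -/
theorem exists_subseq_ballSum_tendsto {g : ℕ → R3 → ℝ} (hg : ∀ n, MemLp (g n) 2 volume)
    {M : ℝ} (hM : ∀ n, ∫⁻ x, ‖g n x‖ₑ ^ 2 ≤ ENNReal.ofReal M) :
    ∃ (φ : ℕ → ℕ) (a : ℝ → R3 → ℝ) (B : ℝ → ℝ), StrictMono φ ∧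
      (∀ η x, Filter.Tendsto (fun n => ballSum η (g (φ n)) x) Filter.atTop (nhds (a η x))) ∧
      ∀ η x n, ‖ballSum η (g n) x‖ ≤ B η := by
  set T : ℕ → Lp ℝ 2 (volume : Measure R3) := fun n => (hg n).toLp with hT
  have hTn : ∀ n, ‖T n‖ ≤ √M := by
    intro n
    have h1 : ENNReal.ofReal (‖T n‖ ^ 2) ≤ ENNReal.ofReal M := by
      rw [ENNReal.ofReal_pow (norm_nonneg _), ofReal_norm, hT, Lp.enorm_toLp, eLpNorm_two_sq]
      exact hM n
    by_cases hM0 : 0 ≤ M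
    · rw [ENNReal.ofReal_le_ofReal_iff hM0] at h1
      exact Real.le_sqrt_of_sq_le h1
    · rw [ENNReal.ofReal_of_nonpos (not_le.1 hM0).le, nonpos_iff_eq_zero,
        ENNReal.ofReal_eq_zero] at h1
      have : ‖T n‖ = 0 := by nlinarith [norm_nonneg (T n)]
      rw [this]; positivity
  have : Fact ((2 : ℝ≥0∞) ≠ ⊤) := ⟨by norm_num⟩
  let I : ℝ → R3 → Lp ℝ 2 (volume : Measure R3) := fun η x =>
    indicatorConstLp 2 (Metric.isOpen_ball (x := x) (ε := η)).measurableSet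
        measure_ball_lt_top.ne 1
  have hI : ∀ η x n, ballSum η (g n) x = inner ℝ (I η x) (T n) := by
    intro η x n
    rw [L2.inner_indicatorConstLp_one, ballSum]
    exact integral_congr_ae (ae_restrict_of_ae (hg n).coeFn_toLp.symm)
  have hIn : ∀ η x, ‖I η x‖ = ‖I η 0‖ := by
    intro η x
    simp only [I]
    rw [norm_indicatorConstLp (by norm_num) (by norm_num),
      norm_indicatorConstLp (by norm_num) (by norm_num)]
    simp only [Measure.real, Measure.addHaar_ball_center _ x η]
  obtain ⟨f, -, φ, hφ, hφf⟩ := WeakDual.isSeqCompact_closedBall ℝ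
    (Lp ℝ 2 (volume : Measure R3)) 0 (√M)
    (x := fun n => StrongDual.toWeakDual (InnerProductSpace.toDual ℝ _ (T n)))
    (fun n => by
      change InnerProductSpace.toDual ℝ _ (T n) ∈ Metric.closedBall 0 (√M)
      rw [mem_closedBall_zero_iff, LinearIsometryEquiv.norm_map]
      exact hTn n)
  refine ⟨φ, fun η x => f (I η x), fun η => ‖I η 0‖ * √M, hφ, fun η x => ?_, fun η x n => ?_⟩
  · have h1 := (tendsto_iff_forall_eval_tendsto_topDualPairing.1 hφf) (I η x)
    refine h1.congr fun n => ?_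
    change inner ℝ (T (φ n)) _ = _
    rw [real_inner_comm, hI]
  · rw [hI]
    beta_reduce
    rw [← hIn η x]
    exact (norm_inner_le_norm _ _).trans (mul_le_mul_of_nonneg_left (hTn n) (norm_nonneg _))

theorem tendsto_eLpNorm_of_bounded {α : Type*} [MeasurableSpace α] {ν : Measure α}
    [IsFiniteMeasure ν] {m : ℕ → α → ℝ} {m0 : α → ℝ} (hm : ∀ n, StronglyMeasurable (m n)) {B : ℝ}
    (hB : ∀ n x, ‖m n x‖ ≤ B)
    (h : ∀ x, Filter.Tendsto (fun n => m n x) Filter.atTop (nhds (m0 x))) :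
    Filter.Tendsto (fun n => eLpNorm (m n - m0) 2 ν) Filter.atTop (nhds 0) := by
  have hm0m : StronglyMeasurable m0 :=
    stronglyMeasurable_of_tendsto Filter.atTop hm (tendsto_pi_nhds.2 h)
  have hB0 : ∀ x, ‖m0 x‖ ≤ B := fun x =>
    le_of_tendsto (h x).norm (Filter.Eventually.of_forall fun n => hB n x)
  have h1 : Filter.Tendsto (fun n => ∫⁻ x, ‖m n x - m0 x‖ₑ ^ 2 ∂ν) Filter.atTop
      (nhds (∫⁻ _, 0 ∂ν)) := by
    refine tendsto_lintegral_of_dominated_convergence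
      (fun _ => ENNReal.ofReal (2 * B) ^ 2)
      (fun n => ((hm n).sub hm0m).enorm.pow_const 2)
      (fun n => Filter.Eventually.of_forall fun x => ?_) ?_
      (Filter.Eventually.of_forall fun x => ?_)
    · beta_reduce
      rw [← ofReal_norm]
      gcongr
      exact (norm_sub_le _ _).trans (by linarith [hB n x, hB0 x])
    · rw [lintegral_const]
      exact ENNReal.mul_ne_top (ENNReal.pow_ne_top ENNReal.ofReal_ne_top) (measure_ne_top _ _)
    · have h2 := ((h x).sub_const (m0 x)).enorm
      rw [sub_self, enorm_zero] at h2
      have h3 := ((ENNReal.continuous_pow 2).tendsto _).comp h2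
      rwa [zero_pow two_ne_zero] at h3
  rw [lintegral_zero] at h1
  have h3 := ((ENNReal.continuous_rpow_const (y := 1 / 2)).tendsto _).comp h1
  rw [ENNReal.zero_rpow_of_pos (by norm_num)] at h3
  refine h3.congr fun n => ?_
  simp only [Function.comp_apply]
  have h4 := eLpNorm_two_sq (μ := ν) (m n - m0)
  simp only [Pi.sub_apply] at h4
  rw [← h4, ← ENNReal.rpow_natCast, ← ENNReal.rpow_mul]
  norm_num

theorem memLp_two_of_lintegral_le {F : Type*} [NormedAddCommGroup F] {f : R3 → F}
    (hf : StronglyMeasurable f) {M : ℝ}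
    (hM : ∫⁻ x, ‖f x‖ₑ ^ 2 ≤ ENNReal.ofReal M) : MemLp f 2 volume := by
  refine ⟨hf.aestronglyMeasurable, ?_⟩
  have h1 : eLpNorm f 2 volume ^ 2 < ⊤ := by
    rw [eLpNorm_two_sq]; exact hM.trans_lt ENNReal.ofReal_lt_top
  by_contra h2
  rw [not_lt, top_le_iff] at h2
  rw [h2] at h1
  simp at h1

theorem eLpNorm_sub_ballMean_le {η : ℝ} (hη : 0 < η) {f : R3 → ℝ} (hf : StronglyMeasurable f)
    (hfi : LocallyIntegrable f volume) {A : ℝ} (hA : 0 ≤ A)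
    (h : nonlocalEnergy η f ≤ ENNReal.ofReal (ballMoment η) * ENNReal.ofReal A) :
    eLpNorm (fun x => f x - (volume.real (Metric.ball (0 : R3) η))⁻¹ * ballSum η f x) 2 volume
      ≤ ENNReal.ofReal (η * √A) := by
  rw [← ENNReal.pow_le_pow_left_iff two_ne_zero, eLpNorm_two_sq]
  refine (lintegral_sub_ballMean_sq_le hη hf hfi).trans ?_
  set V := volume (Metric.ball (0 : R3) η) with hV
  have hV0 : V ≠ 0 := (Metric.measure_ball_pos _ _ hη).ne'
  have hVt : V ≠ ⊤ := measure_ball_lt_top.ne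
  calc V⁻¹ * nonlocalEnergy η f
      ≤ V⁻¹ * ((ENNReal.ofReal (η ^ 2) * V) * ENNReal.ofReal A) := by
        gcongr
        refine h.trans ?_
        gcongr
        exact ballMoment_le hη
    _ = ENNReal.ofReal (η ^ 2) * ENNReal.ofReal A := by
        rw [mul_comm _ V, mul_assoc, ← mul_assoc V⁻¹, ENNReal.inv_mul_cancel hV0 hVt, one_mul]
    _ = _ := by
        rw [← ENNReal.ofReal_pow (by positivity), mul_pow, ← ENNReal.ofReal_mul (by positivity),
          Real.sq_sqrt hA]

/-- **Rellich's theorem**, in terms of nonlocal energies. -/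
theorem exists_subseq_tendsto {g : ℕ → R3 → ℝ} (hg : ∀ n, StronglyMeasurable (g n))
    {M : ℝ} (hM : ∀ n, ∫⁻ x, ‖g n x‖ₑ ^ 2 ≤ ENNReal.ofReal M) {A : ℝ} (hA0 : 0 ≤ A)
    (hA : ∀ n, ∀ ε > 0, nonlocalEnergy ε (g n)
      ≤ ENNReal.ofReal (ballMoment ε) * ENNReal.ofReal A) :
    ∃ (φ : ℕ → ℕ) (G : R3 → ℝ), StrictMono φ ∧ StronglyMeasurable G ∧
      (∀ᵐ x, Filter.Tendsto (fun n => g (φ n) x) Filter.atTop (nhds (G x))) ∧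
      Filter.Tendsto (fun n => eLpNorm (g (φ n) - G) 2 weightedMeasure)
        Filter.atTop (nhds 0) := by
  have hgL : ∀ n, MemLp (g n) 2 volume := fun n => memLp_two_of_lintegral_le (hg n) (hM n)
  obtain ⟨φ, a, B, hφ, ha, hB⟩ := exists_subseq_ballSum_tendsto hgL hM
  have hν : ∀ n, MemLp (g n) 2 weightedMeasure := fun n => (hgL n).mono_measure weightedMeasure_le
  set Tν : ℕ → Lp ℝ 2 weightedMeasure := fun n => (hν n).toLp with hTν
  have hcauchy : CauchySeq fun n => Tν (φ n) := by
    rw [Metric.cauchySeq_iff]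
    intro δ hδ
    obtain ⟨η, hη, hηδ⟩ : ∃ η : ℝ, 0 < η ∧ η * √A ≤ δ / 4 := by
      refine ⟨δ / 4 / (√A + 1), by positivity, ?_⟩
      rw [div_mul_eq_mul_div]
      refine div_le_of_le_mul₀ (by positivity) (by positivity) ?_
      exact mul_le_mul_of_nonneg_left (by linarith) (by positivity)
    set c : ℝ := (volume.real (Metric.ball (0 : R3) η))⁻¹ with hc
    set m : ℕ → R3 → ℝ := fun n x => c * ballSum η (g (φ n)) x with hm
    set m0 : R3 → ℝ := fun x => c * a η x with hm0
    have hmm : ∀ n, StronglyMeasurable (m n) := fun n =>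
      stronglyMeasurable_const.mul (stronglyMeasurable_ballSum η (hg _))
    have hmt : ∀ x, Filter.Tendsto (fun n => m n x) Filter.atTop (nhds (m0 x)) := fun x =>
      (ha η x).const_mul c
    have hm0m : StronglyMeasurable m0 :=
      stronglyMeasurable_of_tendsto Filter.atTop hmm (tendsto_pi_nhds.2 hmt)
    have hmid := tendsto_eLpNorm_of_bounded (ν := weightedMeasure) hmm (B := |c| * B η)
      (fun n x => by
        simp only [hm]
        rw [norm_mul, Real.norm_eq_abs]
        exact mul_le_mul_of_nonneg_left (hB η x _) (abs_nonneg _)) hmt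
    have hev := hmid.eventually (gt_mem_nhds (ENNReal.ofReal_pos.2 (show 0 < δ / 4 by positivity)))
    obtain ⟨N, hN⟩ := Filter.eventually_atTop.1 hev
    have hone : ∀ n ≥ N, eLpNorm (g (φ n) - m0) 2 weightedMeasure < ENNReal.ofReal (δ / 2) := by
      intro n hn
      have e1 : g (φ n) - m0 = (g (φ n) - m n) + (m n - m0) := by abel
      rw [e1]
      refine (eLpNorm_add_le ((hg _).sub (hmm n)).aestronglyMeasurable
        ((hmm n).sub hm0m).aestronglyMeasurable (by norm_num)).trans_lt ?_
      rw [show δ / 2 = δ / 4 + δ / 4 by ring, ENNReal.ofReal_add (by positivity) (by positivity)]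
      suffices h : eLpNorm (g (φ n) - m n) 2 weightedMeasure ≤ ENNReal.ofReal (δ / 4) from
        ENNReal.add_lt_add_of_le_of_lt (ne_top_of_le_ne_top ENNReal.ofReal_ne_top h) h (hN n hn)
      refine (eLpNorm_mono_measure _ weightedMeasure_le).trans ?_
      refine (eLpNorm_sub_ballMean_le hη (hg (φ n)) ((hgL (φ n)).locallyIntegrable (by norm_num))
        hA0 (hA _ η hη)).trans (ENNReal.ofReal_le_ofReal hηδ)
    refine ⟨N, fun n hn k hk => ?_⟩
    rw [← edist_lt_ofReal, hTν, Lp.edist_toLp_toLp]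
    have e2 : g (φ n) - g (φ k) = (g (φ n) - m0) - (g (φ k) - m0) := by abel
    rw [e2]
    refine (eLpNorm_sub_le ((hg _).sub hm0m).aestronglyMeasurable
      ((hg _).sub hm0m).aestronglyMeasurable (by norm_num)).trans_lt ?_
    rw [show δ = δ / 2 + δ / 2 by ring, ENNReal.ofReal_add (by positivity) (by positivity)]
    exact ENNReal.add_lt_add (hone n hn) (hone k hk)
  obtain ⟨G, hG⟩ := cauchySeq_tendsto_of_complete hcauchy
  obtain ⟨ψ, hψ, hψt⟩ := (tendstoInMeasure_of_tendsto_Lp hG).exists_seq_tendsto_ae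
  refine ⟨φ ∘ ψ, G, hφ.comp hψ, Lp.stronglyMeasurable G, ?_, ?_⟩
  · have h1 : ∀ᵐ x ∂weightedMeasure, ∀ n, Tν n x = g n x :=
      ae_all_iff.2 fun n => (hν n).coeFn_toLp
    refine volume_ac_weightedMeasure.ae_le ?_
    filter_upwards [h1, hψt] with x hx1 hx2
    simpa only [hx1, Function.comp_apply] using hx2
  · have h2 := ((Lp.tendsto_Lp_iff_tendsto_eLpNorm' _ _).1 hG).comp hψ.tendsto_atTop
    refine h2.congr fun n => eLpNorm_congr_ae ?_
    filter_upwards [(hν (φ (ψ n))).coeFn_toLp] with x hx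
    simp only [Pi.sub_apply, hTν, hx, Function.comp_apply]

/-! ### Polarization with respect to half-spaces -/

/-- Reflection across the hyperplane `⟪e, x⟫ = s`, for a unit vector `e`. -/
def hyperReflect (e : R3) (s : ℝ) (x : R3) : R3 := x + (2 * (s - inner ℝ e x)) • e

theorem inner_hyperReflect {e : R3} (he : ‖e‖ = 1) (s : ℝ) (x : R3) :
    inner ℝ e (hyperReflect e s x) = 2 * s - inner ℝ e x := by
  rw [hyperReflect, inner_add_right, inner_smul_right, real_inner_self_eq_norm_sq, he]; ring

theorem hyperReflect_hyperReflect {e : R3} (he : ‖e‖ = 1) (s : ℝ) (x : R3) : hyperReflect e s (hyperReflect e s x) = x := by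
  rw [hyperReflect, inner_hyperReflect he, hyperReflect, add_assoc, ← add_smul]
  ring_nf
  simp

theorem norm_hyperReflect_sq {e : R3} (he : ‖e‖ = 1) (s : ℝ) (x : R3) :
    ‖hyperReflect e s x‖ ^ 2 = ‖x‖ ^ 2 + 4 * s * (s - inner ℝ e x) := by
  rw [hyperReflect, norm_add_sq_real, inner_smul_right, norm_smul, he, real_inner_comm,
    Real.norm_eq_abs, mul_one, sq_abs]
  ring

theorem norm_sub_hyperReflect_sq {e : R3} (he : ‖e‖ = 1) (s : ℝ) (x y : R3) :
    ‖x - hyperReflect e s y‖ ^ 2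
      = ‖x - y‖ ^ 2 + 4 * (s - inner ℝ e x) * (s - inner ℝ e y) := by
  have h : x - hyperReflect e s y = (x - y) - (2 * (s - inner ℝ e y)) • e := by
    rw [hyperReflect]; abel
  have h0 : inner ℝ (x - y) e = inner ℝ e x - inner ℝ e y := by
    rw [real_inner_comm, inner_sub_right]
  rw [h, norm_sub_sq_real, inner_smul_right, h0, norm_smul, he,
    Real.norm_eq_abs, mul_one, sq_abs]
  ring

theorem dist_hyperReflect {e : R3} (he : ‖e‖ = 1) (s : ℝ) (x y : R3) :
    dist (hyperReflect e s x) (hyperReflect e s y) = dist x y := by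
  rw [dist_eq_norm, dist_eq_norm]
  have h : ‖hyperReflect e s x - hyperReflect e s y‖ ^ 2 = ‖x - y‖ ^ 2 := by
    rw [norm_sub_hyperReflect_sq he, inner_hyperReflect he, norm_sub_rev,
      norm_sub_hyperReflect_sq he, norm_sub_rev]
    ring
  exact (sq_eq_sq₀ (norm_nonneg _) (norm_nonneg _)).1 h

theorem dist_hyperReflect_right {e : R3} (he : ‖e‖ = 1) (s : ℝ) (x y : R3) :
    dist x (hyperReflect e s y) = dist (hyperReflect e s x) y := by
  conv_lhs => rw [← hyperReflect_hyperReflect he s x]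
  exact dist_hyperReflect he s _ _

theorem measurePreserving_hyperReflect {e : R3} (he : ‖e‖ = 1) (s : ℝ) : MeasurePreserving (hyperReflect e s) := by
  have h1 : hyperReflect e s = (fun x => (2 * s) • e + x) ∘
      ((Submodule.span ℝ {e}).reflection.trans (LinearIsometryEquiv.neg ℝ)) := by
    funext x
    simp only [Function.comp_apply, LinearIsometryEquiv.trans_apply, LinearIsometryEquiv.coe_neg,
      Submodule.reflection_singleton_apply, he, hyperReflect]
    simp only [RCLike.ofReal_real_eq_id, id, one_pow, div_one]
    module
  rw [h1]
  exact (measurePreserving_add_left volume _).comp (LinearIsometryEquiv.measurePreserving _)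

theorem volume_hyperplane {e : R3} (he : ‖e‖ = 1) (s : ℝ) : volume {x : R3 | inner ℝ e x = s} = 0 := by
  have h1 : {x : R3 | inner ℝ e x = s}
      = ((AffineSubspace.mk' (s • e) (Submodule.span ℝ {e})ᗮ : AffineSubspace ℝ R3) : Set R3) := by
    ext x
    simp only [Set.mem_ofPred_eq, SetLike.mem_coe, AffineSubspace.mem_mk', vsub_eq_sub,
      Submodule.mem_orthogonal_singleton_iff_inner_right, inner_sub_right, inner_smul_right,
      real_inner_self_eq_norm_sq, he]
    constructor
    · intro h; rw [h]; ring
    · intro h; linarith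
  rw [h1]
  refine Measure.addHaar_affineSubspace _ _ fun h => ?_
  have h2 : (0 : R3) + (s + 1) • e ∈ {x : R3 | inner ℝ e x = s} := by rw [h1, h]; trivial
  simp only [Set.mem_ofPred_eq, zero_add, inner_smul_right, real_inner_self_eq_norm_sq, he] at h2
  linarith

theorem measurableSet_halfSpace (e : R3) (s : ℝ) : MeasurableSet {x : R3 | inner ℝ e x < s} :=
  measurableSet_lt (by fun_prop) measurable_const

/-- Folding an integral over space along a hyperplane. -/
theorem lintegral_eq_fold {e : R3} (he : ‖e‖ = 1) (s : ℝ) {f : R3 → ℝ≥0∞} (hf : Measurable f) :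
    ∫⁻ x, f x = ∫⁻ x in {x : R3 | inner ℝ e x < s}, (f x + f (hyperReflect e s x)) := by
  have hH := measurableSet_halfSpace e s
  have hσ := measurePreserving_hyperReflect he s
  rw [lintegral_add_left hf, ← lintegral_add_compl f hH]
  congr 1
  have h1 : (hyperReflect e s) ⁻¹' {x : R3 | inner ℝ e x < s}ᶜ
      =ᵐ[volume] {x : R3 | inner ℝ e x < s} := by
    have h2 : ∀ᵐ x : R3, inner ℝ e x ≠ s := by
      rw [ae_iff]; simpa using volume_hyperplane he s
    filter_upwards [h2] with x hx
    refine propext ?_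
    change ¬ (inner ℝ e (hyperReflect e s x) < s) ↔ inner ℝ e x < s
    rw [inner_hyperReflect he]
    constructor
    · intro h; exact lt_of_le_of_ne (by linarith) hx
    · intro h; linarith
  rw [← setLIntegral_congr h1, hσ.setLIntegral_comp_preimage hH.compl hf]

/-- Two-point symmetrization: the larger of the values at `x` and its mirror image is placed in
the half-space `⟪e, x⟫ < s`. -/
def polarize (e : R3) (s : ℝ) (v : R3 → ℝ) (x : R3) : ℝ :=
  if inner ℝ e x < s then max (v x) (v (hyperReflect e s x))
  else min (v x) (v (hyperReflect e s x))

theorem polarize_of_lt {e : R3} {s : ℝ} (v : R3 → ℝ) {x : R3} (hx : inner ℝ e x < s) :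
    polarize e s v x = max (v x) (v (hyperReflect e s x)) := if_pos hx

theorem polarize_reflect_of_lt {e : R3} (he : ‖e‖ = 1) {s : ℝ} (v : R3 → ℝ) {x : R3} (hx : inner ℝ e x < s) :
    polarize e s v (hyperReflect e s x) = min (v x) (v (hyperReflect e s x)) := by
  rw [polarize, if_neg, hyperReflect_hyperReflect he, min_comm]
  rw [inner_hyperReflect he]; linarith

theorem stronglyMeasurable_polarize {e : R3} (he : ‖e‖ = 1) {s : ℝ} {v : R3 → ℝ} (hv : StronglyMeasurable v) :
    StronglyMeasurable (polarize e s v) := by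
  have h1 : StronglyMeasurable fun x => v (hyperReflect e s x) :=
    hv.comp_measurable (measurePreserving_hyperReflect he s).measurable
  exact StronglyMeasurable.ite (measurableSet_halfSpace e s) (hv.sup h1) (hv.inf h1)

/-- Polarization moves a monotone functional of `v` towards sets that prefer the half-space. -/
theorem setLIntegral_le_polarize {e : R3} (he : ‖e‖ = 1) {s : ℝ} {v : R3 → ℝ} (hv : StronglyMeasurable v) {φ : ℝ → ℝ≥0∞}
    (hφ : Monotone φ) {w : R3 → ℝ≥0∞} (hw : Measurable w)
    (hws : ∀ x, inner ℝ e x < s → w (hyperReflect e s x) ≤ w x) :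
    ∫⁻ x, w x * φ (v x) ≤ ∫⁻ x, w x * φ (polarize e s v x) := by
  have m1 : Measurable fun x => w x * φ (v x) := hw.mul (hφ.measurable.comp hv.measurable)
  have m2 : Measurable fun x => w x * φ (polarize e s v x) :=
    hw.mul (hφ.measurable.comp (stronglyMeasurable_polarize he hv).measurable)
  rw [lintegral_eq_fold he s m1, lintegral_eq_fold he s m2]
  refine setLIntegral_mono' (measurableSet_halfSpace e s) fun x hx => ?_
  rw [polarize_of_lt v hx, polarize_reflect_of_lt he v hx]
  rcases le_total (v x) (v (hyperReflect e s x)) with h | h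
  · rw [max_eq_right h, min_eq_left h]
    obtain ⟨d, hd⟩ := exists_add_of_le (hφ h)
    obtain ⟨c, hc⟩ := exists_add_of_le (hws x hx)
    rw [hd, hc]
    have : w (hyperReflect e s x) * d ≤ (w (hyperReflect e s x) + c) * d := by
      gcongr; exact le_self_add
    calc _ = (w (hyperReflect e s x) + c) * φ (v x) + w (hyperReflect e s x) * φ (v x)
            + w (hyperReflect e s x) * d := by ring
      _ ≤ (w (hyperReflect e s x) + c) * φ (v x) + w (hyperReflect e s x) * φ (v x)
            + (w (hyperReflect e s x) + c) * d := by gcongr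
      _ = _ := by ring
  · rw [max_eq_left h, min_eq_right h]

theorem lintegral_polarize {e : R3} (he : ‖e‖ = 1) {s : ℝ} {v : R3 → ℝ} (hv : StronglyMeasurable v) {φ : ℝ → ℝ≥0∞}
    (hφ : Measurable φ) : ∫⁻ x, φ (polarize e s v x) = ∫⁻ x, φ (v x) := by
  have m1 : Measurable fun x => φ (v x) := hφ.comp hv.measurable
  have m2 : Measurable fun x => φ (polarize e s v x) :=
    hφ.comp (stronglyMeasurable_polarize he hv).measurable
  rw [lintegral_eq_fold he s m2, lintegral_eq_fold he s m1]
  refine setLIntegral_congr_fun (measurableSet_halfSpace e s) fun x hx => ?_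
  rw [polarize_of_lt v hx, polarize_reflect_of_lt he v hx]
  rcases le_total (v x) (v (hyperReflect e s x)) with h | h
  · rw [max_eq_right h, min_eq_left h, add_comm]
  · rw [max_eq_left h, min_eq_right h]

/-- If polarization does not increase the integral against a weight that strictly prefers the
half-space, then `v` is already polarized. -/
theorem le_of_lintegral_polarize_le {e : R3} (he : ‖e‖ = 1) {s : ℝ} {v : R3 → ℝ} (hv : StronglyMeasurable v) (hv0 : ∀ x, 0 ≤ v x)
    {w : R3 → ℝ} (hw : Measurable w) (hw0 : ∀ x, 0 < w x)
    (hws : ∀ x, inner ℝ e x < s → w (hyperReflect e s x) < w x)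
    (hfin : ∫⁻ x, ENNReal.ofReal (w x) * ENNReal.ofReal (v x) ≠ ⊤)
    (hle : ∫⁻ x, ENNReal.ofReal (w x) * ENNReal.ofReal (polarize e s v x)
      ≤ ∫⁻ x, ENNReal.ofReal (w x) * ENNReal.ofReal (v x)) :
    ∀ᵐ x : R3, inner ℝ e x < s → v (hyperReflect e s x) ≤ v x := by
  have hpm := stronglyMeasurable_polarize he (s := s) hv
  have m1 : Measurable fun x => ENNReal.ofReal (w x) * ENNReal.ofReal (v x) :=
    hw.ennreal_ofReal.mul hv.measurable.ennreal_ofReal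
  have m2 : Measurable fun x => ENNReal.ofReal (w x) * ENNReal.ofReal (polarize e s v x) :=
    hw.ennreal_ofReal.mul hpm.measurable.ennreal_ofReal
  have hσ := (measurePreserving_hyperReflect he s).measurable
  rw [lintegral_eq_fold he s m1] at hfin hle
  rw [lintegral_eq_fold he s m2] at hle
  have key : ∀ x, inner ℝ e x < s →
      (ENNReal.ofReal (w x) * ENNReal.ofReal (polarize e s v x)
        + ENNReal.ofReal (w (hyperReflect e s x))
          * ENNReal.ofReal (polarize e s v (hyperReflect e s x))
        = ENNReal.ofReal (w x * max (v x) (v (hyperReflect e s x))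
          + w (hyperReflect e s x) * min (v x) (v (hyperReflect e s x)))) ∧
      (ENNReal.ofReal (w x) * ENNReal.ofReal (v x)
        + ENNReal.ofReal (w (hyperReflect e s x)) * ENNReal.ofReal (v (hyperReflect e s x))
        = ENNReal.ofReal (w x * v x + w (hyperReflect e s x) * v (hyperReflect e s x))) := by
    intro x hx
    have a1 := hw0 x
    have a2 := hw0 (hyperReflect e s x)
    have a3 := hv0 x
    have a4 := hv0 (hyperReflect e s x)
    rw [polarize_of_lt v hx, polarize_reflect_of_lt he v hx, ← ENNReal.ofReal_mul a1.le,
      ← ENNReal.ofReal_mul a2.le, ← ENNReal.ofReal_mul a1.le, ← ENNReal.ofReal_mul a2.le,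
      ENNReal.ofReal_add (by positivity) (mul_nonneg a2.le (le_min a3 a4)),
      ENNReal.ofReal_add (by positivity) (by positivity)]
    exact ⟨rfl, rfl⟩
  have h1 := ae_eq_of_ae_le_of_lintegral_le
    (μ := volume.restrict {x : R3 | inner ℝ e x < s})
    (f := fun x => ENNReal.ofReal (w x) * ENNReal.ofReal (v x)
        + ENNReal.ofReal (w (hyperReflect e s x)) * ENNReal.ofReal (v (hyperReflect e s x)))
    (g := fun x => ENNReal.ofReal (w x) * ENNReal.ofReal (polarize e s v x)
        + ENNReal.ofReal (w (hyperReflect e s x))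
          * ENNReal.ofReal (polarize e s v (hyperReflect e s x))) ?_ hfin
    ((m2.add (m2.comp hσ)).aemeasurable) hle
  · rw [Filter.EventuallyEq, ae_restrict_iff' (measurableSet_halfSpace e s)] at h1
    filter_upwards [h1] with x hx hxs
    have h2 := hx hxs
    rw [(key x hxs).1, (key x hxs).2] at h2
    by_contra hlt
    rw [not_le] at hlt
    rw [max_eq_right hlt.le, min_eq_left hlt.le] at h2
    have a1 := hw0 x
    have a2 := hw0 (hyperReflect e s x)
    have a3 := hv0 x
    have a4 := hv0 (hyperReflect e s x)
    rw [ENNReal.ofReal_eq_ofReal_iff (by positivity) (by positivity)] at h2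
    nlinarith [hws x hxs]
  · refine (ae_restrict_iff' (measurableSet_halfSpace e s)).2
      (Filter.Eventually.of_forall fun x hx => ?_)
    beta_reduce
    rw [(key x hx).1, (key x hx).2]
    refine ENNReal.ofReal_le_ofReal ?_
    rcases le_total (v x) (v (hyperReflect e s x)) with h | h
    · rw [max_eq_right h, min_eq_left h]
      nlinarith [hws x hx]
    · rw [max_eq_left h, min_eq_right h]

/-- Polarization does not increase the nonlocal Dirichlet energies: mirror pairs in the same
half-space are closer than mirror pairs in opposite half-spaces. -/
theorem nonlocalEnergy_polarize_le {e : R3} (he : ‖e‖ = 1) {s : ℝ} {v : R3 → ℝ} (hv : StronglyMeasurable v) (ε : ℝ) :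
    nonlocalEnergy ε (polarize e s v) ≤ nonlocalEnergy ε v := by
  have hσ := (measurePreserving_hyperReflect he s).measurable
  obtain ⟨k, hk⟩ : ∃ k : (R3 → ℝ) → R3 → R3 → ℝ,
      k = fun f x y => if dist x y < ε then (f y - f x) ^ 2 else 0 := ⟨_, rfl⟩
  have hk0 : ∀ f x y, 0 ≤ k f x y := fun f x y => by
    simp only [hk]; split_ifs <;> positivity
  have hkm : ∀ {f : R3 → ℝ}, StronglyMeasurable f →
      Measurable fun z : R3 × R3 => ENNReal.ofReal (k f z.1 z.2) := by
    intro f hf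
    rw [hk]
    refine Measurable.ennreal_ofReal (Measurable.ite ?_ ?_ measurable_const)
    · exact measurableSet_lt (f := fun z : R3 × R3 => dist z.1 z.2) (by fun_prop) measurable_const
    · exact ((hf.measurable.comp measurable_snd).sub (hf.measurable.comp measurable_fst)).pow_const 2
  have hE : ∀ f : R3 → ℝ, nonlocalEnergy ε f = ∫⁻ x, ∫⁻ y, ENNReal.ofReal (k f x y) := by
    intro f
    refine lintegral_congr fun x => ?_
    rw [← lintegral_indicator Metric.isOpen_ball.measurableSet]
    refine lintegral_congr fun y => ?_
    by_cases hy : dist x y < ε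
    · rw [Set.indicator_of_mem (by rwa [Metric.mem_ball, dist_comm])]
      simp only [hk, if_pos hy]
      rw [← ofReal_norm, ← ENNReal.ofReal_pow (norm_nonneg _), Real.norm_eq_abs, sq_abs]
    · rw [Set.indicator_of_notMem (by rwa [Metric.mem_ball, dist_comm])]
      simp [hk, if_neg hy]
  have hfold : ∀ {f : R3 → ℝ}, StronglyMeasurable f → nonlocalEnergy ε f
      = ∫⁻ x in {x : R3 | inner ℝ e x < s}, ∫⁻ y in {x : R3 | inner ℝ e x < s},
        ENNReal.ofReal ((k f x y + k f x (hyperReflect e s y))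
          + (k f (hyperReflect e s x) y + k f (hyperReflect e s x) (hyperReflect e s y))) := by
    intro f hf
    have hm := hkm hf
    have hm1 : ∀ x, Measurable fun y => ENNReal.ofReal (k f x y) := fun x =>
      hm.comp measurable_prodMk_left
    have hm2 : Measurable fun x => ∫⁻ y, ENNReal.ofReal (k f x y) :=
      Measurable.lintegral_prod_right' (f := fun z : R3 × R3 => ENNReal.ofReal (k f z.1 z.2)) hm
    rw [hE, lintegral_eq_fold he s hm2]
    refine lintegral_congr fun x => ?_
    have hm3 : Measurable fun y => ENNReal.ofReal (k f x y)
        + ENNReal.ofReal (k f x (hyperReflect e s y)) := (hm1 x).add ((hm1 x).comp hσ)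
    rw [lintegral_eq_fold he s (hm1 x), lintegral_eq_fold he s (hm1 (hyperReflect e s x)),
      ← lintegral_add_left hm3]
    refine lintegral_congr fun y => ?_
    rw [ENNReal.ofReal_add (add_nonneg (hk0 _ _ _) (hk0 _ _ _))
      (add_nonneg (hk0 _ _ _) (hk0 _ _ _)), ENNReal.ofReal_add (hk0 _ _ _) (hk0 _ _ _),
      ENNReal.ofReal_add (hk0 _ _ _) (hk0 _ _ _)]
  rw [hfold hv, hfold (stronglyMeasurable_polarize he hv)]
  refine setLIntegral_mono' (measurableSet_halfSpace e s) fun x hx => ?_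
  refine setLIntegral_mono' (measurableSet_halfSpace e s) fun y hy => ?_
  refine ENNReal.ofReal_le_ofReal ?_
  have hclose : dist x y ≤ dist x (hyperReflect e s y) := by
    rw [dist_eq_norm, dist_eq_norm]
    refine le_of_sq_le_sq ?_ (norm_nonneg _)
    rw [norm_sub_hyperReflect_sq he]
    have h1 : 0 < s - inner ℝ e x := sub_pos.2 hx
    have h2 : 0 < s - inner ℝ e y := sub_pos.2 hy
    nlinarith [mul_pos h1 h2]
  simp only [hk, dist_hyperReflect he, ← dist_hyperReflect_right he, polarize_of_lt v hx,
    polarize_of_lt v hy, polarize_reflect_of_lt he v hx, polarize_reflect_of_lt he v hy]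
  generalize v x = a
  generalize v y = b
  generalize v (hyperReflect e s x) = a'
  generalize v (hyperReflect e s y) = b'
  by_cases h1 : dist x y < ε
  · by_cases h2 : dist x (hyperReflect e s y) < ε
    · simp only [if_pos h1, if_pos h2]
      rcases le_total a a' with h | h <;> rcases le_total b b' with h' | h' <;>
        simp only [max_eq_left, max_eq_right, min_eq_left, min_eq_right, h, h'] <;> linarith
    · simp only [if_pos h1, if_neg h2]
      rcases le_total a a' with h | h <;> rcases le_total b b' with h' | h' <;>
        simp only [max_eq_left, max_eq_right, min_eq_left, min_eq_right, h, h'] <;>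
        nlinarith [mul_nonneg (sub_nonneg.2 h) (sub_nonneg.2 h')]
  · have h2 : ¬ dist x (hyperReflect e s y) < ε := fun h => h1 (hclose.trans_lt h)
    simp only [if_neg h1, if_neg h2, le_refl]

/-! ### Interpolation of powers -/

theorem rpow_le_interpolate {α σ β t Λ : ℝ} (hΛ : 0 < Λ) (ht : 0 ≤ t) (hα : 0 < α) (h1 : α ≤ σ)
    (h2 : σ ≤ β) : t ^ σ ≤ Λ ^ (σ - α) * t ^ α + Λ ^ (σ - β) * t ^ β := by
  rcases ht.eq_or_lt with rfl | ht0
  · rw [Real.zero_rpow (by linarith)]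
    positivity
  rcases le_total t Λ with h | h
  · have h3 : t ^ σ = t ^ (σ - α) * t ^ α := by rw [← Real.rpow_add ht0]; ring_nf
    have h4 : t ^ (σ - α) ≤ Λ ^ (σ - α) := Real.rpow_le_rpow ht h (by linarith)
    rw [h3]
    have : 0 ≤ Λ ^ (σ - β) * t ^ β := by positivity
    nlinarith [Real.rpow_pos_of_pos ht0 α]
  · have h3 : t ^ σ = t ^ (σ - β) * t ^ β := by rw [← Real.rpow_add ht0]; ring_nf
    have h4 : t ^ (σ - β) ≤ Λ ^ (σ - β) := Real.rpow_le_rpow_of_nonpos hΛ h (by linarith)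
    rw [h3]
    have : 0 ≤ Λ ^ (σ - α) * t ^ α := by positivity
    nlinarith [Real.rpow_pos_of_pos ht0 β]

theorem enorm_rpow_eq_ofReal {E : Type*} [NormedAddCommGroup E] (v : E) {σ : ℝ} (hσ : 0 ≤ σ) :
    ‖v‖ₑ ^ σ = ENNReal.ofReal (‖v‖ ^ σ) := by
  rw [← ofReal_norm, ENNReal.ofReal_rpow_of_nonneg (norm_nonneg _) hσ]

theorem enorm_rpow_le_interpolate {E : Type*} [NormedAddCommGroup E] (v : E) {α σ β Λ : ℝ}
    (hΛ : 0 < Λ) (hα : 0 < α) (h1 : α ≤ σ) (h2 : σ ≤ β) :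
    ‖v‖ₑ ^ σ ≤ ENNReal.ofReal (Λ ^ (σ - α)) * ‖v‖ₑ ^ α
      + ENNReal.ofReal (Λ ^ (σ - β)) * ‖v‖ₑ ^ β := by
  rw [enorm_rpow_eq_ofReal v (by linarith), enorm_rpow_eq_ofReal v hα.le,
    enorm_rpow_eq_ofReal v (by linarith), ← ENNReal.ofReal_mul (by positivity),
    ← ENNReal.ofReal_mul (by positivity), ← ENNReal.ofReal_add (by positivity) (by positivity)]
  exact ENNReal.ofReal_le_ofReal (rpow_le_interpolate hΛ (norm_nonneg _) hα h1 h2)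

theorem lintegral_rpow_le_interpolate {α' E : Type*} [MeasurableSpace α'] {μ : Measure α'}
    [NormedAddCommGroup E] {v : α' → E} (hv : AEStronglyMeasurable v μ) {α σ β Λ : ℝ}
    (hΛ : 0 < Λ) (hα : 0 < α) (h1 : α ≤ σ) (h2 : σ ≤ β) :
    ∫⁻ x, ‖v x‖ₑ ^ σ ∂μ ≤ ENNReal.ofReal (Λ ^ (σ - α)) * ∫⁻ x, ‖v x‖ₑ ^ α ∂μ
      + ENNReal.ofReal (Λ ^ (σ - β)) * ∫⁻ x, ‖v x‖ₑ ^ β ∂μ := by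
  refine (lintegral_mono fun x => enorm_rpow_le_interpolate (v x) hΛ hα h1 h2).trans ?_
  rw [lintegral_add_left' ((hv.enorm.pow_const _).const_mul _),
    lintegral_const_mul' _ _ ENNReal.ofReal_ne_top, lintegral_const_mul' _ _ ENNReal.ofReal_ne_top]

/-- Convergence in `L²` together with a bound in `L⁶` gives convergence in the spaces between. -/
theorem tendsto_lintegral_rpow_of_sq {α E : Type*} [MeasurableSpace α] {μ : Measure α}
    [NormedAddCommGroup E] {ι : Type*} {l : Filter ι} {w : ι → α → E}
    (hw : ∀ n, AEStronglyMeasurable (w n) μ) {σ : ℝ} (hσ : 2 < σ) (hσ6 : σ < 6) {C : ℝ≥0∞}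
    (hC : C ≠ ⊤) (h6 : ∀ n, ∫⁻ x, ‖w n x‖ₑ ^ (6 : ℝ) ∂μ ≤ C)
    (h2 : Filter.Tendsto (fun n => ∫⁻ x, ‖w n x‖ₑ ^ (2 : ℝ) ∂μ) l (nhds 0)) :
    Filter.Tendsto (fun n => ∫⁻ x, ‖w n x‖ₑ ^ σ ∂μ) l (nhds 0) := by
  rw [ENNReal.tendsto_nhds_zero]
  intro δ hδ
  have hlim : Filter.Tendsto (fun Λ : ℝ => ENNReal.ofReal (Λ ^ (σ - 6)) * C) Filter.atTop
      (nhds 0) := by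
    have h1 : Filter.Tendsto (fun Λ : ℝ => Λ ^ (σ - 6)) Filter.atTop (nhds 0) := by
      have := tendsto_rpow_neg_atTop (show 0 < 6 - σ by linarith)
      simpa using this
    have h3 := ENNReal.Tendsto.mul_const (ENNReal.tendsto_ofReal h1) (Or.inr hC)
    simpa using h3
  have hδ2 : 0 < δ / 2 := ENNReal.div_pos hδ.ne' (by norm_num)
  obtain ⟨Λ, hΛ1, hΛ0⟩ := ((ENNReal.tendsto_nhds_zero.1 hlim (δ / 2) hδ2).and
    (Filter.eventually_gt_atTop 0)).exists
  have h3 := ENNReal.Tendsto.const_mul (a := ENNReal.ofReal (Λ ^ (σ - 2))) h2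
    (Or.inr ENNReal.ofReal_ne_top)
  rw [mul_zero] at h3
  filter_upwards [ENNReal.tendsto_nhds_zero.1 h3 (δ / 2) hδ2] with n hn
  refine (lintegral_rpow_le_interpolate (hw n) hΛ0 two_pos hσ.le hσ6.le).trans ?_
  calc _ ≤ δ / 2 + δ / 2 := add_le_add hn (le_trans (by gcongr; exact h6 n) hΛ1)
    _ = δ := ENNReal.add_halves δ

theorem lintegral_enorm_rpow_eq_eLpNorm {α E : Type*} [MeasurableSpace α] {μ : Measure α}
    [NormedAddCommGroup E] {σ : ℝ} (hσ : 0 < σ) (v : α → E) :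
    ∫⁻ x, ‖v x‖ₑ ^ σ ∂μ = eLpNorm v (ENNReal.ofReal σ) μ ^ σ := by
  rw [eLpNorm_eq_lintegral_rpow_enorm_toReal (by simpa using hσ) ENNReal.ofReal_ne_top,
    ENNReal.toReal_ofReal hσ.le, ← ENNReal.rpow_mul, one_div, inv_mul_cancel₀ hσ.ne',
    ENNReal.rpow_one]

/-- The constant in `∫ |u|⁶ ≤ S (∫ |∇u|²)³`. -/
theorem exists_sobolev_lintegral : ∃ S : ℝ, 0 < S ∧ ∀ u : H1,
    ∫⁻ x, ‖fn u x‖ₑ ^ (6 : ℝ) ≤ ENNReal.ofReal (S * kinetic u ^ 3) := by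
  obtain ⟨S, hS⟩ := exists_sobolev
  refine ⟨(S : ℝ) ^ 6 + 1, by positivity, fun u => ?_⟩
  have h1 : ENNReal.ofReal 6 = 6 := by norm_num
  rw [lintegral_enorm_rpow_eq_eLpNorm (by norm_num), h1]
  have h2 : eLpNorm (grad u) 2 volume = ENNReal.ofReal ‖grad u‖ := by
    rw [ofReal_norm]; exact (Lp.enorm_def _).symm
  have h3 := hS u
  rw [h2] at h3
  calc eLpNorm (fn u) 6 volume ^ (6 : ℝ) ≤ (S * ENNReal.ofReal ‖grad u‖) ^ (6 : ℝ) := by gcongr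
    _ = ENNReal.ofReal (S ^ 6 * kinetic u ^ 3) := by
      rw [← ENNReal.ofReal_coe_nnreal, ← ENNReal.ofReal_mul (by positivity),
        ENNReal.ofReal_rpow_of_nonneg (by positivity) (by norm_num), kinetic_eq_norm_sq]
      congr 1
      rw [show (6 : ℝ) = ((6 : ℕ) : ℝ) by norm_num, Real.rpow_natCast]
      ring
    _ ≤ _ := by
      refine ENNReal.ofReal_le_ofReal ?_
      have := kinetic_nonneg u
      gcongr
      linarith

/-! ### Real functions of finite nonlocal energy -/

theorem nonlocalEnergy_norm_le {F : Type*} [NormedAddCommGroup F] (ε : ℝ) (u : R3 → F) :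
    nonlocalEnergy ε (fun x => ‖u x‖) ≤ nonlocalEnergy ε u := by
  refine lintegral_mono fun x => lintegral_mono fun y => ?_
  gcongr
  rw [← ofReal_norm, ← ofReal_norm]
  exact ENNReal.ofReal_le_ofReal (abs_norm_sub_norm_le _ _)

/-- Real functions with bounded nonlocal energies, as elements of `H¹`. -/
theorem exists_H1_of_real {v : R3 → ℝ} (hv : StronglyMeasurable v) {M A : ℝ} (hA0 : 0 ≤ A)
    (hM : ∫⁻ x, ‖v x‖ₑ ^ 2 ≤ ENNReal.ofReal M)
    (hA : ∀ ε > 0, nonlocalEnergy ε v ≤ ENNReal.ofReal (ballMoment ε) * ENNReal.ofReal A) :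
    ∃ U : H1, (∀ᵐ x, fn U x = (v x : ℂ)) ∧ kinetic U ≤ A := by
  have hvL : MemLp (fun x => (v x : ℂ)) 2 volume := (memLp_two_of_lintegral_le hv hM).ofReal
  obtain ⟨U, hU, hK⟩ := exists_H1_of_nonlocalEnergy_le hvL.toLp hA0 fun ε hε => by
    rw [nonlocalEnergy_congr_ae hvL.coeFn_toLp]
    refine le_trans (le_of_eq ?_) (hA ε hε)
    refine lintegral_congr fun x => lintegral_congr fun y => ?_
    rw [← Complex.ofReal_sub, ← ofReal_norm, Complex.norm_real, ofReal_norm]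
  refine ⟨U, ?_, hK⟩
  rw [hU]
  exact hvL.coeFn_toLp

/-! ### A compact class that is stable under polarization -/

/-- Nonnegative functions with prescribed bounds on mass, Dirichlet energy and the lower power,
and with lower bounds on the higher power over all balls around the origin. -/
structure SymmClass (q p M A : ℝ) (N : ℝ≥0∞) (b : ℝ → ℝ≥0∞) (v : R3 → ℝ) : Prop where
  meas : StronglyMeasurable v
  nonneg : ∀ x, 0 ≤ v x
  mass : ∫⁻ x, ‖v x‖ₑ ^ 2 ≤ ENNReal.ofReal M
  energy : ∀ ε > 0, nonlocalEnergy ε v ≤ ENNReal.ofReal (ballMoment ε) * ENNReal.ofReal A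
  lower : ∫⁻ x, ‖v x‖ₑ ^ (q + 1) ≤ N
  upper : ∀ R, b R ≤ ∫⁻ x in Metric.ball (0 : R3) R, ‖v x‖ₑ ^ (p + 1)

theorem norm_hyperReflect_gt {e : R3} (he : ‖e‖ = 1) {s : ℝ} (hs : 0 < s) {x : R3}
    (hx : inner ℝ e x < s) : ‖x‖ < ‖hyperReflect e s x‖ := by
  refine lt_of_pow_lt_pow_left₀ 2 (norm_nonneg _) ?_
  rw [norm_hyperReflect_sq he]
  have : 0 < s - inner ℝ e x := sub_pos.2 hx
  have := mul_pos hs this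
  linarith

theorem enorm_of_nonneg {t : ℝ} (ht : 0 ≤ t) : ‖t‖ₑ = ENNReal.ofReal t :=
  Real.enorm_eq_ofReal ht

theorem polarize_nonneg {e : R3} {s : ℝ} {v : R3 → ℝ} (hv : ∀ x, 0 ≤ v x) (x : R3) :
    0 ≤ polarize e s v x := by
  unfold polarize
  split_ifs
  · exact (hv x).trans (le_max_left _ _)
  · exact le_min (hv _) (hv _)

theorem SymmClass.polarize {q p M A : ℝ} {N : ℝ≥0∞} {b : ℝ → ℝ≥0∞} {v : R3 → ℝ} (hp : 0 ≤ p + 1)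
    (h : SymmClass q p M A N b v) {e : R3} (he : ‖e‖ = 1) {s : ℝ} (hs : 0 < s) :
    SymmClass q p M A N b (polarize e s v) where
  meas := stronglyMeasurable_polarize he h.meas
  nonneg := polarize_nonneg h.nonneg
  mass := by
    rw [lintegral_polarize he h.meas (φ := fun t => ‖t‖ₑ ^ 2) (by fun_prop)]
    exact h.mass
  energy ε hε := (nonlocalEnergy_polarize_le he h.meas ε).trans (h.energy ε hε)
  lower := by
    rw [lintegral_polarize he h.meas (φ := fun t => ‖t‖ₑ ^ (q + 1)) (by fun_prop)]
    exact h.lower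
  upper R := by
    refine (h.upper R).trans ?_
    have e1 : ∀ f : R3 → ℝ, (∀ x, 0 ≤ f x) →
        ∫⁻ x in Metric.ball (0 : R3) R, ‖f x‖ₑ ^ (p + 1)
          = ∫⁻ x, (Metric.ball (0 : R3) R).indicator 1 x * ENNReal.ofReal (f x) ^ (p + 1) := by
      intro f hf
      rw [← lintegral_indicator Metric.isOpen_ball.measurableSet]
      refine lintegral_congr fun x => ?_
      by_cases hx : x ∈ Metric.ball (0 : R3) R
      · rw [Set.indicator_of_mem hx, Set.indicator_of_mem hx, enorm_of_nonneg (hf x)]; simp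
      · rw [Set.indicator_of_notMem hx, Set.indicator_of_notMem hx]; simp
    rw [e1 v h.nonneg, e1 _ (polarize_nonneg h.nonneg)]
    refine setLIntegral_le_polarize he h.meas (φ := fun t => ENNReal.ofReal t ^ (p + 1))
      (fun a c hac => ?_) (measurable_one.indicator Metric.isOpen_ball.measurableSet)
      fun x hx => ?_
    · exact ENNReal.rpow_le_rpow (ENNReal.ofReal_le_ofReal hac) hp
    · by_cases hxR : hyperReflect e s x ∈ Metric.ball (0 : R3) R
      · have : x ∈ Metric.ball (0 : R3) R := by
          rw [mem_ball_zero_iff] at hxR ⊢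
          exact (norm_hyperReflect_gt he hs hx).trans hxR
        rw [Set.indicator_of_mem hxR, Set.indicator_of_mem this]; rfl
      · rw [Set.indicator_of_notMem hxR]; exact zero_le

theorem lintegral_rpow_le_of_tendsto {α E : Type*} [MeasurableSpace α] {μ : Measure α}
    [NormedAddCommGroup E] {v : ℕ → α → E} {u : α → E}
    (hv : ∀ n, StronglyMeasurable (v n)) {σ : ℝ}
    (h : ∀ᵐ x ∂μ, Filter.Tendsto (fun n => v n x) Filter.atTop (nhds (u x))) {N : ℝ≥0∞}
    (hN : ∀ n, ∫⁻ x, ‖v n x‖ₑ ^ σ ∂μ ≤ N) : ∫⁻ x, ‖u x‖ₑ ^ σ ∂μ ≤ N := by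
  have h1 : ∀ᵐ x ∂μ, ‖u x‖ₑ ^ σ = Filter.liminf (fun n => ‖v n x‖ₑ ^ σ) Filter.atTop := by
    filter_upwards [h] with x hx
    exact (((ENNReal.continuous_rpow_const (y := σ)).tendsto _).comp hx.enorm).liminf_eq.symm
  rw [lintegral_congr_ae h1]
  refine (lintegral_liminf_le fun n => (hv n).enorm.pow_const _).trans ?_
  exact Filter.liminf_le_of_le (by isBoundedDefault) fun c hc => by
    obtain ⟨n, hn⟩ := hc.exists
    exact hn.trans (hN n)

theorem SymmClass.lintegral_six_le {q p M A S : ℝ} {N : ℝ≥0∞} {b : ℝ → ℝ≥0∞} {v : R3 → ℝ}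
    (h : SymmClass q p M A N b v) (hA0 : 0 ≤ A) (hS0 : 0 ≤ S)
    (hS : ∀ u : H1, ∫⁻ x, ‖fn u x‖ₑ ^ (6 : ℝ) ≤ ENNReal.ofReal (S * kinetic u ^ 3)) :
    ∫⁻ x, ‖v x‖ₑ ^ (6 : ℝ) ≤ ENNReal.ofReal (S * A ^ 3) := by
  obtain ⟨U, hU, hK⟩ := exists_H1_of_real h.meas hA0 h.mass h.energy
  have h1 : ∫⁻ x, ‖v x‖ₑ ^ (6 : ℝ) = ∫⁻ x, ‖fn U x‖ₑ ^ (6 : ℝ) := by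
    refine lintegral_congr_ae ?_
    filter_upwards [hU] with x hx
    rw [hx, ← ofReal_norm (v x : ℂ), Complex.norm_real, ofReal_norm]
  rw [h1]
  refine (hS U).trans (ENNReal.ofReal_le_ofReal ?_)
  have := kinetic_nonneg U
  gcongr

theorem eLpNorm_le_add_sub {μ : Measure R3} {v w : R3 → ℝ} (hv : StronglyMeasurable v)
    (hw : StronglyMeasurable w) {σ : ℝ} (hσ : 1 ≤ σ) :
    eLpNorm w (ENNReal.ofReal σ) μ
      ≤ eLpNorm v (ENNReal.ofReal σ) μ + eLpNorm (w - v) (ENNReal.ofReal σ) μ := by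
  have h := eLpNorm_add_le (μ := μ) hv.aestronglyMeasurable (hw.sub hv).aestronglyMeasurable
    (ENNReal.one_le_ofReal.2 hσ)
  rwa [add_sub_cancel] at h

/-- Convergence in the weighted `L²` space and a bound in `L⁶` give convergence on balls in the
spaces between. -/
theorem tendsto_eLpNorm_ball {σ : ℝ} (hσ2 : 2 < σ) (hσ6 : σ < 6) {v : ℕ → R3 → ℝ} {V : R3 → ℝ}
    (hv : ∀ n, StronglyMeasurable (v n)) (hV : StronglyMeasurable V) {C : ℝ≥0∞} (hC : C ≠ ⊤)
    (hv6 : ∀ n, ∫⁻ x, ‖v n x‖ₑ ^ (6 : ℝ) ≤ C) (hV6 : ∫⁻ x, ‖V x‖ₑ ^ (6 : ℝ) ≤ C)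
    (h : Filter.Tendsto (fun n => eLpNorm (v n - V) 2 weightedMeasure) Filter.atTop (nhds 0))
    (R : ℝ) : Filter.Tendsto (fun n => eLpNorm (v n - V) (ENNReal.ofReal σ)
      (volume.restrict (Metric.ball 0 R))) Filter.atTop (nhds 0) := by
  set μ := (volume : Measure R3).restrict (Metric.ball 0 R) with hμ
  have hwm : ∀ n, StronglyMeasurable (v n - V) := fun n => (hv n).sub hV
  set c : ℝ≥0∞ := C ^ (1 / 6 : ℝ) with hc
  have hcle : ∀ f : R3 → ℝ, ∫⁻ x, ‖f x‖ₑ ^ (6 : ℝ) ≤ C →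
      eLpNorm f (ENNReal.ofReal 6) μ ≤ c := by
    intro f hf
    have h1 : eLpNorm f (ENNReal.ofReal 6) μ ^ (6 : ℝ) ≤ C := by
      rw [← lintegral_enorm_rpow_eq_eLpNorm (by norm_num)]
      exact (setLIntegral_le_lintegral _ _).trans hf
    have h2 := ENNReal.rpow_le_rpow h1 (show (0 : ℝ) ≤ 1 / 6 by norm_num)
    rwa [← ENNReal.rpow_mul, show (6 : ℝ) * (1 / 6) = 1 by norm_num, ENNReal.rpow_one] at h2
  have hct : c ≠ ⊤ := ENNReal.rpow_ne_top_of_nonneg (by norm_num) hC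
  have hw6 : ∀ n, ∫⁻ x, ‖(v n - V) x‖ₑ ^ (6 : ℝ) ∂μ ≤ (c + c) ^ (6 : ℝ) := by
    intro n
    rw [lintegral_enorm_rpow_eq_eLpNorm (by norm_num)]
    gcongr
    exact (eLpNorm_sub_le (hv n).aestronglyMeasurable hV.aestronglyMeasurable
      (by norm_num)).trans (add_le_add (hcle _ (hv6 n)) (hcle _ hV6))
  have hw2 : Filter.Tendsto (fun n => ∫⁻ x, ‖(v n - V) x‖ₑ ^ (2 : ℝ) ∂μ) Filter.atTop
      (nhds 0) := by
    have h1 : Filter.Tendsto (fun n => ENNReal.ofReal ((1 + R) ^ (4 : ℝ))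
        * eLpNorm (v n - V) 2 weightedMeasure ^ 2) Filter.atTop (nhds 0) := by
      have h2 := ((ENNReal.continuous_pow 2).tendsto _).comp h
      have h3 := ENNReal.Tendsto.const_mul (a := ENNReal.ofReal ((1 + R) ^ (4 : ℝ))) h2
        (Or.inr ENNReal.ofReal_ne_top)
      simpa [Function.comp_def] using h3
    refine tendsto_of_tendsto_of_tendsto_of_le_of_le tendsto_const_nhds h1
      (fun _ => zero_le) fun n => ?_
    simp only [eLpNorm_two_sq, ENNReal.rpow_two]
    exact setLIntegral_ball_le_weighted R ((hwm n).enorm.pow_const 2)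
  have hσ : 0 < σ := by linarith
  have hlim := tendsto_lintegral_rpow_of_sq (fun n => (hwm n).aestronglyMeasurable) hσ2 hσ6
    (ENNReal.rpow_ne_top_of_nonneg (by norm_num) (ENNReal.add_ne_top.2 ⟨hct, hct⟩)) hw6 hw2
  have h3 := ((ENNReal.continuous_rpow_const (y := 1 / σ)).tendsto _).comp hlim
  rw [ENNReal.zero_rpow_of_pos (by positivity)] at h3
  refine h3.congr fun n => ?_
  rw [Function.comp_apply, lintegral_enorm_rpow_eq_eLpNorm hσ, ← ENNReal.rpow_mul,
    mul_one_div_cancel hσ.ne', ENNReal.rpow_one]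

/-- The class is sequentially compact. -/
theorem SymmClass.exists_subseq {q p M A : ℝ} {N : ℝ≥0∞} {b : ℝ → ℝ≥0∞} (hA0 : 0 ≤ A)
    (hp : 1 < p) (hp5 : p < 5) {v : ℕ → R3 → ℝ} (h : ∀ n, SymmClass q p M A N b (v n)) :
    ∃ (φ : ℕ → ℕ) (V : R3 → ℝ), StrictMono φ ∧ SymmClass q p M A N b V ∧
      Filter.Tendsto (fun n => eLpNorm (v (φ n) - V) 2 weightedMeasure) Filter.atTop (nhds 0) := by
  obtain ⟨φ, G, hφ, hGm, hGae, hGν⟩ := exists_subseq_tendsto (fun n => (h n).meas)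
    (fun n => (h n).mass) hA0 (fun n => (h n).energy)
  obtain ⟨S, hS0, hS⟩ := exists_sobolev_lintegral
  have hG0 : ∀ᵐ x, |G x| = G x := by
    filter_upwards [hGae] with x hx
    exact abs_of_nonneg (ge_of_tendsto' hx fun n => (h _).nonneg x)
  set V : R3 → ℝ := fun x => |G x| with hV
  have hVG : V =ᵐ[volume] G := hG0
  have hVae : ∀ᵐ x, Filter.Tendsto (fun n => v (φ n) x) Filter.atTop (nhds (V x)) := by
    filter_upwards [hGae, hVG] with x hx hx2
    rwa [hx2]
  have hVm : StronglyMeasurable V := hGm.norm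
  have hVν : Filter.Tendsto (fun n => eLpNorm (v (φ n) - V) 2 weightedMeasure) Filter.atTop
      (nhds 0) := by
    refine hGν.congr fun n => eLpNorm_congr_ae ?_
    filter_upwards [weightedMeasure_le.absolutelyContinuous.ae_le hVG] with x hx
    simp only [Pi.sub_apply, hx]
  refine ⟨φ, V, hφ, ⟨hVm, fun x => abs_nonneg _, ?_, fun ε hε => ?_, ?_, fun R => ?_⟩, hVν⟩
  · have := lintegral_rpow_le_of_tendsto (σ := 2) (fun n => (h (φ n)).meas) hVae
      (fun n => by simpa using (h (φ n)).mass)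
    simpa using this
  · refine (nonlocalEnergy_le_liminf (fun n => (h (φ n)).meas) hVae ε).trans ?_
    exact Filter.liminf_le_of_le (by isBoundedDefault) fun c hc => by
      obtain ⟨n, hn⟩ := hc.exists
      exact hn.trans ((h (φ n)).energy ε hε)
  · exact lintegral_rpow_le_of_tendsto (fun n => (h (φ n)).meas) hVae fun n => (h (φ n)).lower
  · set μ := (volume : Measure R3).restrict (Metric.ball 0 R) with hμ
    have hv6 : ∀ n, ∫⁻ x, ‖v (φ n) x‖ₑ ^ (6 : ℝ) ≤ ENNReal.ofReal (S * A ^ 3) := fun n =>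
      (h _).lintegral_six_le hA0 hS0.le hS
    have hσ : 0 < p + 1 := by linarith
    have hlim := tendsto_eLpNorm_ball (show 2 < p + 1 by linarith) (show p + 1 < 6 by linarith)
      (fun n => (h (φ n)).meas) hVm ENNReal.ofReal_ne_top hv6
      (lintegral_rpow_le_of_tendsto (fun n => (h (φ n)).meas) hVae hv6) hVν R
    have hlim2 : Filter.Tendsto (fun n => eLpNorm V (ENNReal.ofReal (p + 1)) μ
        + eLpNorm (v (φ n) - V) (ENNReal.ofReal (p + 1)) μ) Filter.atTop
        (nhds (eLpNorm V (ENNReal.ofReal (p + 1)) μ + 0)) := hlim.const_add _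
    rw [add_zero] at hlim2
    have hb : ∀ n, b R ^ (1 / (p + 1)) ≤ eLpNorm V (ENNReal.ofReal (p + 1)) μ
        + eLpNorm (v (φ n) - V) (ENNReal.ofReal (p + 1)) μ := by
      intro n
      have h1 := (h (φ n)).upper R
      rw [lintegral_enorm_rpow_eq_eLpNorm hσ] at h1
      have h2 := ENNReal.rpow_le_rpow h1 (show 0 ≤ 1 / (p + 1) by positivity)
      rw [← ENNReal.rpow_mul, mul_one_div_cancel hσ.ne', ENNReal.rpow_one] at h2
      exact h2.trans (eLpNorm_le_add_sub hVm (h _).meas (by linarith))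
    have h4 := ENNReal.rpow_le_rpow (ge_of_tendsto' hlim2 hb) hσ.le
    rwa [← ENNReal.rpow_mul, one_div_mul_cancel hσ.ne', ENNReal.rpow_one,
      ← lintegral_enorm_rpow_eq_eLpNorm hσ] at h4

theorem lintegral_weighted_eq {v : R3 → ℝ} (hv : StronglyMeasurable v) (hv0 : ∀ x, 0 ≤ v x) :
    ∫⁻ x, ENNReal.ofReal (radialWeight x) * ENNReal.ofReal (v x) = ∫⁻ x, ‖v x‖ₑ ∂weightedMeasure := by
  rw [weightedMeasure, lintegral_withDensity_eq_lintegral_mul _ measurable_ofReal_radialWeight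
    hv.enorm]
  refine lintegral_congr fun x => ?_
  rw [Pi.mul_apply, enorm_of_nonneg (hv0 x)]

/-- A member of the class with the largest weighted integral cannot be improved by polarization,
hence it is already polarized with respect to every half-space containing the origin. -/
theorem SymmClass.exists_polarized {q p M A : ℝ} {N : ℝ≥0∞} {b : ℝ → ℝ≥0∞} (hA0 : 0 ≤ A)
    (hp : 1 < p) (hp5 : p < 5) {f : R3 → ℝ} (hf : SymmClass q p M A N b f) :
    ∃ V : R3 → ℝ, SymmClass q p M A N b V ∧ ∀ (e : R3) (s : ℝ), ‖e‖ = 1 → 0 < s →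
      ∀ᵐ x : R3, inner ℝ e x < s → V (hyperReflect e s x) ≤ V x := by
  set F : (R3 → ℝ) → ℝ≥0∞ := fun v => ∫⁻ x, ‖v x‖ₑ ∂weightedMeasure with hF
  set T : Set ℝ≥0∞ := F '' {v | SymmClass q p M A N b v} with hT
  have hT0 : T.Nonempty := ⟨F f, f, hf, rfl⟩
  obtain ⟨t, -, htS, htT⟩ := exists_seq_tendsto_sSup hT0 (OrderTop.bddAbove _)
  choose v hv hvt using htT
  obtain ⟨φ, V, hφ, hV, hVν⟩ := SymmClass.exists_subseq hA0 hp hp5 hv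
  have hmax : ∀ g, SymmClass q p M A N b g → F g ≤ F V := by
    intro g hg
    refine (le_sSup (show F g ∈ T from ⟨g, hg, rfl⟩)).trans ?_
    have h1 : Filter.Tendsto (fun n => F (v (φ n))) Filter.atTop (nhds (sSup T)) := by
      simp only [hvt]
      exact htS.comp hφ.tendsto_atTop
    have h2 : Filter.Tendsto (fun n => F V + eLpNorm (v (φ n) - V) 2 weightedMeasure
        * weightedMeasure Set.univ ^ (1 / (1 : ℝ≥0∞).toReal - 1 / (2 : ℝ≥0∞).toReal))
        Filter.atTop (nhds (F V + 0 * weightedMeasure Set.univ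
          ^ (1 / (1 : ℝ≥0∞).toReal - 1 / (2 : ℝ≥0∞).toReal))) := by
      refine Filter.Tendsto.const_add _ (ENNReal.Tendsto.mul_const hVν (Or.inr ?_))
      exact ENNReal.rpow_ne_top_of_nonneg (by norm_num) (measure_ne_top _ _)
    rw [zero_mul, add_zero] at h2
    refine le_of_tendsto_of_tendsto' h1 h2 fun n => ?_
    have h3 : F (v (φ n)) ≤ F V + ∫⁻ x, ‖(v (φ n) - V) x‖ₑ ∂weightedMeasure := by
      simp only [hF]
      rw [← lintegral_add_left hV.meas.enorm]
      refine lintegral_mono fun x => ?_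
      have : v (φ n) x = V x + (v (φ n) - V) x := by simp
      rw [this]
      exact enorm_add_le _ _
    refine h3.trans (add_le_add_right ?_ _)
    rw [← eLpNorm_one_eq_lintegral_enorm]
    exact eLpNorm_le_eLpNorm_mul_rpow_measure_univ (by norm_num)
      ((hv _).meas.sub hV.meas).aestronglyMeasurable
  refine ⟨V, hV, fun e s he hs => ?_⟩
  have hP := hV.polarize (by linarith) he hs
  refine le_of_lintegral_polarize_le he hV.meas hV.nonneg continuous_radialWeight.measurable
    radialWeight_pos (fun x hx => radialWeight_lt (norm_hyperReflect_gt he hs hx)) ?_ ?_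
  · rw [lintegral_weighted_eq hV.meas hV.nonneg]
    have h1 := lintegral_sq_le (μ := weightedMeasure) (g := fun x => ‖V x‖ₑ)
      hV.meas.enorm.aemeasurable
    have h2 : ∫⁻ x, ‖V x‖ₑ ^ 2 ∂weightedMeasure ≤ ENNReal.ofReal M :=
      (lintegral_mono' weightedMeasure_le le_rfl).trans hV.mass
    intro h3
    rw [h3, ENNReal.top_pow two_ne_zero, top_le_iff] at h1
    exact ENNReal.mul_ne_top (measure_ne_top _ _) (ne_top_of_le_ne_top ENNReal.ofReal_ne_top h2) h1
  · rw [lintegral_weighted_eq hV.meas hV.nonneg, lintegral_weighted_eq hP.meas hP.nonneg]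
    exact hmax _ hP

/-! ### Radially decreasing functions -/

/-- `v` agrees, outside a null set, with a nonincreasing function of `‖x‖`. -/
def RadiallyDecreasing (v : R3 → ℝ) : Prop :=
  ∃ L : Set R3, (∀ᵐ x, x ∈ L) ∧ ∀ x ∈ L, ∀ y ∈ L, ‖x‖ ≤ ‖y‖ → v y ≤ v x

/-- A function that is polarized with respect to all half-spaces containing the origin is radially
decreasing: compare its means over small balls at `x` and near `y` by reflection in the
perpendicular bisector. -/
theorem radiallyDecreasing_of_polarized {v : R3 → ℝ} (hv : LocallyIntegrable v volume)
    (h : ∀ (e : R3) (s : ℝ), ‖e‖ = 1 → 0 < s →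
      ∀ᵐ x : R3, inner ℝ e x < s → v (hyperReflect e s x) ≤ v x) : RadiallyDecreasing v := by
  have hmean : ∀ (x y : R3) (δ : ℝ), 0 < δ → ‖x‖ < ‖y‖ → δ < ‖y - x‖ / 2 →
      ⨍ z in Metric.closedBall y δ, v z ≤ ⨍ z in Metric.closedBall x δ, v z := by
    intro x y δ hδ hxy hδ2
    have hd : 0 < ‖y - x‖ := by
      rw [norm_pos_iff, sub_ne_zero]
      rintro rfl
      exact lt_irrefl _ hxy
    set e : R3 := ‖y - x‖⁻¹ • (y - x) with he
    have he1 : ‖e‖ = 1 := by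
      rw [he, norm_smul, norm_inv, norm_norm, inv_mul_cancel₀ hd.ne']
    set s : ℝ := (‖y‖ ^ 2 - ‖x‖ ^ 2) / (2 * ‖y - x‖) with hs
    have hs0 : 0 < s := by
      refine div_pos (sub_pos.2 ?_) (by positivity)
      exact pow_lt_pow_left₀ hxy (norm_nonneg _) two_ne_zero
    have hsx : s - inner ℝ e x = ‖y - x‖ / 2 := by
      have e1 : ‖y - x‖ ^ 2 = ‖y‖ ^ 2 - 2 * inner ℝ y x + ‖x‖ ^ 2 := norm_sub_sq_real y x
      have e2 : inner ℝ e x = ‖y - x‖⁻¹ * (inner ℝ y x - ‖x‖ ^ 2) := by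
        rw [he, inner_smul_left, inner_sub_left, real_inner_self_eq_norm_sq]; rfl
      rw [e2, hs]
      field_simp
      linarith
    have hσx : hyperReflect e s x = y := by
      rw [hyperReflect, hsx, he, smul_smul, mul_div_cancel₀ _ two_ne_zero, mul_inv_cancel₀ hd.ne',
        one_smul, add_sub_cancel]
    have hpre : hyperReflect e s ⁻¹' Metric.closedBall y δ = Metric.closedBall x δ := by
      ext z
      rw [Set.mem_preimage, Metric.mem_closedBall, Metric.mem_closedBall, ← hσx,
        dist_hyperReflect he1]
    have hin : ∀ z ∈ Metric.closedBall x δ, inner ℝ e z < s := by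
      intro z hz
      have e1 : inner ℝ e (z - x) ≤ ‖z - x‖ := by
        have := real_inner_le_norm e (z - x)
        rwa [he1, one_mul] at this
      rw [inner_sub_right] at e1
      have e2 : ‖z - x‖ ≤ δ := by rwa [Metric.mem_closedBall, dist_eq_norm] at hz
      linarith
    have hσ := measurePreserving_hyperReflect he1 s
    have hinj : MeasurableEmbedding (hyperReflect e s) := by
      refine Measurable.measurableEmbedding hσ.measurable fun a c hac => ?_
      rw [← hyperReflect_hyperReflect he1 s a, hac, hyperReflect_hyperReflect he1]
    have hint : ∫ z in Metric.closedBall y δ, v z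
        = ∫ z in Metric.closedBall x δ, v (hyperReflect e s z) := by
      rw [← hpre, hσ.setIntegral_preimage_emb hinj]
    have hvi : ∀ w, IntegrableOn v (Metric.closedBall w δ) := fun w =>
      hv.integrableOn_isCompact (isCompact_closedBall w δ)
    have hvσ : IntegrableOn (fun z => v (hyperReflect e s z)) (Metric.closedBall x δ) := by
      rw [← hpre]
      exact (hσ.integrableOn_comp_preimage hinj).2 (hvi y)
    rw [setAverage_eq, setAverage_eq, hint]
    simp only [Measure.real, Measure.addHaar_closedBall_center _ x, 
      Measure.addHaar_closedBall_center _ y]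
    refine smul_le_smul_of_nonneg_left ?_ (by positivity)
    refine setIntegral_mono_on_ae hvσ (hvi x) measurableSet_closedBall ?_
    filter_upwards [h e s he1 hs0] with z hz hzx
    exact hz (hin z hzx)
  refine ⟨_, IsUnifLocDoublingMeasure.ae_tendsto_average (volume : Measure R3) hv 1,
    fun x hx y hy hxy => ?_⟩
  by_cases hne : x = y
  · rw [hne]
  have hy0 : 0 < ‖y‖ := by
    rcases (norm_nonneg y).eq_or_lt with h0 | h0
    · rw [← h0] at hxy
      exact absurd ((norm_le_zero_iff.1 hxy).trans (norm_eq_zero.1 h0.symm).symm) hne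
    · exact h0
  set δ : ℕ → ℝ := fun n => 1 / ((n : ℝ) + 1) with hδ
  have hδ0 : ∀ n, 0 < δ n := fun n => by positivity
  have hδt : Filter.Tendsto δ Filter.atTop (nhds 0) := tendsto_one_div_add_atTop_nhds_zero_nat
  have hδt' : Filter.Tendsto δ Filter.atTop (nhdsWithin 0 (Set.Ioi 0)) :=
    tendsto_nhdsWithin_iff.2 ⟨hδt, Filter.Eventually.of_forall hδ0⟩
  set w : ℕ → R3 := fun n => y + (δ n * ‖y‖⁻¹) • y with hw
  have hwd : ∀ n, ‖w n - y‖ = δ n := fun n => by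
    simp only [hw, add_sub_cancel_left]
    rw [norm_smul, norm_mul, norm_inv, norm_norm, mul_assoc, inv_mul_cancel₀ hy0.ne', mul_one,
      Real.norm_of_nonneg (hδ0 n).le]
  have hwn : ∀ n, ‖w n‖ = ‖y‖ + δ n := fun n => by
    have : w n = (1 + δ n * ‖y‖⁻¹) • y := by rw [add_smul, one_smul]
    rw [this, norm_smul, Real.norm_of_nonneg (by have := hδ0 n; positivity)]
    field_simp
  have hA := hx (fun _ => x) δ hδt' (Filter.Eventually.of_forall fun n => by
    simp [(hδ0 n).le])
  have hB := hy w δ hδt' (Filter.Eventually.of_forall fun n => by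
    rw [Metric.mem_closedBall, dist_comm, dist_eq_norm, hwd, one_mul])
  refine le_of_tendsto_of_tendsto hB hA ?_
  have hxy0 : 0 < ‖y - x‖ / 3 := by
    have : 0 < ‖y - x‖ := norm_pos_iff.2 (sub_ne_zero.2 (Ne.symm hne))
    positivity
  filter_upwards [hδt.eventually (gt_mem_nhds hxy0)] with n hn
  refine hmean x (w n) (δ n) (hδ0 n) (by rw [hwn]; linarith [hδ0 n]) ?_
  have h1 : ‖y - x‖ ≤ ‖w n - x‖ + δ n := by
    have e1 : y - x = (w n - x) - (w n - y) := by abel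
    rw [e1, ← hwd n]
    exact norm_sub_le _ _
  linarith

/-! ### Powers of functions in `H¹` -/

theorem lintegral_fn_sq (u : H1) : ∫⁻ x, ‖fn u x‖ₑ ^ 2 = ENNReal.ofReal (‖fn u‖ ^ 2) := by
  rw [ENNReal.ofReal_pow (norm_nonneg _), ofReal_norm, Lp.enorm_def, eLpNorm_two_sq]

theorem lintegral_fn_rpow_ne_top (u : H1) {s : ℝ} (h1 : 1 ≤ s) (h5 : s ≤ 5) :
    ∫⁻ x, ‖fn u x‖ₑ ^ (s + 1) ≠ ⊤ := by
  obtain ⟨S, hS0, hS⟩ := exists_sobolev_lintegral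
  refine ne_top_of_le_ne_top ?_ (lintegral_rpow_le_interpolate (Lp.aestronglyMeasurable (fn u))
    one_pos two_pos (show (2 : ℝ) ≤ s + 1 by linarith) (show s + 1 ≤ 6 by linarith))
  refine ENNReal.add_ne_top.2 ⟨ENNReal.mul_ne_top ENNReal.ofReal_ne_top ?_,
    ENNReal.mul_ne_top ENNReal.ofReal_ne_top (ne_top_of_le_ne_top ENNReal.ofReal_ne_top (hS u))⟩
  simp only [ENNReal.rpow_two]
  rw [lintegral_fn_sq]
  exact ENNReal.ofReal_ne_top

theorem integrable_fn_rpow (u : H1) {s : ℝ} (h1 : 1 ≤ s) (h5 : s ≤ 5) :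
    Integrable (fun x => ‖fn u x‖ ^ (s + 1)) volume := by
  refine ⟨((Lp.aestronglyMeasurable (fn u)).norm.aemeasurable.pow_const _).aestronglyMeasurable,
    ?_⟩
  rw [hasFiniteIntegral_iff_ofReal (Filter.Eventually.of_forall fun x => by positivity)]
  simp only [← enorm_rpow_eq_ofReal (fn u _) (show 0 ≤ s + 1 by linarith)]
  exact (lintegral_fn_rpow_ne_top u h1 h5).lt_top

theorem potential_nonneg (s : ℝ) (u : H1) : 0 ≤ potential s u :=
  integral_nonneg fun x => by positivity

theorem ofReal_potential (u : H1) {s : ℝ} (h1 : 1 ≤ s) (h5 : s ≤ 5) :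
    ENNReal.ofReal (potential s u) = ∫⁻ x, ‖fn u x‖ₑ ^ (s + 1) := by
  rw [potential, ofReal_integral_eq_lintegral_ofReal (integrable_fn_rpow u h1 h5)
    (Filter.Eventually.of_forall fun x => by positivity)]
  simp only [← enorm_rpow_eq_ofReal (fn u _) (show 0 ≤ s + 1 by linarith)]

theorem potential_eq_toReal (u : H1) {s : ℝ} (h1 : 1 ≤ s) :
    potential s u = (∫⁻ x, ‖fn u x‖ₑ ^ (s + 1)).toReal := by
  rw [potential, integral_eq_lintegral_of_nonneg_ae
    (Filter.Eventually.of_forall fun x => by positivity)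
    ((Lp.aestronglyMeasurable (fn u)).norm.aemeasurable.pow_const _).aestronglyMeasurable]
  simp only [← enorm_rpow_eq_ofReal (fn u _) (show 0 ≤ s + 1 by linarith)]

theorem potential_le_of_lintegral_le {u v : H1} {s : ℝ} (h1 : 1 ≤ s) (h5 : s ≤ 5)
    (h : ∫⁻ x, ‖fn u x‖ₑ ^ (s + 1) ≤ ∫⁻ x, ‖fn v x‖ₑ ^ (s + 1)) :
    potential s u ≤ potential s v := by
  rw [potential_eq_toReal u h1, potential_eq_toReal v h1]
  exact ENNReal.toReal_mono (lintegral_fn_rpow_ne_top v h1 h5) h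

theorem potential_pos {u : H1} (hu : fn u ≠ 0) {s : ℝ} (h1 : 1 ≤ s) (h5 : s ≤ 5) :
    0 < potential s u := by
  refine lt_of_le_of_ne (potential_nonneg s u) fun h0 => hu ?_
  have h2 : ∫⁻ x, ‖fn u x‖ₑ ^ (s + 1) = 0 := by
    rw [← ofReal_potential u h1 h5, ← h0, ENNReal.ofReal_zero]
  rw [lintegral_eq_zero_iff' ((Lp.aestronglyMeasurable (fn u)).enorm.pow_const _)] at h2
  rw [Lp.eq_zero_iff_ae_eq_zero]
  filter_upwards [h2] with x hx
  have : s + 1 ≠ 0 := by linarith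
  have h3 : ‖fn u x‖ₑ = 0 := by
    rcases ENNReal.rpow_eq_zero_iff.1 hx with h | h
    · exact h.1
    · exact absurd h.2 (by linarith)
  simpa using h3

theorem fn_ne_zero_of_potential_pos {u : H1} {s : ℝ} (h1 : 1 ≤ s) (h : 0 < potential s u) :
    fn u ≠ 0 := by
  intro h0
  rw [potential_eq_toReal _ h1, h0] at h
  have h2 : ∫⁻ x, ‖(0 : L2) x‖ₑ ^ (s + 1) = ∫⁻ _ : R3, 0 := by
    refine lintegral_congr_ae ?_
    filter_upwards [Lp.coeFn_zero ℂ 2 (volume : Measure R3)] with x hx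
    rw [hx, Pi.zero_apply, enorm_zero, ENNReal.zero_rpow_of_pos (by linarith)]
  rw [h2, lintegral_zero, ENNReal.toReal_zero] at h
  exact lt_irrefl _ h

/-- `H¹` functions without gradient vanish. -/
theorem kinetic_pos {u : H1} (hu : fn u ≠ 0) : 0 < kinetic u := by
  refine lt_of_le_of_ne (kinetic_nonneg u) fun h0 => ?_
  obtain ⟨S, hS0, hS⟩ := exists_sobolev_lintegral
  have h1 := potential_pos hu (s := 5) (by norm_num) le_rfl
  have h2 := hS u
  rw [← h0, show (6 : ℝ) = 5 + 1 by norm_num, ← ofReal_potential u (by norm_num) le_rfl] at h2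
  have h3 := (ENNReal.ofReal_le_ofReal_iff (by norm_num)).1 h2
  norm_num at h3
  linarith

/-! ### Symmetrization -/

/-- The element `u` of `H¹` is represented by the nonnegative, radially decreasing function `v`. -/
structure HasProfile (u : H1) (v : R3 → ℝ) : Prop where
  meas : StronglyMeasurable v
  nonneg : ∀ x, 0 ≤ v x
  radial : RadiallyDecreasing v
  eq : ∀ᵐ x, fn u x = (v x : ℂ)

theorem HasProfile.enorm_eq {u : H1} {v : R3 → ℝ} (h : HasProfile u v) :
    ∀ᵐ x, ‖fn u x‖ₑ = ‖v x‖ₑ := by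
  filter_upwards [h.eq] with x hx
  rw [hx, ← ofReal_norm (v x : ℂ), Complex.norm_real, ofReal_norm]

theorem HasProfile.lintegral_rpow {u : H1} {v : R3 → ℝ} (h : HasProfile u v) (s : ℝ) :
    ∫⁻ x, ‖fn u x‖ₑ ^ s = ∫⁻ x, ‖v x‖ₑ ^ s := by
  refine lintegral_congr_ae ?_
  filter_upwards [h.enorm_eq] with x hx
  rw [hx]

/-- A radially decreasing substitute for the symmetric decreasing rearrangement: mass, kinetic
energy and the lower power do not increase, and the higher power does not decrease. -/
theorem exists_symmetrization {p q : ℝ} (hq : 1 < q) (hqp : q < p) (hp : p < 5) (u : H1) :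
    ∃ (U : H1) (v : R3 → ℝ), HasProfile U v ∧ kinetic U ≤ kinetic u ∧ ‖fn U‖ ≤ ‖fn u‖ ∧
      potential q U ≤ potential q u ∧ potential p u ≤ potential p U := by
  set f : R3 → ℝ := fun x => ‖fn u x‖ with hf
  have hfm : StronglyMeasurable f := (Lp.stronglyMeasurable (fn u)).norm
  have hfe : ∀ x, ‖f x‖ₑ = ‖fn u x‖ₑ := fun x => by simp [hf]
  have hC : SymmClass q p (‖fn u‖ ^ 2) (kinetic u) (∫⁻ x, ‖fn u x‖ₑ ^ (q + 1))
      (fun R => ∫⁻ x in Metric.ball (0 : R3) R, ‖fn u x‖ₑ ^ (p + 1)) f := by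
    refine ⟨hfm, fun x => norm_nonneg _, ?_, fun ε hε => ?_, ?_, fun R => ?_⟩
    · simp only [hfe]; exact (lintegral_fn_sq u).le
    · refine (nonlocalEnergy_norm_le ε _).trans ?_
      rw [← lintegral_grad_eq]
      exact nonlocalEnergy_fn_le u ε
    · simp only [hfe]; exact le_rfl
    · simp only [hfe]; exact le_rfl
  obtain ⟨V, hV, hpol⟩ := hC.exists_polarized (kinetic_nonneg u) (by linarith) hp
  obtain ⟨U, hU, hK⟩ := exists_H1_of_real hV.meas (kinetic_nonneg u) hV.mass hV.energy
  have hVl : LocallyIntegrable V volume :=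
    (memLp_two_of_lintegral_le hV.meas hV.mass).locallyIntegrable (by norm_num)
  have hUV : HasProfile U V :=
    ⟨hV.meas, hV.nonneg, radiallyDecreasing_of_polarized hVl hpol, hU⟩
  refine ⟨U, V, hUV, hK, ?_, ?_, ?_⟩
  · refine le_of_sq_le_sq ?_ (norm_nonneg _)
    rw [← ENNReal.ofReal_le_ofReal_iff (by positivity), ← lintegral_fn_sq]
    have h := hUV.lintegral_rpow 2
    simp only [ENNReal.rpow_two] at h
    rw [h]
    exact hV.mass
  · refine potential_le_of_lintegral_le hq.le (by linarith) ?_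
    rw [hUV.lintegral_rpow]
    exact hV.lower
  · refine potential_le_of_lintegral_le (by linarith) (by linarith) ?_
    rw [hUV.lintegral_rpow]
    have hu : ∫⁻ x, ‖fn u x‖ₑ ^ (p + 1)
        = ⨆ n : ℕ, ∫⁻ x in Metric.ball (0 : R3) n, ‖fn u x‖ₑ ^ (p + 1) := by
      rw [← setLIntegral_univ, ← Metric.iUnion_ball_nat (0 : R3)]
      refine setLIntegral_iUnion_of_directed _ ?_
      exact (monotone_nat_of_le_succ fun n => Metric.ball_subset_ball (by push_cast; linarith)).directed_le
    rw [hu]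
    exact iSup_le fun n => (hV.upper n).trans (setLIntegral_le_lintegral _ _)

/-! ### The space `H¹`: construction of elements and continuity of the functionals -/

theorem fn_add (u v : H1) : fn (u + v) = fn u + fn v := rfl
theorem fn_sub (u v : H1) : fn (u - v) = fn u - fn v := rfl
theorem fn_smul (c : ℂ) (u : H1) : fn (c • u) = c • fn u := rfl
theorem grad_sub (u v : H1) : grad (u - v) = grad u - grad v := rfl
theorem grad_smul (c : ℂ) (u : H1) : grad (c • u) = c • grad u := rfl

theorem continuous_fn : Continuous fn :=
  (continuous_fst.comp (WithLp.prod_continuous_ofLp 2 L2 L2Vec)).comp continuous_subtype_val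

theorem continuous_grad : Continuous grad :=
  (continuous_snd.comp (WithLp.prod_continuous_ofLp 2 L2 L2Vec)).comp continuous_subtype_val

theorem continuous_toH1 {X : Type*} [TopologicalSpace X] {f : X → H1}
    (h1 : Continuous fun x => fn (f x)) (h2 : Continuous fun x => grad (f x)) : Continuous f :=
  Continuous.subtype_mk (f := fun x => (f x : WithLp 2 (L2 × L2Vec)))
    ((WithLp.prod_continuous_toLp 2 L2 L2Vec).comp (h1.prodMk h2)) fun x => (f x).2

/-- A square integrable function with a square integrable distributional gradient, as an element of
`H¹`. -/
theorem exists_H1_of_fun {f : R3 → ℂ} {g : R3 → EuclideanSpace ℂ (Fin 3)}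
    (hf : MemLp f 2 volume) (hg : MemLp g 2 volume)
    (h : ∀ φ : R3 → ℝ, IsTest φ → ∀ i : Fin 3,
      ∫ x, f x * (partialDeriv i φ x : ℂ) = -∫ x, g x i * (φ x : ℂ)) :
    ∃ w : H1, fn w = hf.toLp ∧ grad w = hg.toLp := by
  refine ⟨⟨WithLp.toLp 2 (hf.toLp, hg.toLp), fun φ hφ i => ?_⟩, rfl, rfl⟩
  have e1 : ∫ x, (hf.toLp : R3 → ℂ) x * (partialDeriv i φ x : ℂ)
      = ∫ x, f x * (partialDeriv i φ x : ℂ) := integral_congr_ae <| by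
    filter_upwards [hf.coeFn_toLp] with x hx
    rw [hx]
  have e2 : ∫ x, (hg.toLp : R3 → EuclideanSpace ℂ (Fin 3)) x i * (φ x : ℂ)
      = ∫ x, g x i * (φ x : ℂ) := integral_congr_ae <| by
    filter_upwards [hg.coeFn_toLp] with x hx
    rw [hx]
  exact e1.trans ((h φ hφ i).trans (congrArg Neg.neg e2.symm))

theorem continuous_partialDeriv {φ : R3 → ℝ} (hφ : IsTest φ) (i : Fin 3) :
    Continuous (partialDeriv i φ) :=
  (hφ.contDiff.continuous_fderiv (by simp)).clm_apply continuous_const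

theorem hasCompactSupport_partialDeriv {φ : R3 → ℝ} (hφ : IsTest φ) (i : Fin 3) :
    HasCompactSupport (partialDeriv i φ) :=
  (hφ.hasCompactSupport.fderiv ℝ).comp_left
    (g := fun L : R3 →L[ℝ] ℝ => L (EuclideanSpace.single i 1)) (by simp)

theorem IsTest.partialDeriv {φ : R3 → ℝ} (hφ : IsTest φ) (i : Fin 3) :
    IsTest (partialDeriv i φ) where
  contDiff := (hφ.contDiff.fderiv_right (m := ∞) (by simp)).clm_apply contDiff_const
  hasCompactSupport := hasCompactSupport_partialDeriv hφ i

theorem integral_mul_partialDeriv {φ ψ : R3 → ℝ} (hφ : IsTest φ) (hψ : IsTest ψ) (i : Fin 3) :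
    ∫ x, φ x * partialDeriv i ψ x = -∫ x, partialDeriv i φ x * ψ x := by
  refine integral_mul_fderiv_eq_neg_fderiv_mul_of_integrable ?_ ?_ ?_
    (fun x _ => hφ.contDiff.differentiable (by simp) x)
    (fun x _ => hψ.contDiff.differentiable (by simp) x)
  · exact ((continuous_partialDeriv hφ i).mul hψ.contDiff.continuous).integrable_of_hasCompactSupport
      hψ.hasCompactSupport.mul_left
  · exact (hφ.contDiff.continuous.mul (continuous_partialDeriv hψ i)).integrable_of_hasCompactSupport
      hφ.hasCompactSupport.mul_right
  · exact (hφ.contDiff.continuous.mul hψ.contDiff.continuous).integrable_of_hasCompactSupport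
      hφ.hasCompactSupport.mul_right

theorem exists_H1_of_isTest {φ : R3 → ℝ} (hφ : IsTest φ) : ∃ w : H1,
    (∀ᵐ x, fn w x = (φ x : ℂ)) ∧ ∀ᵐ x, ∀ i, grad w x i = (partialDeriv i φ x : ℂ) := by
  have hc : Continuous fun x =>
      (WithLp.toLp 2 fun i => (partialDeriv i φ x : ℂ) : EuclideanSpace ℂ (Fin 3)) :=
    (PiLp.continuous_toLp 2 _).comp (continuous_pi fun i =>
      Complex.continuous_ofReal.comp (continuous_partialDeriv hφ i))
  have hs : HasCompactSupport fun x =>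
      (WithLp.toLp 2 fun i => (partialDeriv i φ x : ℂ) : EuclideanSpace ℂ (Fin 3)) := by
    refine HasCompactSupport.mono (f := fderiv ℝ φ) (hφ.hasCompactSupport.fderiv ℝ)
      fun x hx hx0 => hx ?_
    ext i
    simp [CombinedNLS.partialDeriv, hx0]
  obtain ⟨w, hw1, hw2⟩ := exists_H1_of_fun hφ.memLp (hc.memLp_of_hasCompactSupport hs)
    fun ψ hψ i => by
      simp only [← Complex.ofReal_mul]
      rw [integral_complex_ofReal, integral_complex_ofReal, ← Complex.ofReal_neg,
        integral_mul_partialDeriv hφ hψ i]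
  refine ⟨w, ?_, ?_⟩
  · rw [hw1]; exact hφ.memLp.coeFn_toLp
  · rw [hw2]
    filter_upwards [(hc.memLp_of_hasCompactSupport hs).coeFn_toLp] with x hx i
    rw [hx]

theorem continuous_kinetic : Continuous kinetic := by
  have : kinetic = fun u => ‖grad u‖ ^ 2 := funext kinetic_eq_norm_sq
  rw [this]
  exact continuous_grad.norm.pow 2

theorem eLpNorm_fn_eq (u : H1) {s : ℝ} (h1 : 1 ≤ s) (h5 : s ≤ 5) :
    eLpNorm (fn u) (ENNReal.ofReal (s + 1)) volume
      = ENNReal.ofReal (potential s u ^ (1 / (s + 1))) := by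
  have hσ : 0 < s + 1 := by linarith
  rw [← ENNReal.ofReal_rpow_of_nonneg (potential_nonneg s u) (by positivity),
    ofReal_potential u h1 h5, lintegral_enorm_rpow_eq_eLpNorm hσ, ← ENNReal.rpow_mul,
    mul_one_div_cancel hσ.ne', ENNReal.rpow_one]

/-- The triangle inequality in `L^(s+1)`. -/
theorem potential_rpow_add_le (u v : H1) {s : ℝ} (h1 : 1 ≤ s) (h5 : s ≤ 5) :
    potential s (u + v) ^ (1 / (s + 1))
      ≤ potential s u ^ (1 / (s + 1)) + potential s v ^ (1 / (s + 1)) := by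
  have h := eLpNorm_add_le (p := ENNReal.ofReal (s + 1)) (Lp.aestronglyMeasurable (fn u))
    (Lp.aestronglyMeasurable (fn v)) (by rw [ENNReal.one_le_ofReal]; linarith)
  rw [← eLpNorm_congr_ae (Lp.coeFn_add (fn u) (fn v)), ← fn_add, eLpNorm_fn_eq _ h1 h5,
    eLpNorm_fn_eq _ h1 h5, eLpNorm_fn_eq _ h1 h5, ← ENNReal.ofReal_add
      (Real.rpow_nonneg (potential_nonneg _ _) _) (Real.rpow_nonneg (potential_nonneg _ _) _)] at h
  exact (ENNReal.ofReal_le_ofReal_iff (add_nonneg (Real.rpow_nonneg (potential_nonneg _ _) _)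
    (Real.rpow_nonneg (potential_nonneg _ _) _))).1 h

theorem potential_neg (s : ℝ) (u : H1) : potential s (-u) = potential s u := by
  refine integral_congr_ae ?_
  filter_upwards [Lp.coeFn_neg (fn u)] with x hx
  have : fn (-u) x = - fn u x := hx
  simp [this]

theorem tendsto_potential_of_sub {ι : Type*} {l : Filter ι} {u : H1} {v : ι → H1} {s : ℝ}
    (h1 : 1 ≤ s) (h5 : s ≤ 5) (h : Filter.Tendsto (fun n => potential s (v n - u)) l (nhds 0)) :
    Filter.Tendsto (fun n => potential s (v n)) l (nhds (potential s u)) := by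
  have hσ : 0 < s + 1 := by linarith
  have h6 : Filter.Tendsto (fun n => potential s (v n - u) ^ (1 / (s + 1))) l (nhds 0) := by
    have := h.rpow_const (p := 1 / (s + 1)) (Or.inr (by positivity))
    rwa [Real.zero_rpow (by positivity)] at this
  have h7 : Filter.Tendsto (fun n => potential s (v n) ^ (1 / (s + 1))) l
      (nhds (potential s u ^ (1 / (s + 1)))) := by
    rw [tendsto_iff_norm_sub_tendsto_zero]
    refine squeeze_zero (fun _ => norm_nonneg _) (fun n => ?_) h6
    rw [Real.norm_eq_abs, abs_sub_le_iff]
    constructor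
    · have := potential_rpow_add_le (v n - u) u h1 h5
      rw [sub_add_cancel] at this
      linarith
    · have := potential_rpow_add_le (-(v n - u)) (v n) h1 h5
      rw [potential_neg, show -(v n - u) + v n = u by abel] at this
      linarith
  have h8 := h7.rpow_const (p := s + 1) (Or.inr hσ.le)
  simpa only [← Real.rpow_mul (potential_nonneg s _), one_div_mul_cancel hσ.ne', Real.rpow_one]
    using h8

/-- On sets of bounded kinetic energy, `N_s` is continuous for the convergence in `L²`. -/
theorem tendsto_potential {u : H1} {v : ℕ → H1} {s : ℝ} (h1 : 1 < s) (h5 : s < 5) {K : ℝ}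
    (hK : ∀ n, kinetic (v n) ≤ K)
    (h : Filter.Tendsto (fun n => fn (v n)) Filter.atTop (nhds (fn u))) :
    Filter.Tendsto (fun n => potential s (v n)) Filter.atTop (nhds (potential s u)) := by
  obtain ⟨S, hS0, hS⟩ := exists_sobolev_lintegral
  have hK2 : ∀ n, kinetic (v n - u) ≤ 2 * K + 2 * kinetic u := by
    intro n
    have h2 := hK n
    rw [kinetic_eq_norm_sq] at h2 ⊢
    rw [kinetic_eq_norm_sq, grad_sub]
    have := norm_sub_le (grad (v n)) (grad u)
    nlinarith [sq_nonneg (‖grad (v n)‖ - ‖grad u‖), norm_nonneg (grad (v n) - grad u)]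
  have h6 : ∀ n, ∫⁻ x, ‖fn (v n - u) x‖ₑ ^ (6 : ℝ)
      ≤ ENNReal.ofReal (S * (2 * K + 2 * kinetic u) ^ 3) := fun n => by
    refine (hS _).trans (ENNReal.ofReal_le_ofReal ?_)
    have := kinetic_nonneg (v n - u)
    gcongr
    exact hK2 n
  have h2 : Filter.Tendsto (fun n => ∫⁻ x, ‖fn (v n - u) x‖ₑ ^ (2 : ℝ)) Filter.atTop (nhds 0) := by
    simp only [ENNReal.rpow_two, lintegral_fn_sq]
    have h3 : Filter.Tendsto (fun n => ‖fn (v n) - fn u‖) Filter.atTop (nhds 0) :=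
      tendsto_iff_norm_sub_tendsto_zero.1 h
    simpa [fn_sub] using ENNReal.tendsto_ofReal (h3.pow 2)
  have h4 := tendsto_lintegral_rpow_of_sq (fun n => Lp.aestronglyMeasurable (fn (v n - u)))
    (show 2 < s + 1 by linarith) (show s + 1 < 6 by linarith) ENNReal.ofReal_ne_top h6 h2
  refine tendsto_potential_of_sub h1.le h5.le
    (((ENNReal.tendsto_toReal ENNReal.zero_ne_top).comp h4).congr fun n => ?_)
  rw [Function.comp_apply, ← potential_eq_toReal _ h1.le]

theorem continuous_potential {s : ℝ} (h1 : 1 < s) (h5 : s < 5) : Continuous (potential s) := by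
  rw [continuous_iff_seqContinuous]
  intro v u hv
  obtain ⟨K, hK⟩ := ((continuous_kinetic.tendsto u).comp hv).bddAbove_range
  exact tendsto_potential h1 h5 (fun n => hK ⟨n, rfl⟩) ((continuous_fn.tendsto u).comp hv)

theorem continuous_energy {p q : ℝ} (hq : 1 < q) (hqp : q < p) (hp : p < 5) :
    Continuous (energy p q) := by
  have h1 := continuous_potential hq (hqp.trans hp)
  have h2 := continuous_potential (hq.trans hqp) hp
  have h3 := continuous_kinetic
  unfold energy
  fun_prop

/-! ### Dilations -/

section Dilation

variable {F : Type*} [NormedAddCommGroup F] [NormedSpace ℝ F]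

/-- The `L²`-normalized dilation by the factor `exp t`. -/
def dilFun (t : ℝ) (f : R3 → F) (x : R3) : F := Real.exp (3 / 2 * t) • f (Real.exp t • x)

theorem lintegral_comp_exp_smul (t : ℝ) {g : R3 → ℝ≥0∞} :
    ∫⁻ x, g (Real.exp t • x) = ENNReal.ofReal (Real.exp (-3 * t)) * ∫⁻ x, g x := by
  have h : Real.exp t ≠ 0 := (Real.exp_pos t).ne'
  have h1 : ∫⁻ x, g (Real.exp t • x) = ∫⁻ x, g x ∂(Measure.map (Real.exp t • ·) volume) :=
    ((MeasurableEquiv.smul₀ (Real.exp t) h).measurableEmbedding.lintegral_map g).symm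
  rw [h1, Measure.map_addHaar_smul _ h, lintegral_smul_measure, finrank_euclideanSpace_fin,
    abs_of_pos (by positivity), ← Real.exp_nat_mul, ← Real.exp_neg, smul_eq_mul]
  congr 3
  push_cast
  ring

theorem quasiMeasurePreserving_exp_smul (t : ℝ) :
    Measure.QuasiMeasurePreserving (fun x : R3 => Real.exp t • x) volume volume := by
  refine ⟨by fun_prop, ?_⟩
  rw [Measure.map_addHaar_smul _ (Real.exp_pos t).ne']
  exact Measure.smul_absolutelyContinuous

theorem lintegral_dilFun_rpow (t : ℝ) (f : R3 → F) {σ : ℝ} (hσ : 0 ≤ σ) :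
    ∫⁻ x, ‖dilFun t f x‖ₑ ^ σ
      = ENNReal.ofReal (Real.exp (3 * (σ - 2) / 2 * t)) * ∫⁻ x, ‖f x‖ₑ ^ σ := by
  have h1 : ∀ x, ‖dilFun t f x‖ₑ ^ σ
      = ENNReal.ofReal (Real.exp (3 / 2 * t * σ)) * ‖f (Real.exp t • x)‖ₑ ^ σ := by
    intro x
    rw [dilFun, enorm_smul, ENNReal.mul_rpow_of_nonneg _ _ hσ,
      Real.enorm_eq_ofReal (Real.exp_pos _).le, ENNReal.ofReal_rpow_of_pos (Real.exp_pos _),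
      ← Real.exp_mul]
  simp only [h1]
  rw [lintegral_const_mul' _ _ ENNReal.ofReal_ne_top,
    lintegral_comp_exp_smul t (g := fun x => ‖f x‖ₑ ^ σ), ← mul_assoc,
    ← ENNReal.ofReal_mul (Real.exp_pos _).le, ← Real.exp_add]
  congr 3
  ring

theorem eLpNorm_dilFun (t : ℝ) (f : R3 → F) :
    eLpNorm (dilFun t f) 2 volume = eLpNorm f 2 volume := by
  have h := lintegral_dilFun_rpow t f (σ := 2) (by norm_num)
  simp only [ENNReal.rpow_two, ← eLpNorm_two_sq] at h
  rw [show 3 * (2 - 2) / 2 * t = 0 by ring, Real.exp_zero, ENNReal.ofReal_one, one_mul] at h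
  exact (ENNReal.pow_right_strictMono two_ne_zero).injective h

theorem memLp_dilFun (t : ℝ) {f : R3 → F} (hf : MemLp f 2 volume) :
    MemLp (dilFun t f) 2 volume := by
  refine ⟨?_, by rw [eLpNorm_dilFun]; exact hf.2⟩
  exact (hf.1.comp_quasiMeasurePreserving (quasiMeasurePreserving_exp_smul t)).const_smul _

theorem dilFun_sub (t : ℝ) (f g : R3 → F) : dilFun t (f - g) = dilFun t f - dilFun t g := by
  ext x
  simp [dilFun, smul_sub]

theorem tendsto_dilFun_of_continuous {g : R3 → F} (hg : Continuous g) (hs : HasCompactSupport g)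
    (t₀ : ℝ) : Filter.Tendsto (fun t => eLpNorm (dilFun t g - dilFun t₀ g) 2 volume) (nhds t₀)
      (nhds 0) := by
  obtain ⟨C, hC⟩ := hg.bounded_above_of_compact_support hs
  have hC0 : 0 ≤ C := (norm_nonneg _).trans (hC 0)
  obtain ⟨R, hR⟩ := hs.isCompact.isBounded.subset_closedBall (0 : R3)
  set c : ℝ := Real.exp (3 / 2 * (|t₀| + 1)) * C with hc
  set B : Set R3 := Metric.closedBall 0 (Real.exp (|t₀| + 1) * R) with hB
  have hb : ∀ t, |t| ≤ |t₀| + 1 → ∀ x, ‖dilFun t g x‖ₑ ≤ B.indicator (fun _ => ENNReal.ofReal c) x := by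
    intro t ht x
    by_cases hx : x ∈ B
    · rw [Set.indicator_of_mem hx, ← ofReal_norm, dilFun, norm_smul,
        Real.norm_of_nonneg (Real.exp_pos _).le]
      refine ENNReal.ofReal_le_ofReal ?_
      have h1 : t ≤ |t₀| + 1 := (le_abs_self t).trans ht
      rw [hc]
      gcongr
      exact hC _
    · rw [Set.indicator_of_notMem hx, dilFun]
      have : g (Real.exp t • x) = 0 := by
        refine image_eq_zero_of_notMem_tsupport fun h2 => hx ?_
        have h3 := hR h2
        rw [mem_closedBall_zero_iff, norm_smul, Real.norm_of_nonneg (Real.exp_pos _).le] at h3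
        rw [hB, mem_closedBall_zero_iff]
        have h4 : -t ≤ |t₀| + 1 := (neg_le_abs t).trans ht
        calc ‖x‖ = Real.exp (-t) * (Real.exp t * ‖x‖) := by
              rw [← mul_assoc, ← Real.exp_add]; simp
          _ ≤ Real.exp (-t) * R := by gcongr
          _ ≤ _ := by
            have hR0 : 0 ≤ R := le_trans (by positivity) h3
            gcongr
      rw [this]
      simp
  have hlim : Filter.Tendsto (fun t => ∫⁻ x, ‖(dilFun t g - dilFun t₀ g) x‖ₑ ^ 2) (nhds t₀)
      (nhds (∫⁻ _ : R3, 0)) := by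
    refine tendsto_lintegral_filter_of_dominated_convergence
      (B.indicator (fun _ => (2 * ENNReal.ofReal c) ^ 2)) ?_ ?_ ?_ ?_
    · refine Filter.Eventually.of_forall fun t => ?_
      have : Continuous (dilFun t g - dilFun t₀ g) := by
        unfold dilFun
        exact ((hg.comp (by fun_prop)).const_smul _).sub ((hg.comp (by fun_prop)).const_smul _)
      exact this.enorm.measurable.pow_const 2
    · have h1 : ∀ᶠ t in nhds t₀, |t| ≤ |t₀| + 1 :=
        (continuous_abs.tendsto t₀).eventually (ge_mem_nhds (by linarith))
      filter_upwards [h1] with t ht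
      refine Filter.Eventually.of_forall fun x => ?_
      have h2 : ‖(dilFun t g - dilFun t₀ g) x‖ₑ
          ≤ B.indicator (fun _ => ENNReal.ofReal c) x + B.indicator (fun _ => ENNReal.ofReal c) x :=
        (enorm_sub_le (a := dilFun t g x) (b := dilFun t₀ g x)).trans
          (add_le_add (hb t ht x) (hb t₀ (by linarith) x))
      by_cases hx : x ∈ B
      · rw [Set.indicator_of_mem hx] at h2 ⊢
        rw [two_mul]
        gcongr
      · rw [Set.indicator_of_notMem hx] at h2 ⊢
        simp at h2
        simp [h2]
    · rw [lintegral_indicator measurableSet_closedBall, setLIntegral_const]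
      exact ENNReal.mul_ne_top (ENNReal.pow_ne_top (ENNReal.mul_ne_top (by norm_num)
        ENNReal.ofReal_ne_top)) measure_closedBall_lt_top.ne
    · refine Filter.Eventually.of_forall fun x => ?_
      have h1 : Continuous fun t => ‖(dilFun t g - dilFun t₀ g) x‖ₑ ^ 2 := by
        simp only [Pi.sub_apply, dilFun]
        exact (ENNReal.continuous_pow 2).comp (Continuous.enorm
          (((Continuous.smul (by fun_prop) (hg.comp (by fun_prop)))).sub continuous_const))
      have := h1.tendsto t₀
      simpa using this
  simp only [← eLpNorm_two_sq, lintegral_zero] at hlim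
  have h3 := ((ENNReal.continuous_rpow_const (y := 1 / 2)).tendsto _).comp hlim
  rw [ENNReal.zero_rpow_of_pos (by norm_num)] at h3
  refine h3.congr fun t => ?_
  rw [Function.comp_apply, ← ENNReal.rpow_natCast, ← ENNReal.rpow_mul]
  norm_num

theorem tendsto_dilFun {f : R3 → F} (hf : MemLp f 2 volume) (t₀ : ℝ) :
    Filter.Tendsto (fun t => eLpNorm (dilFun t f - dilFun t₀ f) 2 volume) (nhds t₀) (nhds 0) := by
  rw [ENNReal.tendsto_nhds_zero]
  intro ε hε
  have hε3 : ε / 3 ≠ 0 := (ENNReal.div_pos hε.ne' (by norm_num)).ne'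
  obtain ⟨g, hgs, hfg, hg, hgL⟩ := hf.exists_hasCompactSupport_eLpNorm_sub_le (by norm_num) hε3
  filter_upwards [ENNReal.tendsto_nhds_zero.1 (tendsto_dilFun_of_continuous hg hgs t₀) (ε / 3)
    (pos_iff_ne_zero.2 hε3)] with t ht
  have e1 : dilFun t f - dilFun t₀ f
      = dilFun t (f - g) + (dilFun t g - dilFun t₀ g) - dilFun t₀ (f - g) := by
    rw [dilFun_sub, dilFun_sub]; abel
  have hm : ∀ t, AEStronglyMeasurable (dilFun t (f - g)) volume := fun t =>
    (memLp_dilFun t (hf.sub hgL)).1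
  have hmg : AEStronglyMeasurable (dilFun t g - dilFun t₀ g) volume :=
    ((memLp_dilFun t hgL).sub (memLp_dilFun t₀ hgL)).1
  rw [e1]
  calc _ ≤ eLpNorm (dilFun t (f - g) + (dilFun t g - dilFun t₀ g)) 2 volume
        + eLpNorm (dilFun t₀ (f - g)) 2 volume :=
        eLpNorm_sub_le ((hm t).add hmg) (hm t₀) (by norm_num)
    _ ≤ eLpNorm (dilFun t (f - g)) 2 volume + eLpNorm (dilFun t g - dilFun t₀ g) 2 volume
        + eLpNorm (dilFun t₀ (f - g)) 2 volume := by
        gcongr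
        exact eLpNorm_add_le (hm t) hmg (by norm_num)
    _ ≤ ε / 3 + ε / 3 + ε / 3 := by
        rw [eLpNorm_dilFun, eLpNorm_dilFun]
        gcongr
    _ = ε := ENNReal.add_thirds ε

/-- The dilation on `L²`. -/
def dilLp (t : ℝ) (f : Lp F 2 (volume : Measure R3)) : Lp F 2 (volume : Measure R3) :=
  (memLp_dilFun t (Lp.memLp f)).toLp

theorem coeFn_dilLp (t : ℝ) (f : Lp F 2 (volume : Measure R3)) :
    dilLp t f =ᵐ[volume] dilFun t f := MemLp.coeFn_toLp _

theorem norm_dilLp (t : ℝ) (f : Lp F 2 (volume : Measure R3)) : ‖dilLp t f‖ = ‖f‖ := by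
  rw [Lp.norm_def, Lp.norm_def, eLpNorm_congr_ae (coeFn_dilLp t f), eLpNorm_dilFun]

theorem continuous_dilLp (f : Lp F 2 (volume : Measure R3)) : Continuous fun t => dilLp t f := by
  rw [continuous_iff_continuousAt]
  intro t₀
  have h := tendsto_dilFun (Lp.memLp f) t₀
  refine tendsto_iff_edist_tendsto_0.2 (h.congr fun t => ?_)
  rw [Lp.edist_def]
  refine eLpNorm_congr_ae ?_
  filter_upwards [coeFn_dilLp t f, coeFn_dilLp t₀ f] with x h1 h2
  simp [h1, h2]

end Dilation

theorem isTest_comp_smul {φ : R3 → ℝ} (hφ : IsTest φ) {c : ℝ} (hc : c ≠ 0) :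
    IsTest (fun x => φ (c • x)) where
  contDiff := hφ.contDiff.comp (by fun_prop)
  hasCompactSupport := hφ.hasCompactSupport.comp_homeomorph (Homeomorph.smulOfNeZero c hc)

theorem partialDeriv_comp_smul {φ : R3 → ℝ} (hφ : IsTest φ) (c : ℝ) (i : Fin 3) (x : R3) :
    partialDeriv i (fun x => φ (c • x)) x = c * partialDeriv i φ (c • x) := by
  have h1 : HasFDerivAt φ (fderiv ℝ φ (c • x)) (c • x) :=
    (hφ.contDiff.differentiable (by simp) _).hasFDerivAt
  have h2 : HasFDerivAt (fun y : R3 => c • y) (c • ContinuousLinearMap.id ℝ R3) x :=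
    (hasFDerivAt_id x).const_smul c
  have h3 := h1.comp x h2
  have h4 : fderiv ℝ (fun y => φ (c • y)) x = _ := h3.fderiv
  simp [partialDeriv, h4]

theorem isWeakGrad_dilLp (t : ℝ) (u : H1) :
    IsWeakGrad (dilLp t (fn u)) (Real.exp t • dilLp t (grad u)) := by
  intro φ hφ i
  set c : ℝ := Real.exp t with hc
  have hc0 : c ≠ 0 := (Real.exp_pos t).ne'
  set ψ : R3 → ℝ := fun x => φ (c⁻¹ • x) with hψ
  have hψT : IsTest ψ := isTest_comp_smul hφ (inv_ne_zero hc0)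
  have e1 : ∫ x, dilLp t (fn u) x * (partialDeriv i φ x : ℂ)
      = ∫ x, (fun y => Real.exp (3 / 2 * t) • (fn u y * (partialDeriv i φ (c⁻¹ • y) : ℂ))) (c • x) := by
    refine integral_congr_ae ?_
    filter_upwards [coeFn_dilLp t (fn u)] with x hx
    rw [hx, dilFun]
    simp only [inv_smul_smul₀ hc0, smul_mul_assoc, ← hc]
  have e2 : ∫ x, (c • dilLp t (grad u)) x i * (φ x : ℂ)
      = ∫ x, (fun y => c • Real.exp (3 / 2 * t) • (grad u y i * (ψ y : ℂ))) (c • x) := by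
    refine integral_congr_ae ?_
    filter_upwards [coeFn_dilLp t (grad u), Lp.coeFn_smul c (dilLp t (grad u))] with x hx hx2
    rw [hx2, Pi.smul_apply, hx, dilFun]
    simp only [hψ, inv_smul_smul₀ hc0, ← hc, PiLp.smul_apply, smul_mul_assoc]
  rw [e1, e2, Measure.integral_comp_smul volume
      (fun y => Real.exp (3 / 2 * t) • (fn u y * (partialDeriv i φ (c⁻¹ • y) : ℂ))) c,
    Measure.integral_comp_smul volume
      (fun y => c • Real.exp (3 / 2 * t) • (grad u y i * (ψ y : ℂ))) c, integral_smul, integral_smul,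
    integral_smul]
  have hw := u.2 ψ hψT i
  have e3 : ∫ y, fn u y * (partialDeriv i φ (c⁻¹ • y) : ℂ)
      = c • ∫ y, fn u y * (partialDeriv i ψ y : ℂ) := by
    rw [← integral_smul]
    refine integral_congr_ae (Filter.Eventually.of_forall fun y => ?_)
    simp only [hψ]
    rw [partialDeriv_comp_smul hφ]
    simp only [Complex.real_smul]
    push_cast
    have : (c : ℂ) ≠ 0 := by exact_mod_cast hc0
    field_simp
  have hw' : ∫ y, fn u y * (partialDeriv i ψ y : ℂ) = -∫ y, grad u y i * (ψ y : ℂ) := hw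
  rw [e3, hw']
  simp only [smul_neg]
  rw [smul_comm (Real.exp (3 / 2 * t)) c]

/-- The mass preserving dilation `x ↦ exp (3t/2) u (exp(t) x)`. -/
def dilate (t : ℝ) (u : H1) : H1 :=
  ⟨WithLp.toLp 2 (dilLp t (fn u), Real.exp t • dilLp t (grad u)), isWeakGrad_dilLp t u⟩

theorem fn_dilate (t : ℝ) (u : H1) : fn (dilate t u) = dilLp t (fn u) := rfl

theorem grad_dilate (t : ℝ) (u : H1) : grad (dilate t u) = Real.exp t • dilLp t (grad u) := rfl

theorem norm_fn_dilate (t : ℝ) (u : H1) : ‖fn (dilate t u)‖ = ‖fn u‖ := norm_dilLp t _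

theorem kinetic_dilate (t : ℝ) (u : H1) : kinetic (dilate t u) = Real.exp (2 * t) * kinetic u := by
  rw [kinetic_eq_norm_sq, kinetic_eq_norm_sq, grad_dilate, norm_smul, norm_dilLp, mul_pow,
    Real.norm_of_nonneg (Real.exp_pos _).le, ← Real.exp_nat_mul]
  norm_num

theorem potential_dilate (t : ℝ) (u : H1) {s : ℝ} (h1 : 1 ≤ s) :
    potential s (dilate t u) = Real.exp (3 * (s - 1) / 2 * t) * potential s u := by
  have h : ∫⁻ x, ‖fn (dilate t u) x‖ₑ ^ (s + 1) = ∫⁻ x, ‖dilFun t (fn u) x‖ₑ ^ (s + 1) := by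
    refine lintegral_congr_ae ?_
    filter_upwards [coeFn_dilLp t (fn u)] with x hx
    rw [fn_dilate, hx]
  rw [potential_eq_toReal _ h1, potential_eq_toReal _ h1, h,
    lintegral_dilFun_rpow t (fn u) (by linarith), ENNReal.toReal_mul,
    ENNReal.toReal_ofReal (Real.exp_pos _).le, show s + 1 - 2 = s - 1 by ring]

theorem continuous_dilate (u : H1) : Continuous fun t => dilate t u := by
  refine continuous_toH1 ?_ ?_
  · simp only [fn_dilate]
    exact continuous_dilLp _
  · simp only [grad_dilate]
    exact Real.continuous_exp.smul (continuous_dilLp _)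

/-! ### The energy along dilations -/

/-- The Pohozaev functional `d/dt E(dilate t u)` at `t = 0`. -/
def pohozaev (p q : ℝ) (u : H1) : ℝ :=
  kinetic u + 3 * (q - 1) / 2 * (1 / (q + 1) * potential q u)
    - 3 * (p - 1) / 2 * (1 / (p + 1) * potential p u)

theorem energy_dilate {p q : ℝ} (hp : 1 ≤ p) (hq : 1 ≤ q) (t : ℝ) (u : H1) :
    energy p q (dilate t u) = Real.exp (2 * t) * (1 / 2 * kinetic u)
      + Real.exp (3 * (q - 1) / 2 * t) * (1 / (q + 1) * potential q u)
      - Real.exp (3 * (p - 1) / 2 * t) * (1 / (p + 1) * potential p u) := by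
  rw [energy, kinetic_dilate, potential_dilate t u hp, potential_dilate t u hq]
  ring

theorem pohozaev_dilate {p q : ℝ} (hp : 1 ≤ p) (hq : 1 ≤ q) (t : ℝ) (u : H1) :
    pohozaev p q (dilate t u) = Real.exp (2 * t) * kinetic u
      + Real.exp (3 * (q - 1) / 2 * t) * (3 * (q - 1) / 2 * (1 / (q + 1) * potential q u))
      - Real.exp (3 * (p - 1) / 2 * t) * (3 * (p - 1) / 2 * (1 / (p + 1) * potential p u)) := by
  rw [pohozaev, kinetic_dilate, potential_dilate t u hp, potential_dilate t u hq]
  ring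

theorem pohozaev_dilate_zero {p q : ℝ} (hp : 1 ≤ p) (hq : 1 ≤ q) (u : H1) :
    pohozaev p q (dilate 0 u) = pohozaev p q u := by
  rw [pohozaev_dilate hp hq, pohozaev]
  simp only [mul_zero, Real.exp_zero, one_mul]

theorem continuous_pohozaev {p q : ℝ} (hq : 1 < q) (hqp : q < p) (hp : p < 5) :
    Continuous (pohozaev p q) := by
  have h1 := continuous_potential hq (hqp.trans hp)
  have h2 := continuous_potential (hq.trans hqp) hp
  have h3 := continuous_kinetic
  unfold pohozaev
  fun_prop

theorem exp_mul_sub_one_le {b c : ℝ} (hc : 0 ≤ c) (hcb : c ≤ b) (hb : 0 < b) (t : ℝ) :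
    Real.exp (c * t) - 1 ≤ c / b * (Real.exp (b * t) - 1) := by
  have h0 : 0 ≤ 1 - c / b := by rw [sub_nonneg, div_le_one hb]; exact hcb
  have h := convexOn_exp.2 (Set.mem_univ (b * t)) (Set.mem_univ 0) (div_nonneg hc hb.le) h0
    (by ring)
  simp only [smul_eq_mul, mul_zero, add_zero, Real.exp_zero, mul_one] at h
  rw [show c / b * (b * t) = c * t by field_simp] at h
  linarith

/-- Bernoulli's inequality, applied to the three powers of the dilation parameter. -/
theorem energy_dilate_le {p q : ℝ} (hp : 7 / 3 < p) (hq : 1 < q) (hqp : q < p) (t : ℝ) (u : H1) :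
    energy p q (dilate t u) ≤ energy p q u
      + (Real.exp (3 * (p - 1) / 2 * t) - 1) / (3 * (p - 1) / 2) * pohozaev p q u := by
  set b := 3 * (p - 1) / 2 with hb
  set a := 3 * (q - 1) / 2 with ha
  have hb2 : 2 < b := by rw [hb]; linarith
  have ha0 : 0 < a := by rw [ha]; linarith
  have hab : a < b := by rw [ha, hb]; linarith
  have hK := kinetic_nonneg u
  have hB : 0 ≤ 1 / (q + 1) * potential q u :=
    mul_nonneg (by have : 0 < q + 1 := by linarith
                   positivity) (potential_nonneg q u)
  rw [energy_dilate (by linarith) hq.le, energy, pohozaev, ← ha, ← hb]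
  set B := 1 / (q + 1) * potential q u
  set C := 1 / (p + 1) * potential p u
  have h1 := mul_le_mul_of_nonneg_right (exp_mul_sub_one_le (b := b) zero_le_two hb2.le
    (by linarith) t) (show 0 ≤ 1 / 2 * kinetic u by positivity)
  have h2 := mul_le_mul_of_nonneg_right (exp_mul_sub_one_le (b := b) ha0.le hab.le
    (by linarith) t) hB
  have h3 : (Real.exp (b * t) - 1) / b * (kinetic u + a * B - b * C)
      = 2 / b * (Real.exp (b * t) - 1) * (1 / 2 * kinetic u)
        + a / b * (Real.exp (b * t) - 1) * B - (Real.exp (b * t) - 1) * C := by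
    have : b ≠ 0 := by linarith
    field_simp
  rw [h3]
  linarith

theorem pohozaev_add_eq (p q : ℝ) (u : H1) :
    pohozaev p q u + (3 * (p - 1) / 4 - 1) * kinetic u
      + 3 * (p - q) / 2 * (1 / (q + 1) * potential q u) = 3 * (p - 1) / 2 * energy p q u := by
  rw [pohozaev, energy]
  ring

theorem pohozaev_neg_of_energy_neg {p q : ℝ} (hp : 7 / 3 < p) (hq : 1 < q) (hqp : q < p) {u : H1}
    (h : energy p q u < 0) : pohozaev p q u < 0 := by
  have h1 := pohozaev_add_eq p q u
  have h2 : 0 ≤ (3 * (p - 1) / 4 - 1) * kinetic u :=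
    mul_nonneg (by linarith) (kinetic_nonneg u)
  have h3 : 0 ≤ 3 * (p - q) / 2 * (1 / (q + 1) * potential q u) :=
    mul_nonneg (by linarith) (mul_nonneg (by have : 0 < q + 1 := by linarith
                                             positivity) (potential_nonneg q u))
  have h4 : 3 * (p - 1) / 2 * energy p q u < 0 := mul_neg_of_pos_of_neg (by linarith) h
  linarith

theorem tendsto_exp_const_mul_atTop {c : ℝ} (hc : c < 0) :
    Filter.Tendsto (fun t => Real.exp (c * t)) Filter.atTop (nhds 0) :=
  Real.tendsto_exp_atBot.comp (Filter.tendsto_id.const_mul_atTop_of_neg hc)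

theorem tendsto_exp_const_mul_atBot {c : ℝ} (hc : 0 < c) :
    Filter.Tendsto (fun t => Real.exp (c * t)) Filter.atBot (nhds 0) :=
  Real.tendsto_exp_atBot.comp (Filter.tendsto_id.const_mul_atBot hc)

theorem eventually_exp_sum_neg {a b X Y C : ℝ} (hb : 2 < b) (hab : a < b) (hC : 0 < C) :
    ∀ᶠ t in Filter.atTop,
      Real.exp (2 * t) * X + Real.exp (a * t) * Y - Real.exp (b * t) * C < 0 := by
  have h1 := ((tendsto_exp_const_mul_atTop (sub_neg.2 hb)).mul_const X).add
    ((tendsto_exp_const_mul_atTop (sub_neg.2 hab)).mul_const Y)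
  rw [zero_mul, zero_mul, add_zero] at h1
  filter_upwards [h1.eventually (gt_mem_nhds hC)] with t ht
  have e1 : Real.exp (2 * t) = Real.exp (b * t) * Real.exp ((2 - b) * t) := by
    rw [← Real.exp_add]; ring_nf
  have e2 : Real.exp (a * t) = Real.exp (b * t) * Real.exp ((a - b) * t) := by
    rw [← Real.exp_add]; ring_nf
  rw [e1, e2]
  have := Real.exp_pos (b * t)
  have h3 := mul_neg_of_pos_of_neg this (sub_neg.2 ht)
  linarith

theorem eventually_energy_dilate_neg {p q : ℝ} (hp : 7 / 3 < p) (hp5 : p < 5) (hq : 1 < q)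
    (hqp : q < p) {u : H1} (hu : fn u ≠ 0) :
    ∀ᶠ t in Filter.atTop, energy p q (dilate t u) < 0 := by
  have hC := potential_pos hu (show 1 ≤ p by linarith) hp5.le
  have : 0 < p + 1 := by linarith
  filter_upwards [eventually_exp_sum_neg (X := 1 / 2 * kinetic u)
    (Y := 1 / (q + 1) * potential q u) (show 2 < 3 * (p - 1) / 2 by linarith)
    (show 3 * (q - 1) / 2 < 3 * (p - 1) / 2 by linarith)
    (show 0 < 1 / (p + 1) * potential p u by positivity)] with t ht
  rwa [energy_dilate (by linarith) hq.le]

theorem eventually_pohozaev_dilate_pos {p q : ℝ} (hp : 7 / 3 < p) (hq : 1 < q)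
    {u : H1} (hu : fn u ≠ 0) :
    ∀ᶠ t in Filter.atBot, 0 < pohozaev p q (dilate t u) := by
  have hK := kinetic_pos hu
  have hB := potential_nonneg q u
  have h0 : 0 < q + 1 := by linarith
  have h1 := (tendsto_exp_const_mul_atBot (show 0 < 3 * (p - 1) / 2 - 2 by linarith)).mul_const
    (3 * (p - 1) / 2 * (1 / (p + 1) * potential p u))
  rw [zero_mul] at h1
  filter_upwards [h1.eventually (gt_mem_nhds hK)] with t ht
  rw [pohozaev_dilate (by linarith) hq.le]
  have e1 : Real.exp (3 * (p - 1) / 2 * t)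
      = Real.exp (2 * t) * Real.exp ((3 * (p - 1) / 2 - 2) * t) := by
    rw [← Real.exp_add]; ring_nf
  have h2 := mul_pos (Real.exp_pos (2 * t)) (sub_pos.2 ht)
  have h3 : 0 ≤ Real.exp (3 * (q - 1) / 2 * t)
      * (3 * (q - 1) / 2 * (1 / (q + 1) * potential q u)) := by
    have : 0 < q - 1 := by linarith
    positivity
  rw [e1]
  linarith

theorem continuous_pohozaev_dilate {p q : ℝ} (hq : 1 < q) (hqp : q < p) (hp : p < 5) (u : H1) :
    Continuous fun t => pohozaev p q (dilate t u) :=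
  (continuous_pohozaev hq hqp hp).comp (continuous_dilate u)

/-- Dilations carry every nonzero function onto the Pohozaev set, and they do so below any
parameter where the Pohozaev functional is not positive. -/
theorem exists_pohozaev_dilate_eq_zero {p q : ℝ} (hp : 7 / 3 < p) (hp5 : p < 5) (hq : 1 < q)
    (hqp : q < p) {u : H1} (hu : fn u ≠ 0) {T : ℝ} (hT : pohozaev p q (dilate T u) ≤ 0) :
    ∃ t ≤ T, pohozaev p q (dilate t u) = 0 := by
  obtain ⟨t₁, h1, h2⟩ := ((eventually_pohozaev_dilate_pos (p := p) hp hq hu).and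
    (Filter.eventually_le_atBot T)).exists
  have h3 := intermediate_value_Icc' h2
    (continuous_pohozaev_dilate hq hqp hp5 u).continuousOn
  obtain ⟨t, ht, ht0⟩ := h3 ⟨hT, h1.le⟩
  exact ⟨t, ht.2, ht0⟩

theorem pohozaev_dilate_neg {p q : ℝ} (hp : 7 / 3 < p) (hq : 1 < q) (hqp : q < p) {u : H1}
    (hu : fn u ≠ 0) (h0 : pohozaev p q u = 0) {t : ℝ} (ht : 0 < t) :
    pohozaev p q (dilate t u) < 0 := by
  rw [pohozaev_dilate (by linarith) hq.le]
  rw [pohozaev] at h0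
  have hK := kinetic_pos hu
  have hB : 0 ≤ 3 * (q - 1) / 2 * (1 / (q + 1) * potential q u) := by
    have := potential_nonneg q u
    have : 0 < q + 1 := by linarith
    have : 0 < q - 1 := by linarith
    positivity
  have e1 : Real.exp (2 * t) < Real.exp (3 * (p - 1) / 2 * t) :=
    Real.exp_lt_exp.2 (mul_lt_mul_of_pos_right (by linarith) ht)
  have e2 : Real.exp (3 * (q - 1) / 2 * t) ≤ Real.exp (3 * (p - 1) / 2 * t) :=
    Real.exp_le_exp.2 (mul_le_mul_of_nonneg_right (by linarith) ht.le)
  have h1 := mul_lt_mul_of_pos_right e1 hK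
  have h2 := mul_le_mul_of_nonneg_right e2 hB
  have h3 : Real.exp (3 * (p - 1) / 2 * t) * (3 * (p - 1) / 2 * (1 / (p + 1) * potential p u))
      = Real.exp (3 * (p - 1) / 2 * t) * (kinetic u
        + 3 * (q - 1) / 2 * (1 / (q + 1) * potential q u)) := by
    congr 1; linarith
  rw [h3]
  linarith

theorem pohozaev_dilate_pos {p q : ℝ} (hp : 7 / 3 < p) (hq : 1 < q) (hqp : q < p) {u : H1}
    (hu : fn u ≠ 0) (h0 : pohozaev p q u = 0) {t : ℝ} (ht : t < 0) :
    0 < pohozaev p q (dilate t u) := by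
  rw [pohozaev_dilate (by linarith) hq.le]
  rw [pohozaev] at h0
  have hK := kinetic_pos hu
  have hB : 0 ≤ 3 * (q - 1) / 2 * (1 / (q + 1) * potential q u) := by
    have := potential_nonneg q u
    have : 0 < q + 1 := by linarith
    have : 0 < q - 1 := by linarith
    positivity
  have e1 : Real.exp (3 * (p - 1) / 2 * t) < Real.exp (2 * t) :=
    Real.exp_lt_exp.2 (mul_lt_mul_of_neg_right (by linarith) ht)
  have e2 : Real.exp (3 * (p - 1) / 2 * t) ≤ Real.exp (3 * (q - 1) / 2 * t) :=
    Real.exp_le_exp.2 (mul_le_mul_of_nonpos_right (by linarith) ht.le)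
  have h1 := mul_lt_mul_of_pos_right e1 hK
  have h2 := mul_le_mul_of_nonneg_right e2 hB
  have h3 : Real.exp (3 * (p - 1) / 2 * t) * (3 * (p - 1) / 2 * (1 / (p + 1) * potential p u))
      = Real.exp (3 * (p - 1) / 2 * t) * (kinetic u
        + 3 * (q - 1) / 2 * (1 / (q + 1) * potential q u)) := by
    congr 1; linarith
  rw [h3]
  linarith

/-! ### Mountain pass geometry -/

/-- The higher power is absorbed by the lower one and by Sobolev's inequality. -/
theorem exists_potential_le {p q : ℝ} (hq : 1 < q) (hqp : q < p) (hp5 : p < 5) {δ : ℝ}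
    (hδ : 0 < δ) : ∃ c : ℝ, 0 < c ∧ ∀ u : H1,
      potential p u ≤ δ * potential q u + c * kinetic u ^ 3 := by
  obtain ⟨S, hS0, hS⟩ := exists_sobolev_lintegral
  have hq1 : 0 < q + 1 := by linarith
  -- `t ^ (p + 1) ≤ Λ ^ (p - q) t ^ (q + 1) + Λ ^ (p - 5) t ^ 6`; this `Λ` makes the first factor `δ`
  set Λ : ℝ := δ ^ (1 / (p - q)) with hΛ
  have hΛ0 : 0 < Λ := by positivity
  have hΛ1 : Λ ^ (p - q) = δ := by
    rw [hΛ, ← Real.rpow_mul (by positivity), one_div_mul_cancel (by linarith), Real.rpow_one]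
  refine ⟨Λ ^ (p - 5) * S, by positivity, fun u => ?_⟩
  have h6 : potential 5 u ≤ S * kinetic u ^ 3 := by
    have h := hS u
    rw [show (6 : ℝ) = 5 + 1 by norm_num, ← ofReal_potential u (by norm_num) le_rfl] at h
    have := kinetic_nonneg u
    exact (ENNReal.ofReal_le_ofReal_iff (by positivity)).1 h
  have h1 : potential p u ≤ Λ ^ (p - q) * potential q u + Λ ^ (p - 5) * potential 5 u := by
    simp only [potential]
    rw [← integral_const_mul, ← integral_const_mul, ← integral_add
      ((integrable_fn_rpow u hq.le (by linarith)).const_mul _)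
      ((integrable_fn_rpow u (by norm_num) le_rfl).const_mul _)]
    refine integral_mono (integrable_fn_rpow u (by linarith) hp5.le)
      (((integrable_fn_rpow u hq.le (by linarith)).const_mul _).add
      ((integrable_fn_rpow u (by norm_num) le_rfl).const_mul _)) fun x => ?_
    have := rpow_le_interpolate hΛ0 (norm_nonneg (fn u x)) hq1 (show q + 1 ≤ p + 1 by linarith)
      (show p + 1 ≤ 5 + 1 by linarith)
    rwa [show p + 1 - (q + 1) = p - q by ring, show p + 1 - (5 + 1) = p - 5 by ring] at this
  rw [hΛ1] at h1
  rw [mul_assoc]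
  exact h1.trans (by gcongr)

/-- The constant does not depend on the mass. This is why one parameter `k` serves all masses. -/
theorem exists_energy_ge {p q : ℝ} (hq : 1 < q) (hqp : q < p) (hp5 : p < 5) :
    ∃ c : ℝ, 0 < c ∧ ∀ u : H1, 1 / 2 * kinetic u - c * kinetic u ^ 3 ≤ energy p q u := by
  have hp1 : 0 < p + 1 := by linarith
  have hq1 : 0 < q + 1 := by linarith
  obtain ⟨c, hc0, hc⟩ := exists_potential_le hq hqp hp5 (show 0 < (p + 1) / (q + 1) by positivity)
  refine ⟨1 / (p + 1) * c, by positivity, fun u => ?_⟩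
  have h3 : 1 / (p + 1) * potential p u
      ≤ 1 / (p + 1) * ((p + 1) / (q + 1) * potential q u + c * kinetic u ^ 3) := by
    gcongr
    exact hc u
  have h4 : 1 / (p + 1) * ((p + 1) / (q + 1) * potential q u + c * kinetic u ^ 3)
      = 1 / (q + 1) * potential q u + 1 / (p + 1) * c * kinetic u ^ 3 := by
    field_simp
  rw [energy]
  linarith

/-- On the Pohozaev set, the kinetic energy is bounded from below. -/
theorem exists_kinetic_ge {p q : ℝ} (hq : 1 < q) (hqp : q < p) (hp5 : p < 5) :
    ∃ κ : ℝ, 0 < κ ∧ ∀ u : H1, fn u ≠ 0 → pohozaev p q u = 0 → κ ≤ kinetic u := by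
  have hp1 : 0 < p + 1 := by linarith
  have hq1 : 0 < q + 1 := by linarith
  have hq2 : 0 < q - 1 := by linarith
  have hp2 : 0 < p - 1 := by linarith
  set A : ℝ := 3 * (q - 1) / 2 * (1 / (q + 1)) with hA
  set B : ℝ := 3 * (p - 1) / 2 * (1 / (p + 1)) with hB
  have hA0 : 0 < A := by positivity
  have hB0 : 0 < B := by positivity
  obtain ⟨c, hc0, hc⟩ := exists_potential_le hq hqp hp5 (div_pos hA0 hB0)
  refine ⟨min 1 (1 / (B * c)), lt_min one_pos (by positivity), fun u hu h0 => ?_⟩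
  have hK := kinetic_pos hu
  have h1 : kinetic u + A * potential q u = B * potential p u := by
    rw [pohozaev] at h0
    rw [hA, hB]
    linarith
  have h2 : B * potential p u ≤ B * (A / B * potential q u + c * kinetic u ^ 3) := by
    gcongr
    exact hc u
  have h3 : B * (A / B * potential q u + c * kinetic u ^ 3)
      = A * potential q u + B * c * kinetic u ^ 3 := by field_simp
  have h4 : 1 ≤ B * c * kinetic u ^ 2 := by
    have : kinetic u * 1 ≤ kinetic u * (B * c * kinetic u ^ 2) := by
      calc kinetic u * 1 ≤ B * c * kinetic u ^ 3 := by linarith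
        _ = _ := by ring
    exact le_of_mul_le_mul_left this hK
  by_contra! hlt
  obtain ⟨h5, h6⟩ := lt_min_iff.1 hlt
  have h7 : B * c * kinetic u ^ 2 < 1 := by
    calc B * c * kinetic u ^ 2 = (B * c * kinetic u) * kinetic u := by ring
      _ ≤ (B * c * kinetic u) * 1 := by gcongr
      _ < B * c * (1 / (B * c)) := by rw [mul_one]; gcongr
      _ = 1 := by field_simp
  linarith

theorem kinetic_le_normX_sq (q : ℝ) (u : H1) : kinetic u ≤ normX q u ^ 2 := by
  have h1 : kinetic u = (kinetic u ^ (1 / 2 : ℝ)) ^ 2 := by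
    rw [← Real.rpow_natCast, ← Real.rpow_mul (kinetic_nonneg u)]; norm_num
  have h2 := Real.rpow_nonneg (potential_nonneg q u) (1 / (q + 1))
  have h3 := Real.rpow_nonneg (kinetic_nonneg u) (1 / 2)
  nth_rewrite 1 [h1]
  rw [normX]
  gcongr
  linarith

theorem potential_le_of_normX {q : ℝ} (hq : 1 < q) {k : ℝ} {u : H1} (h : normX q u ^ 2 ≤ k) :
    potential q u ≤ k ^ ((q + 1) / 2) := by
  have h2 := Real.rpow_nonneg (potential_nonneg q u) (1 / (q + 1))
  have h3 := Real.rpow_nonneg (kinetic_nonneg u) (1 / 2)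
  have hq1 : 0 < q + 1 := by linarith
  have h4 : (potential q u ^ (1 / (q + 1))) ^ 2 ≤ k := by
    refine le_trans ?_ h
    rw [normX]
    gcongr
    linarith
  calc potential q u = ((potential q u ^ (1 / (q + 1))) ^ 2) ^ ((q + 1) / 2) := by
        rw [← Real.rpow_natCast, ← Real.rpow_mul (potential_nonneg q u),
          ← Real.rpow_mul (potential_nonneg q u)]
        rw [show 1 / (q + 1) * ((2 : ℕ) : ℝ) * ((q + 1) / 2) = 1 by push_cast; field_simp,
          Real.rpow_one]
    _ ≤ _ := by gcongr

theorem energy_le_of_normX {p q : ℝ} (hp : 1 < p) (hq : 1 < q) {k : ℝ} {u : H1}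
    (h : normX q u ^ 2 ≤ k) : energy p q u ≤ 1 / 2 * k + k ^ ((q + 1) / 2) := by
  have h1 := (kinetic_le_normX_sq q u).trans h
  have h2 := potential_le_of_normX hq h
  have h3 : 0 ≤ 1 / (p + 1) * potential p u := by
    have := potential_nonneg p u
    have : 0 < p + 1 := by linarith
    positivity
  have h4 : 1 / (q + 1) * potential q u ≤ 1 * potential q u := by
    have := potential_nonneg q u
    gcongr
    rw [div_le_one (by linarith)]
    linarith
  rw [energy]
  linarith

theorem bddBelow_path_max {p q : ℝ} (hq : 1 < q) (hqp : q < p) (hp5 : p < 5) (k m : ℝ) :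
    BddBelow ((fun g : C(unitInterval, massSphere m) => ⨆ t, energy p q (g t : H1))
      '' paths p q k m) := by
  obtain ⟨c, hc0, hc⟩ := exists_energy_ge hq hqp hp5
  refine ⟨-(c * k ^ 3), ?_⟩
  rintro _ ⟨g, hg, rfl⟩
  have hcont : Continuous fun t => energy p q (g t : H1) :=
    (continuous_energy hq hqp hp5).comp (continuous_subtype_val.comp g.continuous)
  have h1 := hc (g 0 : H1)
  have hK := kinetic_nonneg (g 0 : H1)
  have hKk := (kinetic_le_normX_sq q (g 0 : H1)).trans hg.1
  have h2 : c * kinetic (g 0 : H1) ^ 3 ≤ c * k ^ 3 := by gcongr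
  refine le_trans ?_ (le_ciSup (isCompact_range hcont).bddAbove (0 : unitInterval))
  linarith

theorem level_le_of_path {p q : ℝ} (hq : 1 < q) (hqp : q < p) (hp5 : p < 5) {k m e : ℝ}
    {g : C(unitInterval, massSphere m)} (hg : g ∈ paths p q k m)
    (he : ∀ t, energy p q (g t : H1) ≤ e) : level p q k m ≤ e :=
  (csInf_le (bddBelow_path_max hq hqp hp5 k m) ⟨g, hg, rfl⟩).trans (ciSup_le he)

/-- The path of dilations of `u` with parameters from `x` to `y`. -/
theorem exists_dilation_path {u : H1} {m : ℝ} (hu : ‖fn u‖ ^ 2 = m) {x y : ℝ} (hxy : x ≤ y) :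
    ∃ g : C(unitInterval, massSphere m), (g 0 : H1) = dilate x u ∧ (g 1 : H1) = dilate y u ∧
      ∀ s, ∃ t, x ≤ t ∧ (g s : H1) = dilate t u := by
  refine ⟨⟨fun s => ⟨dilate (x + s * (y - x)) u, ?_⟩, ?_⟩, ?_, ?_, fun s => ⟨x + s * (y - x), ?_, rfl⟩⟩
  · rw [massSphere, Set.mem_ofPred_eq, norm_fn_dilate, hu]
  · refine Continuous.subtype_mk ((continuous_dilate u).comp ?_) _
    fun_prop
  · simp
  · simp
  · have := mul_nonneg s.2.1 (sub_nonneg.2 hxy)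
    linarith

theorem eventually_normX_dilate_le {q : ℝ} (hq : 1 < q) {k : ℝ} (hk : 0 < k) (u : H1) :
    ∀ᶠ t in Filter.atBot, normX q (dilate t u) ^ 2 ≤ k := by
  have h1 : Filter.Tendsto (fun t => kinetic (dilate t u)) Filter.atBot (nhds 0) := by
    simp only [kinetic_dilate]
    simpa using (tendsto_exp_const_mul_atBot two_pos).mul_const (kinetic u)
  have h2 : Filter.Tendsto (fun t => potential q (dilate t u)) Filter.atBot (nhds 0) := by
    simp only [potential_dilate _ u hq.le]
    simpa using (tendsto_exp_const_mul_atBot (show 0 < 3 * (q - 1) / 2 by linarith)).mul_const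
      (potential q u)
  have h3 := ((h1.rpow_const (p := 1 / 2) (Or.inr (by norm_num))).add
    (h2.rpow_const (p := 1 / (q + 1)) (Or.inr (by
      have : 0 < q + 1 := by linarith
      positivity)))).pow 2
  rw [Real.zero_rpow (by norm_num), Real.zero_rpow (by
    have : 0 < q + 1 := by linarith
    positivity), add_zero, zero_pow two_ne_zero] at h3
  exact h3.eventually (ge_mem_nhds hk)

theorem exists_isTest_ne_zero : ∃ φ : R3 → ℝ, IsTest φ ∧ (∀ x, 0 ≤ φ x) ∧
    ∀ x ∈ Metric.ball (0 : R3) 1, 0 < φ x := by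
  let f : ContDiffBump (0 : R3) := ⟨1, 2, one_pos, by norm_num⟩
  exact ⟨f, ⟨f.contDiff, f.hasCompactSupport⟩, fun x => f.nonneg, fun x hx =>
    f.pos_of_mem_ball (Metric.ball_subset_ball (by norm_num [f]) hx)⟩

theorem exists_fn_ne_zero : ∃ w : H1, fn w ≠ 0 := by
  obtain ⟨φ, hφ, -, hpos⟩ := exists_isTest_ne_zero
  obtain ⟨w, hw, -⟩ := exists_H1_of_isTest hφ
  refine ⟨w, fun h0 => ?_⟩
  rw [Lp.eq_zero_iff_ae_eq_zero] at h0
  have h1 : ∀ᵐ x : R3, x ∉ Metric.ball (0 : R3) 1 := by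
    filter_upwards [hw, h0] with x h1 h2 hx
    rw [h2, Pi.zero_apply] at h1
    exact (hpos x hx).ne' (by exact_mod_cast h1.symm)
  have h2 : volume (Metric.ball (0 : R3) 1) = 0 := by
    simp only [ae_iff, not_not] at h1
    exact h1
  exact (Metric.measure_ball_pos volume (0 : R3) one_pos).ne' h2

theorem paths_nonempty {p q : ℝ} (hp : 7 / 3 < p) (hp5 : p < 5) (hq : 1 < q) (hqp : q < p)
    {k r : ℝ} (hk : 0 < k) (hr : 0 < r) : (paths p q k (r ^ 2)).Nonempty := by
  obtain ⟨w, hw⟩ := exists_fn_ne_zero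
  have hw0 : 0 < ‖fn w‖ := norm_pos_iff.2 hw
  set u : H1 := ((r / ‖fn w‖ : ℝ) : ℂ) • w with hu
  have hur : ‖fn u‖ = r := by
    rw [hu, fn_smul, norm_smul, Complex.norm_real, Real.norm_of_nonneg (by positivity),
      div_mul_cancel₀ _ hw0.ne']
  have hu0 : fn u ≠ 0 := norm_pos_iff.1 (by rw [hur]; exact hr)
  obtain ⟨x, hx, hx0⟩ := ((eventually_normX_dilate_le hq hk u).and
    (Filter.eventually_le_atBot 0)).exists
  obtain ⟨y, hy, hy0⟩ := ((eventually_energy_dilate_neg hp hp5 hq hqp hu0).and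
    (Filter.eventually_ge_atTop 0)).exists
  obtain ⟨g, hg0, hg1, -⟩ := exists_dilation_path (m := r ^ 2) (by rw [hur]) (hx0.trans hy0)
  exact ⟨g, by rwa [hg0], by rwa [hg1]⟩

/-- A parameter that serves all masses. -/
theorem exists_mountainPassGeometry {p q : ℝ} (hp : 7 / 3 < p) (hp5 : p < 5) (hq : 1 < q)
    (hqp : q < p) : ∃ k : ℝ, ∀ r : ℝ, 0 < r → MountainPassGeometry p q k (r ^ 2) := by
  obtain ⟨c, hc0, hc⟩ := exists_energy_ge hq hqp hp5
  -- below the kinetic energy `κ`, the cubic term is at most a quarter of the kinetic energy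
  set κ : ℝ := 1 / (2 * (1 + c)) with hκ
  have hκ0 : 0 < κ := by positivity
  have hcκ : c * κ ^ 2 ≤ 1 / 4 := by
    rw [hκ, div_pow, one_pow, mul_one_div, div_le_div_iff₀ (by positivity) (by norm_num)]
    nlinarith
  have hlow : ∀ u : H1, kinetic u ≤ κ → 1 / 4 * kinetic u ≤ energy p q u := by
    intro u hu
    have h0 := kinetic_nonneg u
    have h1 := hc u
    have h2 : c * kinetic u ^ 2 ≤ 1 / 4 := le_trans (by gcongr) hcκ
    have h3 : c * kinetic u ^ 3 ≤ 1 / 4 * kinetic u := by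
      calc c * kinetic u ^ 3 = (c * kinetic u ^ 2) * kinetic u := by ring
        _ ≤ _ := by gcongr
    linarith
  set k : ℝ := min 1 (κ / 16) with hk
  have hk0 : 0 < k := lt_min one_pos (by positivity)
  have hk1 : k ≤ 1 := min_le_left _ _
  have hkκ : k ≤ κ / 16 := min_le_right _ _
  refine ⟨k, fun r hr => ?_⟩
  have hne := paths_nonempty hp hp5 hq hqp hk0 hr
  have hstart : ∀ u : H1, normX q u ^ 2 ≤ k → energy p q u ≤ 2 * k := by
    intro u hu
    have h1 := energy_le_of_normX (p := p) (by linarith) hq hu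
    have h2 : k ^ ((q + 1) / 2) ≤ k ^ (1 : ℝ) :=
      Real.rpow_le_rpow_of_exponent_ge hk0 hk1 (by linarith)
    rw [Real.rpow_one] at h2
    linarith
  refine ⟨hk0, hne, lt_of_le_of_lt (b := 2 * k) (max_le ?_ ?_) ?_⟩
  · refine csSup_le (hne.image _) ?_
    rintro _ ⟨g, hg, rfl⟩
    exact hstart _ hg.1
  · refine csSup_le (hne.image _) ?_
    rintro _ ⟨g, hg, rfl⟩
    have := hg.2
    dsimp only
    linarith
  · refine lt_of_lt_of_le (b := κ / 4) (by linarith) (le_csInf (hne.image _) ?_)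
    rintro _ ⟨g, hg, rfl⟩
    have hgc : Continuous fun t => (g t : H1) := continuous_subtype_val.comp g.continuous
    have hK0 : kinetic (g 0 : H1) ≤ κ :=
      ((kinetic_le_normX_sq q _).trans hg.1).trans (by linarith)
    have hK1 : κ ≤ kinetic (g 1 : H1) := by
      by_contra! h
      have h1 := hlow _ h.le
      have h2 := hg.2
      have := kinetic_nonneg (g 1 : H1)
      linarith
    obtain ⟨t, ht⟩ := mem_range_of_exists_le_of_exists_ge (continuous_kinetic.comp hgc)
      ⟨0, hK0⟩ ⟨1, hK1⟩
    have ht' : kinetic (g t : H1) = κ := ht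
    have h1 := hlow (g t) ht'.le
    rw [ht'] at h1
    refine le_trans ?_ (le_ciSup
      (isCompact_range ((continuous_energy hq hqp hp5).comp hgc)).bddAbove t)
    dsimp only [Function.comp_apply]
    linarith

/-! ### The mountain pass level and the Pohozaev set -/

/-- A function on the Pohozaev set maximizes the energy on its dilation orbit, and a piece of this
orbit is an admissible path. -/
theorem level_le_energy {p q : ℝ} (hp : 7 / 3 < p) (hp5 : p < 5) (hq : 1 < q) (hqp : q < p)
    {k r : ℝ} (hk : 0 < k) {u : H1} (hu : fn u ≠ 0) (hur : ‖fn u‖ = r) (hQ : pohozaev p q u = 0) :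
    level p q k (r ^ 2) ≤ energy p q u := by
  obtain ⟨x, hx, hx0⟩ := ((eventually_normX_dilate_le hq hk u).and
    (Filter.eventually_le_atBot 0)).exists
  obtain ⟨y, hy, hy0⟩ := ((eventually_energy_dilate_neg hp hp5 hq hqp hu).and
    (Filter.eventually_ge_atTop 0)).exists
  obtain ⟨g, hg0, hg1, hgt⟩ := exists_dilation_path (m := r ^ 2) (by rw [hur]) (hx0.trans hy0)
  refine level_le_of_path hq hqp hp5 (g := g) ⟨by rwa [hg0], by rwa [hg1]⟩ fun s => ?_
  obtain ⟨t, -, ht⟩ := hgt s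
  have := energy_dilate_le hp hq hqp t u
  rw [hQ, mul_zero, add_zero] at this
  rwa [ht]

/-- Under mountain pass geometry, the level is approximated by energies on the Pohozaev set. -/
theorem MountainPassGeometry.exists_pohozaev {p q : ℝ} (hp : 7 / 3 < p) (hp5 : p < 5) (hq : 1 < q)
    (hqp : q < p) {k r : ℝ} (h : MountainPassGeometry p q k (r ^ 2)) (hr : 0 < r) {ε : ℝ}
    (hε : 0 < ε) : ∃ u : H1, ‖fn u‖ = r ∧ pohozaev p q u = 0 ∧
      energy p q u ≤ level p q k (r ^ 2) + ε := by
  obtain ⟨_, ⟨g, hg, rfl⟩, hgε⟩ := exists_lt_of_csInf_lt (h.nonempty.image _)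
    (show level p q k (r ^ 2) < level p q k (r ^ 2) + ε by linarith)
  have hgc : Continuous fun t => (g t : H1) := continuous_subtype_val.comp g.continuous
  have hnorm : ∀ t, ‖fn (g t : H1)‖ = r := fun t =>
    (sq_eq_sq₀ (norm_nonneg _) hr.le).1 (g t).2
  have hne : ∀ t, fn (g t : H1) ≠ 0 := fun t => norm_pos_iff.1 (by rw [hnorm]; exact hr)
  have hQ1 : pohozaev p q (g 1 : H1) < 0 := pohozaev_neg_of_energy_neg hp hq hqp hg.2
  have hQ0 : 0 ≤ pohozaev p q (g 0 : H1) := by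
    by_contra! hneg
    -- otherwise the energy decreases along dilations from `g 0`, which is then a path of its own
    obtain ⟨y, hy, hy0⟩ := ((eventually_energy_dilate_neg hp hp5 hq hqp (hne 0)).and
      (Filter.eventually_ge_atTop 0)).exists
    obtain ⟨g', hg0, hg1, hgt⟩ := exists_dilation_path (m := r ^ 2) (g 0).2 hy0
    have hstart : normX q (dilate 0 (g 0 : H1)) = normX q (g 0 : H1) := by
      rw [normX, normX, kinetic_dilate, potential_dilate _ _ hq.le]
      simp
    have h1 : level p q k (r ^ 2) ≤ energy p q (g 0 : H1) := by
      refine level_le_of_path hq hqp hp5 (g := g')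
        ⟨by rw [hg0, hstart]; exact hg.1, by rwa [hg1]⟩ fun s => ?_
      obtain ⟨t, ht0, ht⟩ := hgt s
      have h2 := energy_dilate_le hp hq hqp t (g 0 : H1)
      have h3 : 0 ≤ (Real.exp (3 * (p - 1) / 2 * t) - 1) / (3 * (p - 1) / 2) := by
        have hb : 0 < 3 * (p - 1) / 2 := by linarith
        refine div_nonneg ?_ hb.le
        have := Real.add_one_le_exp (3 * (p - 1) / 2 * t)
        have := mul_nonneg hb.le ht0
        linarith
      have h4 := mul_nonpos_of_nonneg_of_nonpos h3 hneg.le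
      rw [ht]
      linarith
    have h2 : energy p q (g 0 : H1)
        ≤ sSup ((fun g : C(unitInterval, massSphere (r ^ 2)) => energy p q (g 0 : H1))
          '' paths p q k (r ^ 2)) := by
      refine le_csSup ⟨1 / 2 * k + k ^ ((q + 1) / 2), ?_⟩ ⟨g, hg, rfl⟩
      rintro _ ⟨g₁, hg₁, rfl⟩
      exact energy_le_of_normX (by linarith) hq hg₁.1
    have h3 := h.lt_level
    have h4 := le_max_left (sSup ((fun g : C(unitInterval, massSphere (r ^ 2)) =>
      energy p q (g 0 : H1)) '' paths p q k (r ^ 2))) (sSup ((fun g : C(unitInterval,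
      massSphere (r ^ 2)) => energy p q (g 1 : H1)) '' paths p q k (r ^ 2)))
    linarith
  obtain ⟨t, ht⟩ := mem_range_of_exists_le_of_exists_ge
    ((continuous_pohozaev hq hqp hp5).comp hgc) ⟨1, hQ1.le⟩ ⟨0, hQ0⟩
  refine ⟨g t, hnorm t, ht, ?_⟩
  refine le_trans ?_ hgε.le
  exact le_ciSup (isCompact_range ((continuous_energy hq hqp hp5).comp hgc)).bddAbove t

/-! ### Adding mass at infinity -/

theorem tendsto_kinetic_of_sub {ι : Type*} {l : Filter ι} {u : H1} {v : ι → H1}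
    (h : Filter.Tendsto (fun n => kinetic (v n - u)) l (nhds 0)) :
    Filter.Tendsto (fun n => kinetic (v n)) l (nhds (kinetic u)) := by
  have h1 : Filter.Tendsto (fun n => ‖grad (v n) - grad u‖) l (nhds 0) := by
    have h2 := h.sqrt
    rw [Real.sqrt_zero] at h2
    refine h2.congr fun n => ?_
    rw [kinetic_eq_norm_sq, grad_sub, Real.sqrt_sq (norm_nonneg _)]
  have h2 : Filter.Tendsto (fun n => grad (v n)) l (nhds (grad u)) :=
    tendsto_iff_norm_sub_tendsto_zero.2 h1
  have h3 := h2.norm.pow 2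
  refine (h3.congr fun n => (kinetic_eq_norm_sq _).symm).trans ?_
  rw [kinetic_eq_norm_sq]

theorem kinetic_smul (c : ℝ) (u : H1) : kinetic ((c : ℂ) • u) = c ^ 2 * kinetic u := by
  rw [kinetic_eq_norm_sq, kinetic_eq_norm_sq, grad_smul, norm_smul, mul_pow, Complex.norm_real,
    Real.norm_eq_abs, sq_abs]

theorem potential_smul {c : ℝ} (hc : 0 ≤ c) (s : ℝ) (u : H1) :
    potential s ((c : ℂ) • u) = c ^ (s + 1) * potential s u := by
  rw [potential, potential, ← integral_const_mul]
  refine integral_congr_ae ?_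
  filter_upwards [Lp.coeFn_smul (c : ℂ) (fn u)] with x hx
  rw [fn_smul, hx, Pi.smul_apply, norm_smul, Complex.norm_real, Real.norm_of_nonneg hc,
    Real.mul_rpow hc (norm_nonneg _)]

theorem tendsto_energy {p q : ℝ} {ι : Type*} {l : Filter ι} {u : H1} {v : ι → H1}
    (hK : Filter.Tendsto (fun n => kinetic (v n)) l (nhds (kinetic u)))
    (hq : Filter.Tendsto (fun n => potential q (v n)) l (nhds (potential q u)))
    (hp : Filter.Tendsto (fun n => potential p (v n)) l (nhds (potential p u))) :
    Filter.Tendsto (fun n => energy p q (v n)) l (nhds (energy p q u)) :=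
  ((hK.const_mul _).add (hq.const_mul _)).sub (hp.const_mul _)

theorem tendsto_pohozaev {p q : ℝ} {ι : Type*} {l : Filter ι} {u : H1} {v : ι → H1}
    (hK : Filter.Tendsto (fun n => kinetic (v n)) l (nhds (kinetic u)))
    (hq : Filter.Tendsto (fun n => potential q (v n)) l (nhds (potential q u)))
    (hp : Filter.Tendsto (fun n => potential p (v n)) l (nhds (potential p u))) :
    Filter.Tendsto (fun n => pohozaev p q (v n)) l (nhds (pohozaev p q u)) :=
  (hK.add ((hq.const_mul _).const_mul _)).sub ((hp.const_mul _).const_mul _)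

/-- The mass can be increased at arbitrarily small cost: add a function that is spread out so much
that only its mass is felt. -/
theorem exists_add_mass {u : H1} {r : ℝ} (hur : ‖fn u‖ < r) : ∃ v : ℕ → H1,
    (∀ n, ‖fn (v n)‖ = r) ∧
    Filter.Tendsto (fun n => kinetic (v n)) Filter.atTop (nhds (kinetic u)) ∧
    ∀ s, 1 < s → s < 5 →
      Filter.Tendsto (fun n => potential s (v n)) Filter.atTop (nhds (potential s u)) := by
  obtain ⟨w, hw⟩ := exists_fn_ne_zero
  have hw0 : 0 < ‖fn w‖ := norm_pos_iff.2 hw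
  have hu0 := norm_nonneg (fn u)
  -- with the coefficient `M` the spread function alone has enough mass to exceed `r` after
  -- subtracting `u`, so a coefficient in `[0, M]` gives the mass `r` exactly
  set M : ℝ := (r + ‖fn u‖) / ‖fn w‖ with hM
  have hM0 : 0 ≤ M := div_nonneg (by linarith) hw0.le
  have hc : ∀ n : ℕ, ∃ c : ℝ, 0 ≤ c ∧ c ≤ M ∧ ‖fn (u + (c : ℂ) • dilate (-(n : ℝ)) w)‖ = r := by
    intro n
    have hcont : Continuous fun c : ℝ => ‖fn (u + (c : ℂ) • dilate (-(n : ℝ)) w)‖ := by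
      refine (continuous_fn.comp ?_).norm
      exact continuous_const.add (Complex.continuous_ofReal.smul continuous_const)
    have h1 : r ≤ ‖fn (u + (M : ℂ) • dilate (-(n : ℝ)) w)‖ := by
      have e1 : ‖(M : ℂ) • fn (dilate (-(n : ℝ)) w)‖ = r + ‖fn u‖ := by
        rw [norm_smul, norm_fn_dilate, Complex.norm_real, Real.norm_of_nonneg hM0, hM,
          div_mul_cancel₀ _ hw0.ne']
      have e2 := norm_sub_norm_le ((M : ℂ) • fn (dilate (-(n : ℝ)) w)) (-fn u)
      rw [norm_neg, e1, sub_neg_eq_add, add_comm _ (fn u)] at e2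
      have : fn (u + (M : ℂ) • dilate (-(n : ℝ)) w)
        = fn u + (M : ℂ) • fn (dilate (-(n : ℝ)) w) := rfl
      rw [this]
      linarith
    obtain ⟨c, hc, hcr⟩ := intermediate_value_Icc hM0 hcont.continuousOn
      (show r ∈ Set.Icc _ _ from ⟨by simpa using hur.le, h1⟩)
    exact ⟨c, hc.1, hc.2, hcr⟩
  choose c hc0 hcM hcr using hc
  have hn : Filter.Tendsto (fun n : ℕ => -(n : ℝ)) Filter.atTop Filter.atBot :=
    Filter.tendsto_neg_atTop_atBot.comp tendsto_natCast_atTop_atTop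
  refine ⟨fun n => u + (c n : ℂ) • dilate (-(n : ℝ)) w, hcr, tendsto_kinetic_of_sub ?_,
    fun s hs h5 => tendsto_potential_of_sub hs.le h5.le ?_⟩
  · simp only [add_sub_cancel_left, kinetic_smul, kinetic_dilate]
    have h1 := (((tendsto_exp_const_mul_atBot two_pos).comp hn).mul_const (kinetic w)).const_mul
      (M ^ 2)
    rw [zero_mul, mul_zero] at h1
    refine squeeze_zero (fun n => ?_) (fun n => ?_) h1
    · have := kinetic_nonneg w
      positivity
    · have := kinetic_nonneg w
      have h2 := hcM n
      have h3 := hc0 n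
      dsimp only [Function.comp_apply]
      gcongr
  · simp only [add_sub_cancel_left]
    have h1 := (((tendsto_exp_const_mul_atBot (show 0 < 3 * (s - 1) / 2 by linarith)).comp
      hn).mul_const (potential s w)).const_mul (M ^ (s + 1))
    rw [zero_mul, mul_zero] at h1
    refine squeeze_zero (fun n => potential_nonneg _ _) (fun n => ?_) h1
    have := potential_nonneg s w
    have h2 := hcM n
    have h3 := hc0 n
    rw [potential_smul (hc0 n), potential_dilate _ _ hs.le]
    dsimp only [Function.comp_apply]
    gcongr

/-- The level for the mass `r²` is a lower bound for the energy on the part of the Pohozaev set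
with mass at most `r²`. -/
theorem level_le_energy_of_norm_le {p q : ℝ} (hp : 7 / 3 < p) (hp5 : p < 5) (hq : 1 < q)
    (hqp : q < p) {k r : ℝ} (hk : 0 < k) {u : H1} (hu : fn u ≠ 0) (hur : ‖fn u‖ ≤ r)
    (hQ : pohozaev p q u = 0) : level p q k (r ^ 2) ≤ energy p q u := by
  rcases hur.eq_or_lt with hur | hur
  · exact level_le_energy hp hp5 hq hqp hk hu hur hQ
  have hr : 0 < r := (norm_nonneg _).trans_lt hur
  obtain ⟨v, hvr, hvK, hvs⟩ := exists_add_mass hur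
  have hvq := hvs q hq (by linarith)
  have hvp := hvs p (by linarith) hp5
  have hE := tendsto_energy hvK hvq hvp
  have hP := tendsto_pohozaev hvK hvq hvp
  have hP1 : Filter.Tendsto (fun n => pohozaev p q (dilate 1 (v n))) Filter.atTop
      (nhds (pohozaev p q (dilate 1 u))) := by
    simp only [pohozaev_dilate (show 1 ≤ p by linarith) hq.le]
    exact ((hvK.const_mul _).add (((hvq.const_mul _).const_mul _).const_mul _)).sub
      (((hvp.const_mul _).const_mul _).const_mul _)
  have hb : 0 < 3 * (p - 1) / 2 := by linarith
  set C : ℝ := (Real.exp (3 * (p - 1) / 2 * 1) + 1) / (3 * (p - 1) / 2) with hC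
  have hlim : Filter.Tendsto (fun n => energy p q (v n) + C * |pohozaev p q (v n)|) Filter.atTop
      (nhds (energy p q u)) := by
    have := hE.add (hP.abs.const_mul C)
    rwa [hQ, abs_zero, mul_zero, add_zero] at this
  refine ge_of_tendsto hlim ?_
  filter_upwards [hP1.eventually (gt_mem_nhds (pohozaev_dilate_neg hp hq hqp hu hQ one_pos))]
    with n hn
  have hvn : fn (v n) ≠ 0 := norm_pos_iff.1 (by rw [hvr]; exact hr)
  obtain ⟨t, ht1, ht⟩ := exists_pohozaev_dilate_eq_zero hp hp5 hq hqp hvn hn.le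
  have h1 : level p q k (r ^ 2) ≤ energy p q (dilate t (v n)) :=
    level_le_energy hp hp5 hq hqp hk
      (norm_pos_iff.1 (by rw [norm_fn_dilate, hvr]; exact hr)) (by rw [norm_fn_dilate, hvr]) ht
  refine h1.trans ((energy_dilate_le hp hq hqp t (v n)).trans (add_le_add_right ?_ _))
  refine (le_abs_self _).trans ?_
  rw [abs_mul]
  gcongr
  rw [abs_div, abs_of_pos hb, hC]
  gcongr
  have h2 := Real.exp_pos (3 * (p - 1) / 2 * t)
  have h3 : Real.exp (3 * (p - 1) / 2 * t) ≤ Real.exp (3 * (p - 1) / 2 * 1) := by gcongr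
  rw [abs_le]
  constructor <;> linarith

/-! ### Compactness of radially decreasing sequences -/

theorem RadiallyDecreasing.dilFun {v : R3 → ℝ} (h : RadiallyDecreasing v) (t : ℝ) :
    RadiallyDecreasing (dilFun t v) := by
  obtain ⟨L, hL, hLv⟩ := h
  refine ⟨{x | Real.exp t • x ∈ L}, (quasiMeasurePreserving_exp_smul t).ae hL,
    fun x hx y hy hxy => ?_⟩
  unfold CombinedNLS.dilFun
  refine smul_le_smul_of_nonneg_left (hLv _ hx _ hy ?_) (Real.exp_pos _).le
  rw [norm_smul, norm_smul]
  gcongr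

theorem HasProfile.dilate {u : H1} {v : R3 → ℝ} (h : HasProfile u v) (t : ℝ) :
    HasProfile (dilate t u) (dilFun t v) where
  meas := (h.meas.comp_measurable (g := fun x : R3 => Real.exp t • x) (by fun_prop)).const_smul
    (Real.exp (3 / 2 * t))
  nonneg x := smul_nonneg (Real.exp_pos _).le (h.nonneg _)
  radial := h.radial.dilFun t
  eq := by
    filter_upwards [coeFn_dilLp t (fn u), (quasiMeasurePreserving_exp_smul t).ae h.eq] with x h1 h2
    rw [fn_dilate, h1, dilFun, h2, dilFun, Complex.real_smul, smul_eq_mul, Complex.ofReal_mul]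

/-- The decay of radially decreasing functions that is forced by their mass. -/
theorem RadiallyDecreasing.enorm_sq_le {v : R3 → ℝ} (h : RadiallyDecreasing v)
    (hv0 : ∀ x, 0 ≤ v x) (R : ℝ) : ∀ᵐ x, x ∉ Metric.ball (0 : R3) R →
      ‖v x‖ₑ ^ 2 * volume (Metric.ball (0 : R3) R) ≤ ∫⁻ x, ‖v x‖ₑ ^ 2 := by
  obtain ⟨L, hL, hLv⟩ := h
  filter_upwards [hL] with x hx hxR
  rw [← setLIntegral_const]
  refine le_trans (lintegral_mono_ae ?_) (setLIntegral_le_lintegral (Metric.ball (0 : R3) R) _)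
  filter_upwards [ae_restrict_of_ae hL, ae_restrict_mem Metric.isOpen_ball.measurableSet]
    with y hy hyR
  rw [mem_ball_zero_iff, not_lt] at hxR
  rw [mem_ball_zero_iff] at hyR
  rw [enorm_of_nonneg (hv0 x), enorm_of_nonneg (hv0 y)]
  gcongr
  exact hLv y hy x hx (hyR.le.trans hxR)

/-- Uniform smallness of tails: a radially decreasing function is small outside a large ball, in
terms of its mass only. -/
theorem RadiallyDecreasing.setLIntegral_compl_ball_le {v : R3 → ℝ} (h : RadiallyDecreasing v)
    (hv0 : ∀ x, 0 ≤ v x) {M : ℝ≥0∞} (hM : ∫⁻ x, ‖v x‖ₑ ^ 2 ≤ M) {R : ℝ} (hR : 0 < R) {σ : ℝ}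
    (hσ : 2 ≤ σ) : ∫⁻ x in (Metric.ball (0 : R3) R)ᶜ, ‖v x‖ₑ ^ σ
      ≤ (M / volume (Metric.ball (0 : R3) R)) ^ ((σ - 2) / 2) * M := by
  have hvol0 : volume (Metric.ball (0 : R3) R) ≠ 0 := (Metric.measure_ball_pos _ _ hR).ne'
  have hvolt : volume (Metric.ball (0 : R3) R) ≠ ⊤ := measure_ball_lt_top.ne
  by_cases hMt : M = ⊤
  · have h1 : (⊤ / volume (Metric.ball (0 : R3) R)) ^ ((σ - 2) / 2) * ⊤ = (⊤ : ℝ≥0∞) := by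
      refine ENNReal.mul_top fun h0 => ?_
      rw [ENNReal.rpow_eq_zero_iff, ENNReal.top_div_of_ne_top hvolt] at h0
      rcases h0 with h0 | h0
      · exact ENNReal.top_ne_zero h0.1
      · linarith [h0.2]
    rw [hMt, h1]
    exact le_top
  have hb : ∀ᵐ x ∂(volume.restrict (Metric.ball (0 : R3) R)ᶜ),
      ‖v x‖ₑ ^ σ ≤ (M / volume (Metric.ball (0 : R3) R)) ^ ((σ - 2) / 2) * ‖v x‖ₑ ^ 2 := by
    filter_upwards [ae_restrict_of_ae (h.enorm_sq_le hv0 R),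
      ae_restrict_mem Metric.isOpen_ball.measurableSet.compl] with x hx hxR
    have h1 : ‖v x‖ₑ ^ 2 ≤ M / volume (Metric.ball (0 : R3) R) := by
      rw [ENNReal.le_div_iff_mul_le (Or.inl hvol0) (Or.inl hvolt)]
      exact (hx hxR).trans hM
    have h2 : ‖v x‖ₑ ^ σ = (‖v x‖ₑ ^ 2) ^ ((σ - 2) / 2) * ‖v x‖ₑ ^ 2 := by
      rw [← ENNReal.rpow_two, ← ENNReal.rpow_mul, ← ENNReal.rpow_add_of_nonneg _ _
        (by linarith) (by norm_num)]
      congr 1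
      ring
    rw [h2]
    gcongr
  calc _ ≤ ∫⁻ x in (Metric.ball (0 : R3) R)ᶜ,
        (M / volume (Metric.ball (0 : R3) R)) ^ ((σ - 2) / 2) * ‖v x‖ₑ ^ 2 := lintegral_mono_ae hb
    _ = (M / volume (Metric.ball (0 : R3) R)) ^ ((σ - 2) / 2)
        * ∫⁻ x in (Metric.ball (0 : R3) R)ᶜ, ‖v x‖ₑ ^ 2 := by
      refine lintegral_const_mul' _ _ (ENNReal.rpow_ne_top_of_nonneg (by linarith) ?_)
      exact ENNReal.div_ne_top hMt hvol0
    _ ≤ _ := by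
      gcongr
      exact (setLIntegral_le_lintegral _ _).trans hM

theorem tendsto_tail {M : ℝ≥0∞} (hM : M ≠ ⊤) {θ : ℝ} (hθ : 0 < θ) : Filter.Tendsto
    (fun n : ℕ => (M / volume (Metric.ball (0 : R3) ((n : ℝ) + 1))) ^ θ * M) Filter.atTop
    (nhds 0) := by
  have h1 : Filter.Tendsto (fun n : ℕ => volume (Metric.ball (0 : R3) ((n : ℝ) + 1)))
      Filter.atTop (nhds ⊤) := by
    have hm : Monotone fun n : ℕ => Metric.ball (0 : R3) (n : ℝ) := fun m n hmn =>
      Metric.ball_subset_ball (by exact_mod_cast hmn)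
    have h2 := tendsto_measure_iUnion_atTop (μ := (volume : Measure R3)) hm
    rw [Metric.iUnion_ball_nat, measure_univ_of_isAddLeftInvariant] at h2
    refine (h2.comp (Filter.tendsto_add_atTop_nat 1)).congr fun n => ?_
    simp only [Function.comp_apply]
    push_cast
    rfl
  have h3 := ENNReal.Tendsto.const_div h1 (Or.inr hM) (a := M)
  rw [ENNReal.div_top] at h3
  have h4 := ((ENNReal.continuous_rpow_const (y := θ)).tendsto _).comp h3
  rw [ENNReal.zero_rpow_of_pos hθ] at h4
  simpa using ENNReal.Tendsto.mul_const h4 (Or.inr hM)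

theorem lintegral_rpow_le_liminf {α E : Type*} [MeasurableSpace α] {μ : Measure α}
    [NormedAddCommGroup E] {v : ℕ → α → E} {u : α → E}
    (hv : ∀ n, StronglyMeasurable (v n)) {σ : ℝ}
    (h : ∀ᵐ x ∂μ, Filter.Tendsto (fun n => v n x) Filter.atTop (nhds (u x))) :
    ∫⁻ x, ‖u x‖ₑ ^ σ ∂μ ≤ Filter.liminf (fun n => ∫⁻ x, ‖v n x‖ₑ ^ σ ∂μ) Filter.atTop := by
  have h1 : ∀ᵐ x ∂μ, ‖u x‖ₑ ^ σ = Filter.liminf (fun n => ‖v n x‖ₑ ^ σ) Filter.atTop := by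
    filter_upwards [h] with x hx
    exact (((ENNReal.continuous_rpow_const (y := σ)).tendsto _).comp hx.enorm).liminf_eq.symm
  rw [lintegral_congr_ae h1]
  exact lintegral_liminf_le fun n => (hv n).enorm.pow_const _

/-- In the limit of a sequence of radially decreasing functions, mass, kinetic energy and the lower
power do not increase, and nothing of the higher power is lost. -/
theorem exists_radial_limit {p q : ℝ} (hq : 1 < q) (hqp : q < p) (hp5 : p < 5) {W : ℕ → H1}
    {w : ℕ → R3 → ℝ} (hW : ∀ n, HasProfile (W n) (w n)) {r K Nq Np : ℝ}
    (hr : ∀ n, ‖fn (W n)‖ ≤ r)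
    (hK : Filter.Tendsto (fun n => kinetic (W n)) Filter.atTop (nhds K))
    (hNq : Filter.Tendsto (fun n => potential q (W n)) Filter.atTop (nhds Nq))
    (hNp : Filter.Tendsto (fun n => potential p (W n)) Filter.atTop (nhds Np)) :
    ∃ (U : H1) (V : R3 → ℝ), HasProfile U V ∧ ‖fn U‖ ≤ r ∧ kinetic U ≤ K ∧ potential q U ≤ Nq ∧
      Np ≤ potential p U := by
  have hr0 : 0 ≤ r := (norm_nonneg _).trans (hr 0)
  have hK0 : 0 ≤ K := ge_of_tendsto' hK fun n => kinetic_nonneg _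
  obtain ⟨A, hA⟩ := hK.bddAbove_range
  have hA' : ∀ n, kinetic (W n) ≤ A := fun n => hA ⟨n, rfl⟩
  have hA0 : 0 ≤ A := (kinetic_nonneg _).trans (hA' 0)
  have hmass : ∀ n, ∫⁻ x, ‖w n x‖ₑ ^ 2 ≤ ENNReal.ofReal (r ^ 2) := by
    intro n
    have h1 := (hW n).lintegral_rpow 2
    simp only [ENNReal.rpow_two] at h1
    rw [← h1, lintegral_fn_sq]
    refine ENNReal.ofReal_le_ofReal ?_
    have := hr n
    gcongr
  have hnl : ∀ n ε, nonlocalEnergy ε (w n)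
      ≤ ENNReal.ofReal (ballMoment ε) * ENNReal.ofReal (kinetic (W n)) := by
    intro n ε
    have h1 : nonlocalEnergy ε (w n) = nonlocalEnergy ε (fun x => (w n x : ℂ)) := by
      refine lintegral_congr fun x => lintegral_congr fun y => ?_
      rw [← Complex.ofReal_sub, ← ofReal_norm (Complex.ofReal _), Complex.norm_real, ofReal_norm]
    rw [h1, ← nonlocalEnergy_congr_ae (hW n).eq, ← lintegral_grad_eq]
    exact nonlocalEnergy_fn_le (W n) ε
  obtain ⟨φ, G, hφ, hGm, hGae, hGν⟩ := exists_subseq_tendsto (fun n => (hW n).meas) hmass hA0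
    fun n ε _ => (hnl n ε).trans (by gcongr; exact hA' n)
  have hφt := hφ.tendsto_atTop
  set V : R3 → ℝ := fun x => |G x| with hVdef
  have hVm : StronglyMeasurable V := hGm.norm
  have hVG : V =ᵐ[volume] G := by
    filter_upwards [hGae] with x hx
    exact abs_of_nonneg (ge_of_tendsto' hx fun n => (hW _).nonneg x)
  have hVae : ∀ᵐ x, Filter.Tendsto (fun n => w (φ n) x) Filter.atTop (nhds (V x)) := by
    filter_upwards [hGae, hVG] with x hx hx2
    rwa [hx2]
  have hVν : Filter.Tendsto (fun n => eLpNorm (w (φ n) - V) 2 weightedMeasure) Filter.atTop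
      (nhds 0) := by
    refine hGν.congr fun n => eLpNorm_congr_ae ?_
    filter_upwards [weightedMeasure_le.absolutelyContinuous.ae_le hVG] with x hx
    simp only [Pi.sub_apply, hx]
  have hVrad : RadiallyDecreasing V := by
    choose L hL hLw using fun n => (hW (φ n)).radial
    refine ⟨{x | (∀ n, x ∈ L n) ∧ Filter.Tendsto (fun n => w (φ n) x) Filter.atTop (nhds (V x))},
      ?_, fun x hx y hy hxy => ?_⟩
    · filter_upwards [ae_all_iff.2 hL, hVae] with x h1 h2
      exact ⟨h1, h2⟩
    · exact le_of_tendsto_of_tendsto' hy.2 hx.2 fun n => hLw n x (hx.1 n) y (hy.1 n) hxy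
  have hVmass : ∫⁻ x, ‖V x‖ₑ ^ 2 ≤ ENNReal.ofReal (r ^ 2) := by
    have := lintegral_rpow_le_of_tendsto (σ := 2) (fun n => (hW (φ n)).meas) hVae
      (fun n => by simpa using hmass (φ n))
    simpa using this
  have hVnl : ∀ ε > 0, nonlocalEnergy ε V ≤ ENNReal.ofReal (ballMoment ε) * ENNReal.ofReal K := by
    intro ε _
    refine (nonlocalEnergy_le_liminf (fun n => (hW (φ n)).meas) hVae ε).trans ?_
    have h1 : Filter.Tendsto (fun n => ENNReal.ofReal (ballMoment ε)
        * ENNReal.ofReal (kinetic (W (φ n)))) Filter.atTop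
        (nhds (ENNReal.ofReal (ballMoment ε) * ENNReal.ofReal K)) :=
      ENNReal.Tendsto.const_mul (ENNReal.tendsto_ofReal (hK.comp hφt))
        (Or.inr ENNReal.ofReal_ne_top)
    rw [← h1.liminf_eq]
    exact Filter.liminf_le_liminf (Filter.Eventually.of_forall fun n => hnl (φ n) ε)
  obtain ⟨U, hU, hUK⟩ := exists_H1_of_real hVm hK0 hVmass hVnl
  have hUV : HasProfile U V := ⟨hVm, fun x => abs_nonneg _, hVrad, hU⟩
  refine ⟨U, V, hUV, ?_, hUK, ?_, ?_⟩
  · refine le_of_sq_le_sq ?_ hr0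
    rw [← ENNReal.ofReal_le_ofReal_iff (by positivity), ← lintegral_fn_sq]
    have h := hUV.lintegral_rpow 2
    simp only [ENNReal.rpow_two] at h
    rw [h]
    exact hVmass
  · have hNq0 : 0 ≤ Nq := ge_of_tendsto' hNq fun n => potential_nonneg _ _
    rw [← ENNReal.ofReal_le_ofReal_iff hNq0, ofReal_potential U hq.le (by linarith),
      hUV.lintegral_rpow]
    refine (lintegral_rpow_le_liminf (fun n => (hW (φ n)).meas) hVae).trans (le_of_eq ?_)
    refine Filter.Tendsto.liminf_eq ?_
    refine (ENNReal.tendsto_ofReal (hNq.comp hφt)).congr fun n => ?_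
    rw [Function.comp_apply, ofReal_potential _ hq.le (by linarith), (hW (φ n)).lintegral_rpow]
  · obtain ⟨S, hS0, hS⟩ := exists_sobolev_lintegral
    have hσ : 0 < p + 1 := by linarith
    have hw6 : ∀ n, ∫⁻ x, ‖w (φ n) x‖ₑ ^ (6 : ℝ) ≤ ENNReal.ofReal (S * A ^ 3) := by
      intro n
      rw [← (hW (φ n)).lintegral_rpow]
      refine (hS _).trans (ENNReal.ofReal_le_ofReal ?_)
      have := kinetic_nonneg (W (φ n))
      have := hA' (φ n)
      gcongr
    have hV6 := lintegral_rpow_le_of_tendsto (fun n => (hW (φ n)).meas) hVae hw6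
    rw [← ENNReal.ofReal_le_ofReal_iff (potential_nonneg _ _),
      ofReal_potential U (by linarith) hp5.le, hUV.lintegral_rpow]
    have hball : ∀ R : ℝ, 0 < R → ENNReal.ofReal Np ≤ (∫⁻ x, ‖V x‖ₑ ^ (p + 1))
        + (ENNReal.ofReal (r ^ 2) / volume (Metric.ball (0 : R3) R)) ^ ((p + 1 - 2) / 2)
          * ENNReal.ofReal (r ^ 2) := by
      intro R hR
      have h1 := tendsto_eLpNorm_ball (show 2 < p + 1 by linarith) (show p + 1 < 6 by linarith)
        (fun n => (hW (φ n)).meas) hVm ENNReal.ofReal_ne_top hw6 hV6 hVν R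
      have h2 := h1.const_add (eLpNorm V (ENNReal.ofReal (p + 1))
        (volume.restrict (Metric.ball (0 : R3) R)))
      rw [add_zero] at h2
      have h3 := ((ENNReal.continuous_rpow_const (y := p + 1)).tendsto _).comp h2
      have h4 := h3.add_const ((ENNReal.ofReal (r ^ 2) / volume (Metric.ball (0 : R3) R))
        ^ ((p + 1 - 2) / 2) * ENNReal.ofReal (r ^ 2))
      refine (le_of_tendsto_of_tendsto' (ENNReal.tendsto_ofReal (hNp.comp hφt)) h4 fun n => ?_).trans
        (add_le_add_left ?_ _)
      · rw [Function.comp_apply, ofReal_potential _ (by linarith) hp5.le,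
          (hW (φ n)).lintegral_rpow,
          ← lintegral_add_compl _ (Metric.isOpen_ball (x := (0 : R3)) (ε := R)).measurableSet]
        refine add_le_add ?_ ?_
        · rw [lintegral_enorm_rpow_eq_eLpNorm hσ, Function.comp_apply]
          gcongr
          exact eLpNorm_le_add_sub hVm (hW (φ n)).meas (by linarith)
        · exact (hW (φ n)).radial.setLIntegral_compl_ball_le (hW (φ n)).nonneg (hmass (φ n)) hR
            (by linarith)
      · rw [← lintegral_enorm_rpow_eq_eLpNorm hσ]
        exact setLIntegral_le_lintegral _ _
    have h5 := (tendsto_tail (M := ENNReal.ofReal (r ^ 2)) ENNReal.ofReal_ne_top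
      (show 0 < (p + 1 - 2) / 2 by linarith)).const_add (∫⁻ x, ‖V x‖ₑ ^ (p + 1))
    rw [add_zero] at h5
    exact ge_of_tendsto' h5 fun n => hball _ (by positivity)

/-! ### Minimizers on the Pohozaev set -/

/-- Increasing the higher power and decreasing the other terms, followed by a dilation back to the
Pohozaev set, does not increase the energy. -/
theorem energy_dilate_mono {p q : ℝ} (hp : 1 ≤ p) (hq : 1 ≤ q) {U u : H1}
    (hK : kinetic U ≤ kinetic u) (hNq : potential q U ≤ potential q u)
    (hNp : potential p u ≤ potential p U) (t : ℝ) :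
    energy p q (dilate t U) ≤ energy p q (dilate t u) := by
  have hp0 : 0 < p + 1 := by linarith
  have hq0 : 0 < q + 1 := by linarith
  rw [energy_dilate hp hq, energy_dilate hp hq]
  gcongr

/-- The mass of the minimizer may be smaller than `r`, because strong convergence in `L²` can fail.
The limit does not vanish since its `N_p` is bounded away from `0`. -/
theorem exists_minimizer {p q : ℝ} (hp : 7 / 3 < p) (hp5 : p < 5) (hq : 1 < q) (hqp : q < p)
    {c r : ℝ} (hr : 0 < r) (h : ∀ ε > 0, ∃ u : H1, ‖fn u‖ = r ∧ pohozaev p q u = 0 ∧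
      energy p q u ≤ c + ε) :
    ∃ (U : H1) (V : R3 → ℝ), HasProfile U V ∧ fn U ≠ 0 ∧ ‖fn U‖ ≤ r ∧ pohozaev p q U = 0 ∧
      energy p q U ≤ c := by
  have hp1 : 1 ≤ p := by linarith
  have hp0 : 0 < p + 1 := by linarith
  have hq0 : 0 < q + 1 := by linarith
  have hq1 : 0 < q - 1 := by linarith
  have hp2 : 0 < p - 1 := by linarith
  -- a minimizing sequence of radially decreasing functions
  have hseq : ∀ n : ℕ, ∃ (W : H1) (w : R3 → ℝ), HasProfile W w ∧ fn W ≠ 0 ∧ ‖fn W‖ ≤ r ∧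
      pohozaev p q W = 0 ∧ energy p q W ≤ c + 1 / ((n : ℝ) + 1) := by
    intro n
    obtain ⟨u, hur, hu0, huE⟩ := h (1 / ((n : ℝ) + 1)) (by positivity)
    have hune : fn u ≠ 0 := norm_pos_iff.1 (by rw [hur]; exact hr)
    obtain ⟨U, v, hUv, hK, hm, hNq, hNp⟩ := exists_symmetrization hq hqp hp5 u
    have hUne : fn U ≠ 0 :=
      fn_ne_zero_of_potential_pos hp1 ((potential_pos hune hp1 hp5.le).trans_le hNp)
    have hQU : pohozaev p q (dilate 0 U) ≤ 0 := by
      rw [pohozaev_dilate_zero hp1 hq.le, ← hu0, pohozaev, pohozaev]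
      gcongr
    obtain ⟨t, -, ht⟩ := exists_pohozaev_dilate_eq_zero hp hp5 hq hqp hUne hQU
    refine ⟨dilate t U, dilFun t v, hUv.dilate t, ?_, ?_, ht, ?_⟩
    · rw [← norm_pos_iff, norm_fn_dilate, norm_pos_iff]; exact hUne
    · rw [norm_fn_dilate]; exact hm.trans hur.le
    · have h1 := energy_dilate_le hp hq hqp t u
      rw [hu0, mul_zero, add_zero] at h1
      exact (energy_dilate_mono hp1 hq.le hK hNq hNp t).trans (h1.trans huE)
  choose W w hWw hWne hWr hWQ hWE using hseq
  have hE1 : ∀ n, energy p q (W n) ≤ c + 1 := fun n => by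
    refine (hWE n).trans ?_
    have : 1 / ((n : ℝ) + 1) ≤ 1 := by
      rw [div_le_one (by positivity)]
      have : (0 : ℝ) ≤ n := n.cast_nonneg
      linarith
    linarith
  set β : ℝ := 3 * (p - 1) / 2 with hβ
  have hβ0 : 0 < β := by rw [hβ]; linarith
  -- coercivity of the energy on the Pohozaev set
  have hcoer : ∀ n, (3 * (p - 1) / 4 - 1) * kinetic (W n)
      + 3 * (p - q) / 2 * (1 / (q + 1)) * potential q (W n) ≤ β * (c + 1) := by
    intro n
    have h1 := pohozaev_add_eq p q (W n)
    rw [hWQ n, zero_add] at h1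
    have h2 := mul_le_mul_of_nonneg_left (hE1 n) hβ0.le
    rw [mul_assoc, h1]
    exact h2
  have hc1 : 0 < 3 * (p - 1) / 4 - 1 := by linarith
  have hc2 : 0 < 3 * (p - q) / 2 * (1 / (q + 1)) := by
    have : 0 < p - q := by linarith
    positivity
  have hKb : ∀ n, kinetic (W n) ≤ β * (c + 1) / (3 * (p - 1) / 4 - 1) := fun n => by
    rw [le_div_iff₀ hc1]
    have := mul_nonneg hc2.le (potential_nonneg q (W n))
    linarith [hcoer n]
  have hNb : ∀ n, potential q (W n) ≤ β * (c + 1) / (3 * (p - q) / 2 * (1 / (q + 1))) :=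
    fun n => by
    rw [le_div_iff₀ hc2]
    have := mul_nonneg hc1.le (kinetic_nonneg (W n))
    linarith [hcoer n]
  obtain ⟨⟨K, Nq⟩, -, φ, hφ, hlim⟩ := tendsto_subseq_of_bounded
    (x := fun n => (kinetic (W n), potential q (W n)))
    ((Metric.isBounded_Icc (0 : ℝ) (β * (c + 1) / (3 * (p - 1) / 4 - 1))).prod
      (Metric.isBounded_Icc (0 : ℝ) (β * (c + 1) / (3 * (p - q) / 2 * (1 / (q + 1))))))
    fun n => ⟨⟨kinetic_nonneg _, hKb n⟩, ⟨potential_nonneg _ _, hNb n⟩⟩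
  have hK : Filter.Tendsto (fun n => kinetic (W (φ n))) Filter.atTop (nhds K) :=
    (continuous_fst.tendsto _).comp hlim
  have hNq : Filter.Tendsto (fun n => potential q (W (φ n))) Filter.atTop (nhds Nq) :=
    (continuous_snd.tendsto _).comp hlim
  set Np : ℝ := (K + 3 * (q - 1) / 2 * (1 / (q + 1) * Nq)) / (β * (1 / (p + 1))) with hNpdef
  have hβp : 0 < β * (1 / (p + 1)) := by positivity
  have hNp : Filter.Tendsto (fun n => potential p (W (φ n))) Filter.atTop (nhds Np) := by
    refine ((hK.add ((hNq.const_mul _).const_mul _)).div_const _).congr fun n => ?_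
    have h1 := hWQ (φ n)
    rw [pohozaev] at h1
    rw [div_eq_iff hβp.ne', hβ]
    linarith
  obtain ⟨κ, hκ0, hκ⟩ := exists_kinetic_ge hq hqp hp5
  have hKκ : κ ≤ K := ge_of_tendsto' hK fun n => hκ _ (hWne _) (hWQ _)
  have hNq0 : 0 ≤ Nq := ge_of_tendsto' hNq fun n => potential_nonneg _ _
  have hNp0 : 0 < Np := by
    have : 0 < K := by linarith
    positivity
  obtain ⟨U, V, hUV, hUr, hUK, hUq, hUp⟩ := exists_radial_limit hq hqp hp5
    (fun n => hWw (φ n)) (fun n => hWr (φ n)) hK hNq hNp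
  have hUne : fn U ≠ 0 := fn_ne_zero_of_potential_pos hp1 (hNp0.trans_le hUp)
  have hQU : pohozaev p q (dilate 0 U) ≤ 0 := by
    rw [pohozaev_dilate_zero hp1 hq.le, pohozaev]
    have h1 : K + 3 * (q - 1) / 2 * (1 / (q + 1) * Nq) - β * (1 / (p + 1) * Np) = 0 := by
      rw [← mul_assoc β, hNpdef, mul_div_cancel₀ _ hβp.ne', sub_self]
    rw [← h1, ← hβ]
    gcongr
  obtain ⟨t, -, ht⟩ := exists_pohozaev_dilate_eq_zero hp hp5 hq hqp hUne hQU
  refine ⟨dilate t U, dilFun t V, hUV.dilate t, ?_, ?_, ht, ?_⟩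
  · rw [← norm_pos_iff, norm_fn_dilate, norm_pos_iff]; exact hUne
  · rw [norm_fn_dilate]; exact hUr
  · have h1 : energy p q (dilate t U) ≤ Real.exp (2 * t) * (1 / 2 * K)
        + Real.exp (3 * (q - 1) / 2 * t) * (1 / (q + 1) * Nq)
        - Real.exp (3 * (p - 1) / 2 * t) * (1 / (p + 1) * Np) := by
      rw [energy_dilate hp1 hq.le]
      gcongr
    have h2 : Filter.Tendsto (fun n => energy p q (dilate t (W (φ n)))) Filter.atTop
        (nhds (Real.exp (2 * t) * (1 / 2 * K)
        + Real.exp (3 * (q - 1) / 2 * t) * (1 / (q + 1) * Nq)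
        - Real.exp (3 * (p - 1) / 2 * t) * (1 / (p + 1) * Np))) := by
      simp only [energy_dilate hp1 hq.le]
      exact (((hK.const_mul _).const_mul _).add ((hNq.const_mul _).const_mul _)).sub
        ((hNp.const_mul _).const_mul _)
    have h3 : Filter.Tendsto (fun n => c + 1 / (((φ n : ℕ) : ℝ) + 1)) Filter.atTop
        (nhds (c + 0)) :=
      (tendsto_one_div_add_atTop_nhds_zero_nat.comp hφ.tendsto_atTop).const_add c
    rw [add_zero] at h3
    refine h1.trans (le_of_tendsto_of_tendsto' h2 h3 fun n => ?_)
    have h4 := energy_dilate_le hp hq hqp t (W (φ n))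
    rw [hWQ, mul_zero, add_zero] at h4
    exact h4.trans (hWE _)

/-! ### First variation -/

theorem integrable_add_rpow {v φ : R3 → ℝ} {u : H1} (h : HasProfile u v) (hφ : IsTest φ) {s : ℝ}
    (h1 : 1 ≤ s) (h5 : s ≤ 5) : Integrable (fun x => (v x + |φ x|) ^ (s + 1)) volume := by
  have hσ : 0 < s + 1 := by linarith
  have hv : MemLp v (ENNReal.ofReal (s + 1)) volume := by
    refine ⟨h.meas.aestronglyMeasurable, ?_⟩
    have e1 : eLpNorm v (ENNReal.ofReal (s + 1)) volume
        = eLpNorm (fn u) (ENNReal.ofReal (s + 1)) volume := by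
      refine eLpNorm_congr_norm_ae ?_
      filter_upwards [h.eq] with x hx
      rw [hx, Complex.norm_real]
    rw [e1, eLpNorm_fn_eq u h1 h5]
    exact ENNReal.ofReal_lt_top
  have hφp : MemLp (fun x => |φ x|) (ENNReal.ofReal (s + 1)) volume :=
    (hφ.contDiff.continuous.memLp_of_hasCompactSupport hφ.hasCompactSupport).abs
  have h2 := (hv.add hφp).integrable_norm_rpow (by simpa using hσ) ENNReal.ofReal_ne_top
  rw [ENNReal.toReal_ofReal hσ.le] at h2
  refine h2.congr (Filter.Eventually.of_forall fun x => ?_)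
  simp only [Pi.add_apply]
  rw [Real.norm_of_nonneg (add_nonneg (h.nonneg x) (abs_nonneg _))]

theorem abs_rpow_mul_le {a b t s : ℝ} (h1 : 1 ≤ s) (ha : 0 ≤ a) (ht : |t| ≤ 1) :
    ‖|a + t * b| ^ (s - 1) * (a + t * b) * b‖ ≤ (a + |b|) ^ (s + 1) := by
  have hb : |b| ≤ a + |b| := by linarith
  have hz : |a + t * b| ≤ a + |b| := by
    refine (abs_add_le _ _).trans ?_
    rw [abs_of_nonneg ha, abs_mul]
    have := mul_le_mul_of_nonneg_right ht (abs_nonneg b)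
    linarith
  have h0 : 0 ≤ a + |b| := by positivity
  rw [norm_mul, norm_mul, Real.norm_eq_abs, Real.norm_eq_abs, Real.norm_eq_abs,
    abs_of_nonneg (by positivity : 0 ≤ |a + t * b| ^ (s - 1))]
  calc |a + t * b| ^ (s - 1) * |a + t * b| * |b|
      ≤ (a + |b|) ^ (s - 1) * (a + |b|) * (a + |b|) := by
        have : 0 ≤ s - 1 := by linarith
        gcongr
    _ = (a + |b|) ^ (s - 1) * (a + |b|) ^ (2 : ℝ) := by rw [Real.rpow_two]; ring
    _ = _ := by
      rw [← Real.rpow_add_of_nonneg h0 (by linarith) (by norm_num)]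
      ring_nf

theorem integrable_rpow_mul {v φ : R3 → ℝ} {u : H1} (h : HasProfile u v) (hφ : IsTest φ) {s : ℝ}
    (h1 : 1 ≤ s) (h5 : s ≤ 5) : Integrable (fun x => v x ^ (s - 1) * v x * φ x) volume := by
  refine (integrable_add_rpow h hφ h1 h5).mono' ?_ (Filter.Eventually.of_forall fun x => ?_)
  · exact (((h.meas.measurable.pow_const _).mul h.meas.measurable).mul
      hφ.contDiff.continuous.measurable).aestronglyMeasurable
  · have := abs_rpow_mul_le (b := φ x) (t := 0) h1 (h.nonneg x) (by simp)
    simpa [abs_of_nonneg (h.nonneg x)] using this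

theorem hasDerivAt_potential {v φ : R3 → ℝ} {u w : H1} (h : HasProfile u v) (hφ : IsTest φ)
    (hw : ∀ᵐ x, fn w x = (φ x : ℂ)) {s : ℝ} (h1 : 1 < s) (h5 : s ≤ 5) :
    HasDerivAt (fun t : ℝ => potential s (u + (t : ℂ) • w))
      ((s + 1) * ∫ x, v x ^ (s - 1) * v x * φ x) 0 := by
  have hpot : ∀ t : ℝ, potential s (u + (t : ℂ) • w) = ∫ x, |v x + t * φ x| ^ (s + 1) := by
    intro t
    refine integral_congr_ae ?_
    filter_upwards [h.eq, hw, Lp.coeFn_add (fn u) ((t : ℂ) • fn w),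
      Lp.coeFn_smul (t : ℂ) (fn w)] with x e1 e2 e3 e4
    have e5 : fn (u + (t : ℂ) • w) x = ((v x + t * φ x : ℝ) : ℂ) := by
      rw [fn_add, fn_smul, e3, Pi.add_apply, e4, Pi.smul_apply, e1, e2, smul_eq_mul]
      push_cast
      rfl
    rw [e5, Complex.norm_real, Real.norm_eq_abs]
  simp only [hpot]
  have hmeas : ∀ t : ℝ, Measurable fun x => v x + t * φ x := fun t =>
    h.meas.measurable.add (hφ.contDiff.continuous.measurable.const_mul t)
  have hint := integrable_add_rpow h hφ h1.le h5
  have key := hasDerivAt_integral_of_dominated_loc_of_deriv_le (μ := (volume : Measure R3))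
    (F := fun (t : ℝ) x => |v x + t * φ x| ^ (s + 1))
    (F' := fun (t : ℝ) x => (s + 1) * (|v x + t * φ x| ^ (s - 1) * (v x + t * φ x) * φ x))
    (bound := fun x => (s + 1) * (v x + |φ x|) ^ (s + 1)) (x₀ := 0)
    (Metric.closedBall_mem_nhds (0 : ℝ) one_pos)
    (Filter.Eventually.of_forall fun t =>
      ((hmeas t).abs.pow_const _).aestronglyMeasurable) ?_ ?_ ?_ (hint.const_mul _) ?_
  · have h2 := key.2
    rw [integral_const_mul] at h2
    refine h2.congr_deriv ?_
    congr 2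
    ext x
    rw [zero_mul, add_zero, abs_of_nonneg (h.nonneg x)]
  · refine hint.mono' ((hmeas 0).abs.pow_const _).aestronglyMeasurable
      (Filter.Eventually.of_forall fun x => ?_)
    rw [zero_mul, add_zero, Real.norm_of_nonneg (by positivity), abs_of_nonneg (h.nonneg x)]
    have := h.nonneg x
    have : 0 ≤ s + 1 := by linarith
    gcongr
    linarith [abs_nonneg (φ x)]
  · exact (((((hmeas 0).abs.pow_const _).mul (hmeas 0)).mul
      hφ.contDiff.continuous.measurable).const_mul _).aestronglyMeasurable
  · refine Filter.Eventually.of_forall fun x t ht => ?_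
    rw [norm_mul, Real.norm_of_nonneg (show 0 ≤ s + 1 by linarith)]
    have : 0 ≤ s + 1 := by linarith
    gcongr
    refine abs_rpow_mul_le h1.le (h.nonneg x) ?_
    simpa using ht
  · refine Filter.Eventually.of_forall fun x t _ => ?_
    have e1 := hasDerivAt_abs_rpow (v x + t * φ x) (show 1 < s + 1 by linarith)
    have e2 : HasDerivAt (fun t : ℝ => v x + t * φ x) (φ x) t := by
      simpa using ((hasDerivAt_id t).mul_const (φ x)).const_add (v x)
    refine (e1.comp t e2).congr_deriv ?_
    rw [show s + 1 - 2 = s - 1 by ring]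
    ring

theorem hasDerivAt_kinetic (u w : H1) :
    HasDerivAt (fun t : ℝ => kinetic (u + (t : ℂ) • w))
      (2 * (inner ℂ (grad w) (grad u)).re) 0 := by
  have h1 : ∀ t : ℝ, kinetic (u + (t : ℂ) • w)
      = t ^ 2 * kinetic w + t * (2 * (inner ℂ (grad w) (grad u)).re) + kinetic u := by
    intro t
    have e1 : grad (u + (t : ℂ) • w) = (t : ℂ) • grad w + grad u := add_comm _ _
    rw [kinetic_eq_norm_sq, kinetic_eq_norm_sq, kinetic_eq_norm_sq, e1, norm_add_sq (𝕜 := ℂ),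
      norm_smul, inner_smul_left, Complex.norm_real, mul_pow, Real.norm_eq_abs, sq_abs,
      Complex.conj_ofReal]
    simp only [RCLike.re_to_complex, Complex.re_ofReal_mul]
    ring
  simp only [h1]
  have h2 := (((hasDerivAt_pow 2 (0 : ℝ)).mul_const (kinetic w)).add
    ((hasDerivAt_id (0 : ℝ)).mul_const (2 * (inner ℂ (grad w) (grad u)).re))).add_const (kinetic u)
  refine h2.congr_deriv ?_
  simp

/-- A derivative vanishes at a point that is a minimum up to a small multiple of another
differentiable function that vanishes there. -/
theorem hasDerivAt_eq_zero_of_approx_min {e P : ℝ → ℝ} {D D' : ℝ} (he : HasDerivAt e D 0)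
    (hP : HasDerivAt P D' 0) (hP0 : P 0 = 0)
    (h : ∀ η > 0, ∀ᶠ t in nhds 0, e 0 ≤ e t + η * |P t|) : D = 0 := by
  have hsl := hasDerivAt_iff_tendsto_slope.1 he
  have hslP := hasDerivAt_iff_tendsto_slope.1 hP
  have hb : ∀ η > 0, |D| ≤ η * |D'| := by
    intro η hη
    have hR : nhdsWithin (0 : ℝ) (Set.Ioi 0) ≤ nhdsWithin 0 {0}ᶜ :=
      nhdsWithin_mono _ fun x hx => ne_of_gt hx
    have hL : nhdsWithin (0 : ℝ) (Set.Iio 0) ≤ nhdsWithin 0 {0}ᶜ :=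
      nhdsWithin_mono _ fun x hx => ne_of_lt hx
    rw [abs_le]
    constructor
    · refine le_of_tendsto_of_tendsto (((hslP.mono_left hR).abs.const_mul η).neg)
        (hsl.mono_left hR) ?_
      filter_upwards [self_mem_nhdsWithin, nhdsWithin_le_nhds (h η hη)] with t ht0 ht
      have ht0' : 0 < t := ht0
      rw [slope_def_field, slope_def_field, hP0, sub_zero, sub_zero, abs_div, abs_of_pos ht0',
        ← mul_div_assoc, ← neg_div]
      gcongr
      linarith
    · refine le_of_tendsto_of_tendsto (hsl.mono_left hL)
        ((hslP.mono_left hL).abs.const_mul η) ?_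
      filter_upwards [self_mem_nhdsWithin, nhdsWithin_le_nhds (h η hη)] with t ht0 ht
      have ht0' : t < 0 := ht0
      rw [slope_def_field, slope_def_field, hP0, sub_zero, sub_zero, abs_div, abs_of_neg ht0',
        ← mul_div_assoc, ← neg_div_neg_eq]
      have : 0 ≤ -t := by linarith
      gcongr
      linarith
  by_contra hD
  have hD0 : 0 < |D| := abs_pos.2 hD
  have h1 := hb (|D| / (2 * (|D'| + 1))) (by positivity)
  have h2 : |D| / (2 * (|D'| + 1)) * |D'| ≤ |D| / 2 := by
    rw [div_mul_eq_mul_div, div_le_div_iff₀ (by positivity) two_pos]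
    nlinarith [abs_nonneg D']
  linarith

/-- Along a variation of a minimizer on the Pohozaev set, small dilations lead back to this set, so
that the energy is minimal up to an error controlled by the Pohozaev functional. -/
theorem eventually_energy_le_of_minimizer {p q : ℝ} (hp : 7 / 3 < p) (hp5 : p < 5) (hq : 1 < q)
    (hqp : q < p) {u w : H1} (hu : fn u ≠ 0) (hQ : pohozaev p q u = 0) {r : ℝ}
    (hur : ‖fn u‖ < r) (hmin : ∀ z : H1, fn z ≠ 0 → ‖fn z‖ ≤ r → pohozaev p q z = 0 →
      energy p q u ≤ energy p q z) {η : ℝ} (hη : 0 < η) :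
    ∀ᶠ t : ℝ in nhds 0, energy p q u ≤ energy p q (u + (t : ℂ) • w)
      + η * |pohozaev p q (u + (t : ℂ) • w)| := by
  have hp1 : 1 ≤ p := by linarith
  have hcont : Continuous fun t : ℝ => u + (t : ℂ) • w :=
    continuous_const.add (Complex.continuous_ofReal.smul continuous_const)
  have h0 : u + ((0 : ℝ) : ℂ) • w = u := by simp
  have hg : ∀ᶠ τ : ℝ in nhds 0, |(Real.exp (3 * (p - 1) / 2 * τ) - 1) / (3 * (p - 1) / 2)| < η := by
    have hgc : Continuous fun τ : ℝ =>
        |(Real.exp (3 * (p - 1) / 2 * τ) - 1) / (3 * (p - 1) / 2)| := by fun_prop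
    refine (hgc.tendsto 0).eventually (gt_mem_nhds ?_)
    simpa using hη
  obtain ⟨δ', hδ'0, hδ'⟩ := Metric.eventually_nhds_iff.1 hg
  set δ := δ' / 2 with hδ
  have hδ0 : 0 < δ := by positivity
  have hd : ∀ τ : ℝ, Continuous fun t : ℝ => pohozaev p q (dilate τ (u + (t : ℂ) • w)) := by
    intro τ
    have c1 := continuous_kinetic.comp hcont
    have c2 := (continuous_potential hq (by linarith)).comp hcont
    have c3 := (continuous_potential (by linarith) hp5).comp hcont
    simp only [pohozaev_dilate hp1 hq.le]
    exact ((c1.const_mul _).add (((c2.const_mul _).const_mul _).const_mul _)).sub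
      (((c3.const_mul _).const_mul _).const_mul _)
  have e1 : ∀ᶠ t : ℝ in nhds 0, pohozaev p q (dilate δ (u + (t : ℂ) • w)) < 0 := by
    refine ((hd δ).tendsto 0).eventually (gt_mem_nhds ?_)
    rw [h0]
    exact pohozaev_dilate_neg hp hq hqp hu hQ hδ0
  have e2 : ∀ᶠ t : ℝ in nhds 0, 0 < pohozaev p q (dilate (-δ) (u + (t : ℂ) • w)) := by
    refine ((hd (-δ)).tendsto 0).eventually (lt_mem_nhds ?_)
    rw [h0]
    exact pohozaev_dilate_pos hp hq hqp hu hQ (by linarith)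
  have e3 : ∀ᶠ t : ℝ in nhds 0, ‖fn (u + (t : ℂ) • w)‖ < r := by
    refine ((continuous_fn.comp hcont).norm.tendsto 0).eventually (gt_mem_nhds ?_)
    dsimp only [Function.comp_apply]
    rwa [h0]
  have e4 : ∀ᶠ t : ℝ in nhds 0, 0 < ‖fn (u + (t : ℂ) • w)‖ := by
    refine ((continuous_fn.comp hcont).norm.tendsto 0).eventually (lt_mem_nhds ?_)
    dsimp only [Function.comp_apply]
    rw [h0]
    exact norm_pos_iff.2 hu
  filter_upwards [e1, e2, e3, e4] with t h1 h2 h3 h4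
  obtain ⟨τ, hτ, hτ0⟩ := intermediate_value_Icc' (show -δ ≤ δ by linarith)
    (continuous_pohozaev_dilate hq hqp hp5 (u + (t : ℂ) • w)).continuousOn ⟨h1.le, h2.le⟩
  have h5 := hmin (dilate τ (u + (t : ℂ) • w))
    (norm_pos_iff.1 (by rw [norm_fn_dilate]; exact h4)) (by rw [norm_fn_dilate]; exact h3.le) hτ0
  have h6 := energy_dilate_le hp hq hqp τ (u + (t : ℂ) • w)
  refine h5.trans (h6.trans (add_le_add_right ?_ _))
  refine (le_abs_self _).trans ?_
  rw [abs_mul]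
  gcongr
  refine (hδ' ?_).le
  rw [Real.dist_eq, sub_zero]
  have := abs_le.2 hτ
  linarith

theorem integral_grad_mul_eq_inner {u w : H1} {φ : R3 → ℝ}
    (hw : ∀ᵐ x, ∀ i, grad w x i = (partialDeriv i φ x : ℂ)) :
    ∫ x, ∑ i : Fin 3, grad u x i * (partialDeriv i φ x : ℂ) = inner ℂ (grad w) (grad u) := by
  rw [L2.inner_def]
  refine integral_congr_ae ?_
  filter_upwards [hw] with x hx
  rw [PiLp.inner_apply]
  refine Finset.sum_congr rfl fun i _ => ?_
  rw [hx i, RCLike.inner_apply, RCLike.conj_eq_iff_im.2 (by simp)]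

/-- Integration by parts, once more, in the weak form of the equation. -/
theorem integral_grad_mul_eq {u : H1} {v φ : R3 → ℝ} (h : ∀ᵐ x, fn u x = (v x : ℂ))
    (hφ : IsTest φ) : ∫ x, ∑ i : Fin 3, grad u x i * (partialDeriv i φ x : ℂ)
      = ((-∫ x, v x * ∑ i : Fin 3, partialDeriv i (partialDeriv i φ) x : ℝ) : ℂ) := by
  have hu : MemLp (fun x => (v x : ℂ)) 2 volume := (fn_memLp u).ae_eq h
  have hi1 : ∀ i, Integrable fun x => grad u x i * (partialDeriv i φ x : ℂ) := fun i =>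
    (memLp_coord (grad u) i).integrable_mul (hφ.partialDeriv_memLp i)
  have hi2 : ∀ i, Integrable fun x =>
      (v x : ℂ) * (partialDeriv i (partialDeriv i φ) x : ℂ) := fun i =>
    hu.integrable_mul ((hφ.partialDeriv i).partialDeriv_memLp i)
  rw [integral_finsetSum _ fun i _ => hi1 i]
  have h1 : ∀ i, ∫ x, grad u x i * (partialDeriv i φ x : ℂ)
      = -∫ x, (v x : ℂ) * (partialDeriv i (partialDeriv i φ) x : ℂ) := by
    intro i
    have h2 : ∫ x, fn u x * (partialDeriv i (partialDeriv i φ) x : ℂ)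
      = -∫ x, grad u x i * (partialDeriv i φ x : ℂ) := u.2 _ (hφ.partialDeriv i) i
    rw [← neg_eq_iff_eq_neg, ← h2]
    refine integral_congr_ae ?_
    filter_upwards [h] with x hx
    rw [hx]
  simp only [h1]
  rw [Finset.sum_neg_distrib, ← integral_finsetSum _ fun i _ => hi2 i, Complex.ofReal_neg,
    ← integral_complex_ofReal]
  congr 2
  ext x
  push_cast
  rw [Finset.mul_sum]

/-- The Euler-Lagrange equation of a minimizer in the interior of the mass constraint, integrated by
parts twice. The Pohozaev constraint contributes no multiplier. -/
theorem energy_variation {p q : ℝ} (hp : 7 / 3 < p) (hp5 : p < 5) (hq : 1 < q) (hqp : q < p)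
    {u : H1} {v : R3 → ℝ} (hv : HasProfile u v) (hu : fn u ≠ 0) (hQ : pohozaev p q u = 0) {r : ℝ}
    (hur : ‖fn u‖ < r) (hmin : ∀ z : H1, fn z ≠ 0 → ‖fn z‖ ≤ r → pohozaev p q z = 0 →
      energy p q u ≤ energy p q z) {φ : R3 → ℝ} (hφ : IsTest φ) :
    (-∫ x, v x * ∑ i : Fin 3, partialDeriv i (partialDeriv i φ) x)
      + (∫ x, v x ^ (q - 1) * v x * φ x) - ∫ x, v x ^ (p - 1) * v x * φ x = 0 := by
  have hp0 : p + 1 ≠ 0 := by linarith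
  have hq0 : q + 1 ≠ 0 := by linarith
  obtain ⟨w, hw1, hw2⟩ := exists_H1_of_isTest hφ
  have dK := hasDerivAt_kinetic u w
  have dq := hasDerivAt_potential hv hφ hw1 hq (by linarith)
  have dp := hasDerivAt_potential hv hφ hw1 (show 1 < p by linarith) hp5.le
  have hE : HasDerivAt (fun t : ℝ => energy p q (u + (t : ℂ) • w)) _ 0 :=
    ((dK.const_mul (1 / 2)).add (dq.const_mul (1 / (q + 1)))).sub (dp.const_mul (1 / (p + 1)))
  have hP : HasDerivAt (fun t : ℝ => pohozaev p q (u + (t : ℂ) • w)) _ 0 :=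
    (dK.add ((dq.const_mul (1 / (q + 1))).const_mul (3 * (q - 1) / 2))).sub
      ((dp.const_mul (1 / (p + 1))).const_mul (3 * (p - 1) / 2))
  have h0 : u + ((0 : ℝ) : ℂ) • w = u := by simp
  have h1 := hasDerivAt_eq_zero_of_approx_min hE hP (by rw [h0, hQ]) fun η hη => by
    have := eventually_energy_le_of_minimizer hp hp5 hq hqp (w := w) hu hQ hur hmin hη
    simpa only [h0] using this
  rw [← integral_grad_mul_eq_inner hw2, integral_grad_mul_eq hv.eq hφ, Complex.ofReal_re,
    ← mul_assoc (1 / (q + 1)), one_div_mul_cancel hq0, ← mul_assoc (1 / (p + 1)),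
    one_div_mul_cancel hp0] at h1
  linarith

theorem isZeroMassSolution_of_variation {p q : ℝ} {u : H1} {v : R3 → ℝ} (hv : HasProfile u v)
    (h : ∀ φ, IsTest φ → (-∫ x, v x * ∑ i : Fin 3, partialDeriv i (partialDeriv i φ) x)
      + (∫ x, v x ^ (q - 1) * v x * φ x) - ∫ x, v x ^ (p - 1) * v x * φ x = 0) :
    IsZeroMassSolution p q u := by
  intro φ hφ
  have h1 : ∀ s : ℝ, ∫ x, ((‖fn u x‖ ^ (s - 1) : ℝ) : ℂ) * fn u x * (φ x : ℂ)
      = ((∫ x, v x ^ (s - 1) * v x * φ x : ℝ) : ℂ) := by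
    intro s
    rw [← integral_complex_ofReal]
    refine integral_congr_ae ?_
    filter_upwards [hv.eq] with x hx
    rw [hx, Complex.norm_real, Real.norm_of_nonneg (hv.nonneg x)]
    push_cast
    ring
  rw [integral_grad_mul_eq hv.eq hφ, h1, h1, ← Complex.ofReal_add, ← Complex.ofReal_sub, h φ hφ,
    Complex.ofReal_zero]

/-! ### Positivity -/

theorem hasDerivAt_expNegInvGlue (s : ℝ) :
    HasDerivAt expNegInvGlue (s⁻¹ ^ 2 * expNegInvGlue s) s := by
  simpa using expNegInvGlue.hasDerivAt_polynomial_eval_inv_mul 1 s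

theorem hasDerivAt_inv_sq_mul_expNegInvGlue (s : ℝ) :
    HasDerivAt (fun s => s⁻¹ ^ 2 * expNegInvGlue s)
      (s⁻¹ ^ 2 * (s⁻¹ ^ 2 - 2 * s⁻¹) * expNegInvGlue s) s := by
  have h := expNegInvGlue.hasDerivAt_polynomial_eval_inv_mul (Polynomial.X ^ 2) s
  simpa only [Polynomial.eval_mul, Polynomial.eval_sub, Polynomial.eval_pow, Polynomial.eval_X,
    Polynomial.derivative_X_pow, Polynomial.eval_C, Nat.add_one_sub_one, pow_one,
    Nat.cast_ofNat] using h

theorem hasFDerivAt_comp_norm_sq {f : ℝ → ℝ} {f' ρ : ℝ} {x : R3}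
    (hf : HasDerivAt f f' (‖x‖ ^ 2 - ρ)) :
    HasFDerivAt (fun x : R3 => f (‖x‖ ^ 2 - ρ)) (f' • (2 • innerSL ℝ x)) x :=
  hf.comp_hasFDerivAt x ((hasStrictFDerivAt_norm_sq x).hasFDerivAt.sub_const ρ)

theorem innerSL_single (x : R3) (i : Fin 3) :
    innerSL ℝ x (EuclideanSpace.single i 1) = x i := by
  simp [EuclideanSpace.inner_single_right]

/-- The Laplacian of `x ↦ f (|x|² - ρ)` for `f = expNegInvGlue`. -/
theorem sum_partialDeriv_expNegInvGlue (ρ : ℝ) (x : R3) :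
    ∑ i : Fin 3, partialDeriv i (partialDeriv i fun x => expNegInvGlue (‖x‖ ^ 2 - ρ)) x
      = ((‖x‖ ^ 2 - ρ)⁻¹ ^ 2 * (((‖x‖ ^ 2 - ρ)⁻¹ ^ 2 - 2 * (‖x‖ ^ 2 - ρ)⁻¹) * (4 * ‖x‖ ^ 2) + 6))
        * expNegInvGlue (‖x‖ ^ 2 - ρ) := by
  have h1 : ∀ i : Fin 3, (partialDeriv i fun x => expNegInvGlue (‖x‖ ^ 2 - ρ))
      = fun x => ((fun s => s⁻¹ ^ 2 * expNegInvGlue s) (‖x‖ ^ 2 - ρ)) * (2 * x i) := by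
    intro i
    ext y
    rw [partialDeriv, (hasFDerivAt_comp_norm_sq (hasDerivAt_expNegInvGlue _)).fderiv]
    simp only [_root_.smul_apply, innerSL_single, smul_eq_mul, nsmul_eq_mul]
    push_cast
    ring
  have h2 : ∀ i : Fin 3, partialDeriv i (partialDeriv i fun x => expNegInvGlue (‖x‖ ^ 2 - ρ)) x
      = (‖x‖ ^ 2 - ρ)⁻¹ ^ 2 * ((‖x‖ ^ 2 - ρ)⁻¹ ^ 2 - 2 * (‖x‖ ^ 2 - ρ)⁻¹)
          * expNegInvGlue (‖x‖ ^ 2 - ρ) * (4 * (x i) ^ 2)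
        + 2 * ((‖x‖ ^ 2 - ρ)⁻¹ ^ 2 * expNegInvGlue (‖x‖ ^ 2 - ρ)) := by
    intro i
    rw [h1 i, partialDeriv]
    have e1 := hasFDerivAt_comp_norm_sq (x := x) (ρ := ρ) (hasDerivAt_inv_sq_mul_expNegInvGlue _)
    have e2 : HasFDerivAt (fun x : R3 => 2 * x i)
        ((2 : ℝ) • (EuclideanSpace.proj i : R3 →L[ℝ] ℝ)) x :=
      (EuclideanSpace.proj i : R3 →L[ℝ] ℝ).hasFDerivAt.const_mul 2
    have hproj : (EuclideanSpace.proj i : R3 →L[ℝ] ℝ) (EuclideanSpace.single i 1) = 1 := by simp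
    refine (congrArg (fun A : R3 →L[ℝ] ℝ => A (EuclideanSpace.single i 1))
      (e1.mul e2).fderiv).trans ?_
    simp only [_root_.add_apply, _root_.smul_apply, innerSL_single, smul_eq_mul, nsmul_eq_mul,
      hproj]
    push_cast
    ring
  simp only [h2]
  rw [Finset.sum_add_distrib, ← Finset.mul_sum, ← Finset.mul_sum, ← EuclideanSpace.real_norm_sq_eq]
  simp only [Finset.sum_const, Finset.card_univ, Fintype.card_fin, nsmul_eq_mul]
  push_cast
  ring

/-- A test function that is subharmonic to any prescribed degree in a thin shell at the inside of
the sphere of radius `R`, and vanishes inside that shell. -/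
theorem exists_barrier {R : ℝ} (hR : 0 < R) {C : ℝ} (hC : 0 ≤ C) : ∃ (φ : R3 → ℝ) (ρ : ℝ),
    IsTest φ ∧ R / 2 ≤ ρ ∧ ρ < R ∧ (∀ x, 0 ≤ φ x) ∧
    (∀ x, ‖x‖ ≤ ρ → φ x = 0 ∧ ∑ i : Fin 3, partialDeriv i (partialDeriv i φ) x = 0) ∧
    ∀ x, ρ < ‖x‖ → ‖x‖ < R →
      C * φ x < ∑ i : Fin 3, partialDeriv i (partialDeriv i φ) x := by
  -- the barrier is `exp (-1/s)` with `s = ‖x‖² - ρ²`; its Laplacian has the factor `s⁻¹`, which for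
  -- `s < σ` is at least `2` and at least `C`, while `σ ≤ R² / 2` keeps `ρ` away from the origin
  set σ : ℝ := min (1 / 2) (min (R ^ 2 / 2) (1 / (C + 1))) with hσ
  have hσ0 : 0 < σ := lt_min (by norm_num) (lt_min (by positivity) (by positivity))
  have hσ1 : σ ≤ 1 / 2 := min_le_left _ _
  have hσ2 : σ ≤ R ^ 2 / 2 := (min_le_right _ _).trans (min_le_left _ _)
  have hσ3 : σ ≤ 1 / (C + 1) := (min_le_right _ _).trans (min_le_right _ _)
  have hσC : σ * C ≤ 1 := by
    calc σ * C ≤ 1 / (C + 1) * (C + 1) := by gcongr; linarith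
      _ = 1 := by field_simp
  set ρ : ℝ := √(R ^ 2 - σ) with hρ
  have hρ2 : ρ ^ 2 = R ^ 2 - σ := Real.sq_sqrt (by nlinarith)
  have hρ0 : 0 ≤ ρ := Real.sqrt_nonneg _
  have hρR : ρ < R := lt_of_pow_lt_pow_left₀ 2 hR.le (by rw [hρ2]; linarith)
  have hρ3 : R / 2 ≤ ρ := le_of_sq_le_sq (by rw [hρ2]; nlinarith) hρ0
  let χ : ContDiffBump (0 : R3) := ⟨R, R + 1, hR, by linarith⟩
  set g : R3 → ℝ := fun x => expNegInvGlue (‖x‖ ^ 2 - ρ ^ 2) with hg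
  have hgs : ContDiff ℝ ∞ g :=
    expNegInvGlue.contDiff.comp ((contDiff_norm_sq ℝ).sub contDiff_const)
  set φ : R3 → ℝ := fun x => g x * χ x with hφ
  have hφT : IsTest φ := ⟨hgs.mul χ.contDiff, χ.hasCompactSupport.mul_left (f := g)⟩
  have hloc : ∀ x, ‖x‖ < R → φ =ᶠ[nhds x] g := by
    intro x hx
    filter_upwards [χ.eventuallyEq_one_of_mem_ball (x := x) (by simpa [χ] using hx)] with y hy
    simp only [hφ, hy, Pi.one_apply, mul_one]
  have hpart : ∀ (a b : R3 → ℝ) (x : R3) (i : Fin 3), a =ᶠ[nhds x] b →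
      partialDeriv i a =ᶠ[nhds x] partialDeriv i b := by
    intro a b x i hab
    filter_upwards [hab.fderiv (𝕜 := ℝ)] with y hy
    rw [partialDeriv, partialDeriv, hy]
  have hlap : ∀ x, ‖x‖ < R → ∑ i : Fin 3, partialDeriv i (partialDeriv i φ) x
      = ∑ i : Fin 3, partialDeriv i (partialDeriv i g) x := fun x hx =>
    Finset.sum_congr rfl fun i _ => (hpart _ _ x i (hpart _ _ x i (hloc x hx))).self_of_nhds
  refine ⟨φ, ρ, hφT, hρ3, hρR, fun x => mul_nonneg (expNegInvGlue.nonneg _) χ.nonneg,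
    fun x hx => ?_, fun x hx hxR => ?_⟩
  · have h1 : expNegInvGlue (‖x‖ ^ 2 - ρ ^ 2) = 0 :=
      expNegInvGlue.zero_of_nonpos (by have : ‖x‖ ^ 2 ≤ ρ ^ 2 := by gcongr
                                       linarith)
    constructor
    · simp only [hφ, hg, h1, zero_mul]
    · rw [hlap x (hx.trans_lt hρR), hg, sum_partialDeriv_expNegInvGlue, h1, mul_zero]
  · rw [hlap x hxR, (hloc x hxR).self_of_nhds, hg, sum_partialDeriv_expNegInvGlue]
    have hs0 : 0 < ‖x‖ ^ 2 - ρ ^ 2 := by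
      have : ρ ^ 2 < ‖x‖ ^ 2 := by gcongr
      linarith
    have hsσ : ‖x‖ ^ 2 - ρ ^ 2 < σ := by
      have : ‖x‖ ^ 2 < R ^ 2 := by gcongr
      linarith
    set s := ‖x‖ ^ 2 - ρ ^ 2 with hs
    have hf := expNegInvGlue.pos_of_pos hs0
    have hsi : 2 ≤ s⁻¹ := by
      rw [le_inv_comm₀ two_pos hs0]
      linarith
    have hCs : C ≤ s⁻¹ := by
      rw [← one_div, le_div_iff₀ hs0]
      nlinarith
    refine mul_lt_mul_of_pos_right ?_ hf
    have h1 : 0 ≤ (s⁻¹ ^ 2 - 2 * s⁻¹) * (4 * ‖x‖ ^ 2) :=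
      mul_nonneg (by nlinarith) (by positivity)
    have h2 : s⁻¹ ≤ s⁻¹ ^ 2 := by nlinarith
    nlinarith

theorem ae_ne_norm (R : ℝ) : ∀ᵐ x : R3, ‖x‖ ≠ R := by
  have h : volume (Metric.sphere (0 : R3) R) = 0 := Measure.addHaar_sphere _ _ _
  rw [ae_iff]
  simp only [not_not]
  convert h using 2
  ext x
  simp

/-- A radially decreasing solution that vanishes outside a ball vanishes identically: test the
equation against a barrier at the boundary of its support. -/
theorem HasProfile.pos {p q : ℝ} (hp : 1 < p) (hp5 : p < 5) (hq : 1 < q) (hqp : q < p) {u : H1}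
    {v : R3 → ℝ} (hv : HasProfile u v) (hu : fn u ≠ 0)
    (h : ∀ φ, IsTest φ → (-∫ x, v x * ∑ i : Fin 3, partialDeriv i (partialDeriv i φ) x)
      + (∫ x, v x ^ (q - 1) * v x * φ x) - ∫ x, v x ^ (p - 1) * v x * φ x = 0) :
    ∀ᵐ x, 0 < v x := by
  obtain ⟨L, hL, hLv⟩ := hv.radial
  by_contra hneg
  set Z : Set ℝ := norm '' {x | x ∈ L ∧ v x = 0} with hZ
  have hZne : Z.Nonempty := by
    by_contra hZe
    rw [Set.not_nonempty_iff_eq_empty] at hZe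
    refine hneg ?_
    filter_upwards [hL] with x hx
    refine (hv.nonneg x).lt_of_ne fun h0 => ?_
    have : ‖x‖ ∈ Z := ⟨x, ⟨hx, h0.symm⟩, rfl⟩
    rw [hZe] at this
    exact this
  have hZb : BddBelow Z := ⟨0, by rintro _ ⟨x, -, rfl⟩; exact norm_nonneg x⟩
  set R : ℝ := sInf Z with hRdef
  have hout : ∀ x ∈ L, R < ‖x‖ → v x = 0 := by
    intro x hx hxR
    obtain ⟨_, ⟨y, ⟨hy, hy0⟩, rfl⟩, hyx⟩ := exists_lt_of_csInf_lt hZne hxR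
    have := hLv y hy x hx hyx.le
    rw [hy0] at this
    exact le_antisymm this (hv.nonneg x)
  have hin : ∀ x ∈ L, ‖x‖ < R → 0 < v x := fun x hx hxR =>
    (hv.nonneg x).lt_of_ne fun h0 => not_le.2 hxR (csInf_le hZb ⟨x, ⟨hx, h0.symm⟩, rfl⟩)
  have hR : 0 < R := by
    refine lt_of_le_of_ne (le_csInf hZne (by rintro _ ⟨x, -, rfl⟩; exact norm_nonneg x))
      fun h0 => hu ?_
    rw [Lp.eq_zero_iff_ae_eq_zero]
    filter_upwards [hL, hv.eq, ae_ne_norm 0] with x hx hx2 hx3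
    rw [hx2, hout x hx (by rw [← h0]; exact lt_of_le_of_ne (norm_nonneg x) (Ne.symm hx3))]
    simp
  -- the bound for `v` on the shell where the barrier lives
  obtain ⟨x₀, hx₀L, hx₀⟩ : ∃ x₀ ∈ L, ‖x₀‖ < R / 2 := by
    by_contra! hno
    have h1 : volume (Metric.ball (0 : R3) (R / 2)) = 0 := by
      refine measure_mono_null (fun x hx => ?_) (ae_iff.1 hL)
      exact fun hxL => absurd (hno x hxL) (not_le.2 (by simpa using hx))
    exact (Metric.measure_ball_pos volume (0 : R3) (by positivity)).ne' h1
  set C : ℝ := v x₀ ^ (q - 1) with hCdef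
  have hC0 : 0 ≤ C := Real.rpow_nonneg (hv.nonneg _) _
  obtain ⟨φ, ρ, hφ, hρ1, hρ2, hφ0, hφin, hφsh⟩ := exists_barrier hR hC0
  set Δ : R3 → ℝ := fun x => ∑ i : Fin 3, partialDeriv i (partialDeriv i φ) x with hΔ
  have hi1 : Integrable fun x => v x * Δ x := by
    have hvL : MemLp v 2 volume := by
      refine (memLp_norm_iff hv.meas.aestronglyMeasurable).1 ?_
      refine (fn_memLp u).norm.ae_eq ?_
      filter_upwards [hv.eq] with x hx
      rw [hx, Complex.norm_real]
    have hΔL : MemLp Δ 2 volume := by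
      refine memLp_finsetSum _ fun i _ => ?_
      have hT := (hφ.partialDeriv i).partialDeriv i
      exact hT.contDiff.continuous.memLp_of_hasCompactSupport hT.hasCompactSupport
    exact hvL.integrable_mul hΔL
  have hiq := integrable_rpow_mul hv hφ hq.le (by linarith)
  have hip := integrable_rpow_mul hv hφ hp.le hp5.le
  set F : R3 → ℝ := fun x => v x * Δ x - v x ^ (q - 1) * v x * φ x + v x ^ (p - 1) * v x * φ x
    with hF
  have hFi : Integrable F := (hi1.sub hiq).add hip
  have hFint : ∫ x, F x = 0 := by
    have e1 : ∫ x, F x = (∫ x, (v x * Δ x - v x ^ (q - 1) * v x * φ x))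
        + ∫ x, v x ^ (p - 1) * v x * φ x := integral_add (hi1.sub hiq) hip
    rw [e1, integral_sub hi1 hiq]
    linarith [h φ hφ]
  have hFsh : ∀ x ∈ L, ρ < ‖x‖ → ‖x‖ < R → 0 < F x := by
    intro x hx hxρ hxR
    have hvx := hin x hx hxR
    have h1 : v x ≤ v x₀ := hLv x₀ hx₀L x hx (by linarith)
    have h2 : v x ^ (q - 1) ≤ C := Real.rpow_le_rpow hvx.le h1 (by linarith)
    have h3 := hφsh x hxρ hxR
    have h4 : v x ^ (q - 1) * φ x ≤ C * φ x := mul_le_mul_of_nonneg_right h2 (hφ0 x)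
    have h5 : 0 < v x * (Δ x - v x ^ (q - 1) * φ x) := mul_pos hvx (by linarith)
    have h6 : 0 ≤ v x ^ (p - 1) * v x * φ x := by
      have := hφ0 x
      positivity
    simp only [hF]
    linarith
  have hF0 : 0 ≤ᵐ[volume] F := by
    filter_upwards [hL, ae_ne_norm R] with x hx hxR
    rcases le_or_gt ‖x‖ ρ with h1 | h1
    · have h2 := hφin x h1
      simp only [hF, hΔ, h2.1, h2.2, mul_zero, sub_zero, add_zero, Pi.zero_apply, le_refl]
    rcases lt_or_gt_of_ne hxR with h2 | h2
    · exact (hFsh x hx h1 h2).le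
    · simp only [hF, hout x hx h2, mul_zero, zero_mul, sub_zero, add_zero, Pi.zero_apply, le_refl]
  have hFz := (integral_eq_zero_iff_of_nonneg_ae hF0 hFi).1 hFint
  -- the shell has positive measure
  have hopen : IsOpen {x : R3 | ρ < ‖x‖ ∧ ‖x‖ < R} :=
    (isOpen_lt continuous_const continuous_norm).inter (isOpen_lt continuous_norm continuous_const)
  have hne : {x : R3 | ρ < ‖x‖ ∧ ‖x‖ < R}.Nonempty := by
    refine ⟨EuclideanSpace.single 0 ((ρ + R) / 2), ?_⟩
    have : ‖(EuclideanSpace.single 0 ((ρ + R) / 2) : R3)‖ = (ρ + R) / 2 := by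
      rw [PiLp.norm_single, Real.norm_of_nonneg (by linarith)]
    rw [Set.mem_ofPred_eq, this]
    constructor <;> linarith
  refine (hopen.measure_pos volume hne).ne' (measure_mono_null (fun x hx => ?_)
    (ae_iff.1 (hL.and hFz)))
  rintro ⟨hxL, hx0⟩
  exact (hFsh x hxL hx.1 hx.2).ne' hx0

theorem HasProfile.isRadial {u : H1} {v : R3 → ℝ} (hv : HasProfile u v) : IsRadial u := by
  obtain ⟨L, hL, hLv⟩ := hv.radial
  classical
  refine ⟨fun t => if h : ∃ x ∈ L, ‖x‖ = t then (v h.choose : ℂ) else 0, ?_⟩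
  filter_upwards [hL, hv.eq] with x hx hx2
  have h : ∃ y ∈ L, ‖y‖ = ‖x‖ := ⟨x, hx, rfl⟩
  rw [dif_pos h, hx2]
  congr 1
  exact le_antisymm (hLv _ h.choose_spec.1 x hx h.choose_spec.2.le)
    (hLv x hx _ h.choose_spec.1 h.choose_spec.2.ge)

theorem HasProfile.isPositive {u : H1} {v : R3 → ℝ} (hv : HasProfile u v) (h : ∀ᵐ x, 0 < v x) :
    IsPositive u := by
  filter_upwards [h, hv.eq] with x h1 h2
  rw [h2]
  exact_mod_cast h1

/-! ### Masses where the level does not decrease -/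

/-- If the level at a larger mass is not below the level at `r₁²`, then `r₁²` bounds the mass of a
minimizer on the Pohozaev set, in the interior of the set of masses under comparison. -/
theorem exists_solution_of_level_le {p q : ℝ} (hp : 7 / 3 < p) (hp5 : p < 5) (hq : 1 < q)
    (hqp : q < p) {k₁ k₂ r₁ r₂ : ℝ} (hr₁ : 0 < r₁) (hr : r₁ < r₂)
    (h₁ : MountainPassGeometry p q k₁ (r₁ ^ 2)) (hk₂ : 0 < k₂)
    (hle : level p q k₁ (r₁ ^ 2) ≤ level p q k₂ (r₂ ^ 2)) :
    ∃ u : H1, 0 < ‖fn u‖ ∧ ‖fn u‖ ≤ r₁ ∧ IsPositive u ∧ IsRadial u ∧ IsZeroMassSolution p q u := by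
  obtain ⟨u, v, hv, hu, hur, hQ, hE⟩ := exists_minimizer hp hp5 hq hqp hr₁
    fun ε hε => h₁.exists_pohozaev hp hp5 hq hqp hr₁ hε
  have hvar : ∀ φ, IsTest φ → _ := fun φ hφ =>
    energy_variation hp hp5 hq hqp hv hu hQ (hur.trans_lt hr)
      (fun z hz hzr hzQ => hE.trans (hle.trans
        (level_le_energy_of_norm_le hp hp5 hq hqp hk₂ hz hzr hzQ))) hφ
  exact ⟨u, norm_pos_iff.2 hu, hur,
    hv.isPositive (hv.pos (by linarith) hp5 hq hqp hu hvar), hv.isRadial,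
    isZeroMassSolution_of_variation hv hvar⟩

end CombinedNLS

end

theorem lemma3p7 (p q : ℝ) (hp : 7 / 3 < p) (hp' : p < 5) (hq : 1 < q) (hqp : q < p) :
    (∃ k : ℝ, ∀ r : ℝ, 0 < r → CombinedNLS.MountainPassGeometry p q k (r ^ 2)) ∧
    ∀ k : ℝ → ℝ, (∀ r : ℝ, 0 < r → CombinedNLS.MountainPassGeometry p q (k r) (r ^ 2)) →
      ∀ ρ : ℝ, 0 < ρ →
        ¬ StrictAntiOn (fun r : ℝ => CombinedNLS.level p q (k r) (r ^ 2)) (Set.Ioc 0 ρ) →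
        ∃ ρ₀ ∈ Set.Ioo 0 ρ, ∃ u₀ ∈ CombinedNLS.massSphere (ρ₀ ^ 2),
          CombinedNLS.IsPositive u₀ ∧ CombinedNLS.IsRadial u₀ ∧
            CombinedNLS.IsZeroMassSolution p q u₀ := by
  refine ⟨CombinedNLS.exists_mountainPassGeometry hp hp' hq hqp, fun k hk ρ _ hanti => ?_⟩
  simp only [StrictAntiOn, not_forall, not_lt] at hanti
  obtain ⟨r₁, hr₁, r₂, hr₂, hr, hle⟩ := hanti
  obtain ⟨u, hu0, hur, hpos, hrad, hsol⟩ := CombinedNLS.exists_solution_of_level_le hp hp' hq hqp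
    hr₁.1 hr (hk r₁ hr₁.1) (hk r₂ hr₂.1).pos hle
  exact ⟨‖CombinedNLS.fn u‖, ⟨hu0, hur.trans_lt (hr.trans_le hr₂.2)⟩, u, rfl, hpos, hrad, hsol⟩
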